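/- Let $\mathbb S^2\subset\mathbb R^3$ be the unit sphere with surface measure $dp$ (two-dimensional Hausdorff measure, total mass $4\pi$), and let $\mathcal P(\mathbb S^2)$ be the set of $f\in L^1(\mathbb S^2)$ with $f\ge 0$ a.e. and $\int_{\mathbb S^2} f\,dp=1$. For $\eta\in\mathbb R$ and $f\in\mathcal P(\mathbb S^2)$ put $$\mathcal F(f,\eta)=\int_{\mathbb S^2} f(p)\ln f(p)-f(p)\ln\Big(\int_{\mathbb S^2}\big((p\cdot q)^2-\tfrac13\big)f(q)\,dq-\eta\Big)\,dp\in\mathbb R\cup\{+\infty\},$$ where $-\ln$ is $+\infty$ at non-positive arguments and $0\cdot(+\infty)=0$. For a traceless symmetric real $3\times3$ matrix $Q$ let $A(Q)$ be the set of $f\in\mathcal P(\mathbb S^2)$ with $\int_{\mathbb S^2} (p\otimes p-\frac13 I)f(p)\,dp=Q$, and let $J(Q,\eta)=\inf_{f\in A(Q)}\mathcal F(f,\eta)$ (equal to $+\infty$ if $A(Q)=\emptyset$). A critical point of $J(\cdot,\eta)$ is an interior point $Q$ of $\{J(\cdot,\eta)<+\infty\}$, in the space of traceless symmetric matrices, at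 which $J(\cdot,\eta)$ is differentiable with derivative $0$. An optimal density for $Q$ is an $f\in A(Q)$ with $\mathcal F(f,\eta)=J(Q,\eta)$. For $n\in\mathbb S^2$ and $S\in(-\frac12,1)$ let $Q_{S,n}=S(n\otimes n-\frac13 I)$; this matrix is called prolate if $S>0$ and oblate if $S<0$. For $R\in \mathrm{SO}(3)$ write $[Rf](p)=f(Rp)$. 1. Let $0\le\eta<\frac23$ and $n\in\mathbb S^2$. There is $S\in(0,1)$ which minimises $s\mapsto J(Q_{s,n},\eta)$ over $(0,1)$ and for which the prolate matrix $Q_{S,n}$ is a critical point of $J(\cdot,\eta)$ having an optimal density. 2. Let $\eta_j<\frac23$ with $\eta_j\to\frac23$, let $Q_j$ be a prolate critical point of $J(\cdot,\eta_j)$, and let $f_j$ be an optimal density for $Q_j$ (with parameter $\eta_j$). Then for every $e\in\mathbb S^2$ (in particular for $e=e_1$) there are $R_j\in \mathrm{SO}(3)$ such that $[R_jf_j]\stackrel{*}{\rightharpoonup}\frac12(\delta_e+\delta_{-e})$ in $C(\mathbb S^2)^*$. 3. Let $0\le\eta<\frac16$ and $n\in\mathbb S^2$. There is $S\in(-\frac12,0)$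 which minimises $s\mapsto J(Q_{s,n},\eta)$ over $(-\frac12,0)$ and for which the oblate matrix $Q_{S,n}$ is a critical point of $J(\cdot,\eta)$ having an optimal density. 4. Let $\eta_j<\frac16$ with $\eta_j\to\frac16$, let $Q_j$ be an oblate critical point of $J(\cdot,\eta_j)$, and let $f_j$ be an optimal density for $Q_j$ (with parameter $\eta_j$). Then for every $e\in\mathbb S^2$ there are $R_j\in \mathrm{SO}(3)$ such that $[R_jf_j]\stackrel{*}{\rightharpoonup}\frac1{2\pi}\mathcal H^1\llcorner\{p\in\mathbb S^2: e\cdot p=0\}$ in $C(\mathbb S^2)^*$. -/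

import Mathlib

open Set Filter Topology MeasureTheory
open scoped Matrix

namespace Onsager

/-- Euclidean three-space. -/
abbrev E3 : Type := EuclideanSpace ℝ (Fin 3)

/-- The unit sphere of Euclidean three-space. -/
abbrev S2 : Type := Metric.sphere (0 : E3) 1

/-- Surface area on the unit sphere, of total mass `4π`. -/
noncomputable def sigma : Measure S2 := (volume : Measure E3).toSphere

/-- The space of traceless, symmetric real `3 × 3` matrices. -/
def Sym0 : Submodule ℝ (Matrix (Fin 3) (Fin 3) ℝ) where
  carrier := {A | A.IsSymm ∧ A.trace = 0}
  add_mem' := by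
    rintro A B ⟨hA, hA0⟩ ⟨hB, hB0⟩
    exact ⟨hA.add hB, by rw [Matrix.trace_add, hA0, hB0, add_zero]⟩
  zero_mem' := ⟨Matrix.isSymm_zero, Matrix.trace_zero _ _⟩
  smul_mem' := by
    rintro c A ⟨hA, hA0⟩
    exact ⟨hA.smul c, by rw [Matrix.trace_smul, hA0, smul_zero]⟩

/-- The probability densities on the sphere (with respect to surface area). -/
def IsDensity (f : S2 → ℝ) : Prop :=
  Integrable f sigma ∧ (∀ᵐ p ∂sigma, 0 ≤ f p) ∧ ∫ p, f p ∂sigma = 1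

/-- The Q-tensor `∫ (p ⊗ p - I/3) f(p) dp`. -/
noncomputable def qTensor (f : S2 → ℝ) : Matrix (Fin 3) (Fin 3) ℝ :=
  Matrix.of fun i j =>
    ∫ p : S2, ((p : E3) i * (p : E3) j - (1 / 3) * (1 : Matrix (Fin 3) (Fin 3) ℝ) i j) * f p ∂sigma

/-- The function `-ln`, extended by `+∞` to non-positive arguments. -/
noncomputable def negLog (x : ℝ) : EReal :=
  if 0 < x then ((-Real.log x : ℝ) : EReal) else ⊤

/-- The integral of an extended real function: integral of the positive part minus integral of the
negative part. -/
noncomputable def extIntegral (g : S2 → EReal) : EReal :=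
  ((∫⁻ p, (g p).toENNReal ∂sigma : ENNReal) : EReal)
    - ((∫⁻ p, (-g p).toENNReal ∂sigma : ENNReal) : EReal)

/-- The free energy
`F(f, η) = ∫ f(p) ln f(p) - f(p) ln (∫ ((p · q)² - 1/3) f(q) dq - η) dp`.
In `EReal` one has `0 * ⊤ = 0`. -/
noncomputable def freeEnergy (η : ℝ) (f : S2 → ℝ) : EReal :=
  extIntegral fun p =>
    ((f p * Real.log (f p) : ℝ) : EReal) +
      (f p : EReal) *
        negLog ((∫ q : S2, ((inner ℝ (p : E3) (q : E3)) ^ 2 - 1 / 3) * f q ∂sigma) - η)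

/-- The densities whose Q-tensor is `Q`. -/
def admissible (Q : Sym0) : Set (S2 → ℝ) :=
  {f | IsDensity f ∧ qTensor f = (Q : Matrix (Fin 3) (Fin 3) ℝ)}

/-- The macroscopic function `J(Q, η)`, the infimum of the free energy over the densities with
Q-tensor `Q`. It is `+∞` where there are no such densities, so in particular at every `Q` with an
eigenvalue at most `-1/3`. -/
noncomputable def J (η : ℝ) (Q : Sym0) : EReal :=
  ⨅ f ∈ admissible Q, freeEnergy η f

/-- The effective domain of `J`. -/
def domJ (η : ℝ) : Set Sym0 := {Q | J η Q < ⊤}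

/-- `Q` is a critical point of `J`: an interior point of the effective domain at which the
derivative of `J`, along the space of traceless symmetric matrices, exists and vanishes. -/
def IsCriticalPoint (η : ℝ) (Q : Sym0) : Prop :=
  Q ∈ interior (domJ η) ∧
    HasFDerivAt (fun Q' : Sym0 => (J η Q').toReal) (0 : Sym0 →L[ℝ] ℝ) Q

/-- `f` is an optimal energy density for the Q-tensor `Q`. -/
def IsOptimal (η : ℝ) (Q : Sym0) (f : S2 → ℝ) : Prop :=
  f ∈ admissible Q ∧ freeEnergy η f = J η Q

/-- The uniaxial Q-tensor `S (n ⊗ n - I/3)`. -/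
noncomputable def uniaxialQ (S : ℝ) (n : S2) : Sym0 :=
  ⟨S • (Matrix.of (fun i j => (n : E3) i * (n : E3) j) - (1 / 3 : ℝ) • 1), by
    refine Submodule.smul_mem _ _ ⟨?_, ?_⟩
    · ext i j
      simp [Matrix.one_apply, eq_comm, mul_comm]
    · have h : ‖(n : E3)‖ ^ 2 = 1 := by simp
      rw [EuclideanSpace.real_norm_sq_eq] at h
      simp [Matrix.trace, Fin.sum_univ_three] at h ⊢
      linarith⟩

/-- `Q = S (n ⊗ n - I/3)` for a unit vector `n` and some `0 < S < 1`. -/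
def IsProlate (Q : Sym0) : Prop := ∃ n : S2, ∃ S ∈ Ioo (0 : ℝ) 1, Q = uniaxialQ S n

/-- `Q = S (n ⊗ n - I/3)` for a unit vector `n` and some `-1/2 < S < 0`. -/
def IsOblate (Q : Sym0) : Prop := ∃ n : S2, ∃ S ∈ Ioo (-1 / 2 : ℝ) 0, Q = uniaxialQ S n

/-- The rotation group `SO(3)`. -/
abbrev SO3 : Type := Matrix.specialOrthogonalGroup (Fin 3) ℝ

/-- The action of a rotation on the sphere, `p ↦ R p`. -/
noncomputable def rotate (R : SO3) (p : S2) : S2 :=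
  ⟨WithLp.toLp 2 ((R : Matrix (Fin 3) (Fin 3) ℝ) *ᵥ (p : E3).ofLp), by
    have hR : (R : Matrix (Fin 3) (Fin 3) ℝ)ᵀ * (R : Matrix (Fin 3) (Fin 3) ℝ) = 1 :=
      (Matrix.mem_orthogonalGroup_iff' (Fin 3) ℝ).1
        (Matrix.mem_specialOrthogonalGroup_iff.1 R.2).1
    have h : ‖(p : E3)‖ ^ 2 = 1 := by simp
    have key : ‖WithLp.toLp 2 ((R : Matrix (Fin 3) (Fin 3) ℝ) *ᵥ (p : E3).ofLp)‖ ^ 2 = 1 := by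
      rw [EuclideanSpace.real_norm_sq_eq] at h ⊢
      have e : ∀ v : Fin 3 → ℝ, ∑ i, v i ^ 2 = v ⬝ᵥ v := fun v => by
        simp [dotProduct, sq]
      rw [e] at h
      rw [e, Matrix.dotProduct_mulVec, Matrix.vecMul_mulVec, hR, Matrix.vecMul_one, h]
    rw [mem_sphere_zero_iff_norm]
    exact (pow_eq_one_iff_of_nonneg (norm_nonneg _) two_ne_zero).1 key⟩

/-- The rotated function `[R f](p) = f(R p)`. -/
noncomputable def rotateFun (R : SO3) (f : S2 → ℝ) : S2 → ℝ := fun p => f (rotate R p)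

/-- Weak* convergence in `C(S²)*` of the densities `f j` to the measure `μ`. -/
def WeakStarTendsto (f : ℕ → S2 → ℝ) (μ : Measure S2) : Prop :=
  ∀ g : C(S2, ℝ),
    Tendsto (fun j => ∫ p, f j p * g p ∂sigma) atTop (𝓝 (∫ p, g p ∂μ))

/-- The measure `(δ_e + δ_{-e}) / 2`. -/
noncomputable def antipodalDirac (e : S2) : Measure S2 :=
  (2⁻¹ : ENNReal) • (Measure.dirac e + Measure.dirac (-e))

/-- The normalised one-dimensional Hausdorff measure `(1/2π) H¹` on the great circle orthogonal
to `e`. In dimension one, Mathlib's Hausdorff measure has the usual normalisation. -/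
noncomputable def greatCircleMeasure (e : S2) : Measure S2 :=
  ENNReal.ofReal (1 / (2 * Real.pi)) •
    (Measure.hausdorffMeasure (1 : ℝ) : Measure S2).restrict
      {p : S2 | inner ℝ (e : E3) (p : E3) = 0}

end Onsager

/-!
Every admissible `f` for `Q` has the same argument `w(p) = Q p · p - η` in the logarithm, so at a
fixed `Q` the free energy is the relative entropy of `f` with respect to the measure `w₊ dp`, to be
minimised under the linear constraint that the Q-tensor be `Q`. By Gibbs' variational principle
(`gibbs_le_freeEnergy`, `isOptimal_tilted`) the exponential tilt `Z⁻¹ w₊(p) exp (Λ p · p)`, if it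
meets the constraint, is the only optimal density, and every `Λ` gives the lower bound `gibbsBound`
for `J`, whether or not its tilt meets the constraint. For a uniaxial tensor of parameter
`S ∈ (-1/2, 1)` the mean of `w` under an admissible density is `2 S² / 3 - η`. If this is positive,
an axisymmetric tilt meets the constraint (`exists_tilted_mem_admissible`); otherwise `J = +∞`
(`J_uniaxialQ_eq_top`).

*Differentiability.* At a `Q₀ ≠ 0` whose constraint is met by the tilt with matrix `Λ`, the Gibbs
bound for the same `Λ` is differentiable, because the level set `w = 0` is null. For `Q` near `Q₀`
the tilted density misses the constraint by `O(Q - Q₀)`, which a bounded perturbation supported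
where `w` is bounded below repairs at an energy cost of `O(|Q - Q₀|²)`. So `J` is squeezed between
the Gibbs bound and the Gibbs bound plus `O(|Q - Q₀|²)`, and is differentiable at `Q₀`
(`hasFDerivAt_J`).

*Existence.* At a uniaxial tensor the derivative is `H ↦ k H n · n` by axial symmetry, so that a
minimiser along the uniaxial line is critical (`isCriticalPoint_of_isLocalMin`). Put
`c = √(3 η / 2)`, where the mean of `w` degenerates. On `(c, 1)` and on `(-1/2, -c)` the function
`J` is finite and continuous. It blows up at both ends: at `± c` by a Gibbs bound with tilt
`exp (-k w)`, and at `1` and `-1/2` because a density concentrating on a null set has large entropy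
(`exists_le_freeEnergy_of_concentration`). Hence it attains its minimum (`exists_isCriticalPoint`).

*Saturation.* At a uniaxial critical point `J` is finite, so `S² > 3 η / 2`; as `η` tends to `2/3`
or `1/6` this forces `S → 1` or `S → -1/2`. After a rotation of the axis to `e`, the second moment
`2 (1 - S) / 3` of `1 - (e · p)²`, respectively `(1 + 2 S) / 3` of `(e · p)²`, tends to zero, and
the optimal densities, being the tilted ones, are even functions of `e · p`. Testing against `g` is
therefore the same as testing against its average under `p ↦ -p`, respectively under the reflections
in planes containing `e`. The average is constant on the set where the mass concentrates, which
identifies the limit (`tendsto_integral_of_concentration`). In the oblate case the constant is the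
mean of `g` over the great circle, and the Hausdorff measure `H¹` there has to be compared with arc
length (`greatCircle_eq_map`).
-/

namespace Onsager

open scoped Pointwise

/-! ### The sphere and its isometries -/

instance : IsFiniteMeasure sigma := by unfold sigma; infer_instance

instance : sigma.IsOpenPosMeasure := by unfold sigma; infer_instance

instance : CompactSpace S2 := isCompact_iff_compactSpace.1 (isCompact_sphere _ _)

theorem sigma_univ_pos : 0 < sigma.real univ := by
  have : sigma ≠ 0 := by
    unfold sigma
    exact Measure.toSphere_ne_zero _
  have : NeZero sigma := ⟨this⟩
  exact measureReal_univ_pos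

theorem integrable_of_continuous {g : S2 → ℝ} (hg : Continuous g) : Integrable g sigma :=
  hg.integrable_of_hasCompactSupport (HasCompactSupport.of_compactSpace g)

theorem exists_abs_le_of_continuous {g : S2 → ℝ} (hg : Continuous g) :
    ∃ C, 0 ≤ C ∧ ∀ p, |g p| ≤ C := by
  obtain ⟨C, hC⟩ := isCompact_univ.exists_bound_of_continuousOn hg.continuousOn
  exact ⟨max C 0, le_max_right _ _, fun p => (hC p trivial).trans (le_max_left _ _)⟩

theorem integrable_mul_of_continuous {f g : S2 → ℝ} (hf : Integrable f sigma)
    (hg : Continuous g) : Integrable (fun p => g p * f p) sigma := by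
  obtain ⟨C, -, hC⟩ := exists_abs_le_of_continuous hg
  exact hf.bdd_mul hg.aestronglyMeasurable (ae_of_all _ hC)

/-- The homeomorphism of the sphere induced by a linear isometry. -/
noncomputable def sphereHomeo (L : E3 ≃ₗᵢ[ℝ] E3) : S2 ≃ₜ S2 where
  toFun p := ⟨L p, by simp⟩
  invFun p := ⟨L.symm p, by simp⟩
  left_inv p := by ext1; simp
  right_inv p := by ext1; simp
  continuous_toFun := by fun_prop
  continuous_invFun := by fun_prop

@[simp] theorem coe_sphereHomeo (L : E3 ≃ₗᵢ[ℝ] E3) (p : S2) :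
    (sphereHomeo L p : E3) = L p := rfl

theorem measurePreserving_sphereHomeo (L : E3 ≃ₗᵢ[ℝ] E3) :
    MeasurePreserving (sphereHomeo L).toMeasurableEquiv sigma sigma := by
  refine ⟨(sphereHomeo L).toMeasurableEquiv.measurable, ?_⟩
  ext s hs
  rw [MeasurableEquiv.map_apply]
  unfold sigma
  rw [Measure.toSphere_apply' _ hs,
    Measure.toSphere_apply' _ ((sphereHomeo L).toMeasurableEquiv.measurable hs)]
  congr 1
  have hL := (L.measurePreserving).measure_preimage_equiv (f := L.toMeasurableEquiv)
    (Ioo (0 : ℝ) 1 • (Subtype.val '' s))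
  rw [← hL]
  congr 1
  ext x
  simp only [Set.mem_smul, Set.mem_preimage, Set.mem_image]
  constructor
  · rintro ⟨r, hr, _, ⟨p, hp, rfl⟩, rfl⟩
    exact ⟨r, hr, _, ⟨_, hp, rfl⟩, by simp⟩
  · rintro ⟨r, hr, _, ⟨p, hp, rfl⟩, hx⟩
    refine ⟨r, hr, _, ⟨(sphereHomeo L).symm p, by simpa using hp, rfl⟩, ?_⟩
    apply L.injective
    rw [map_smul, ← coe_sphereHomeo, Homeomorph.apply_symm_apply]
    exact hx

theorem integral_comp_sphereHomeo (L : E3 ≃ₗᵢ[ℝ] E3) (F : S2 → ℝ) :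
    ∫ p, F (sphereHomeo L p) ∂sigma = ∫ p, F p ∂sigma :=
  (measurePreserving_sphereHomeo L).integral_comp' F

/-! ### Quadratic forms on the sphere -/

/-- The quadratic form `x ↦ A x · x`. -/
def quad (A : Matrix (Fin 3) (Fin 3) ℝ) (x : E3) : ℝ := ∑ i, ∑ j, A i j * (x i * x j)

theorem continuous_quad (A : Matrix (Fin 3) (Fin 3) ℝ) : Continuous (quad A) := by
  unfold quad; fun_prop

theorem continuous_quad_coe (A : Matrix (Fin 3) (Fin 3) ℝ) : Continuous fun p : S2 => quad A p :=
  (continuous_quad A).comp continuous_subtype_val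

theorem quad_add (A B : Matrix (Fin 3) (Fin 3) ℝ) (x : E3) :
    quad (A + B) x = quad A x + quad B x := by
  simp [quad, add_mul, Finset.sum_add_distrib]

theorem quad_sub (A B : Matrix (Fin 3) (Fin 3) ℝ) (x : E3) :
    quad (A - B) x = quad A x - quad B x := by
  simp [quad, sub_mul, Finset.sum_sub_distrib]

theorem quad_smul (c : ℝ) (A : Matrix (Fin 3) (Fin 3) ℝ) (x : E3) :
    quad (c • A) x = c * quad A x := by
  simp [quad, Finset.mul_sum, mul_assoc]

theorem sum_sq_coe (p : S2) : (p : E3) 0 ^ 2 + (p : E3) 1 ^ 2 + (p : E3) 2 ^ 2 = 1 := by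
  have h : ‖(p : E3)‖ ^ 2 = 1 := by simp
  rw [EuclideanSpace.real_norm_sq_eq] at h
  simpa [Fin.sum_univ_three] using h

theorem quad_one_coe (p : S2) : quad 1 p = 1 := by
  have := sum_sq_coe p
  simp [quad, Fin.sum_univ_three, Matrix.one_apply]
  linarith

theorem inner_eq (x y : E3) : inner ℝ x y = x 0 * y 0 + x 1 * y 1 + x 2 * y 2 := by
  simp [PiLp.inner_apply, Fin.sum_univ_three, mul_comm]

theorem quad_uniaxialQ (S : ℝ) (n p : S2) :
    quad (uniaxialQ S n : Matrix (Fin 3) (Fin 3) ℝ) p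
      = S * ((inner ℝ (n : E3) (p : E3)) ^ 2 - 1 / 3) := by
  have h := quad_one_coe p
  have : quad (Matrix.of (fun i j => (n : E3) i * (n : E3) j)) p
      = (inner ℝ (n : E3) (p : E3)) ^ 2 := by
    simp only [quad, inner_eq, Fin.sum_univ_three, Matrix.of_apply]
    ring
  simp only [uniaxialQ, quad_smul, quad_sub, h, this]
  ring

/-- The restriction of a quadratic form to a line is a quadratic polynomial. -/
theorem quad_add_smul {A : Matrix (Fin 3) (Fin 3) ℝ} (x v : E3) (t : ℝ) :
    quad A (x + t • v) = quad A x + t * (∑ i, ∑ j, A i j * (x i * v j + v i * x j))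
      + t ^ 2 * quad A v := by
  simp only [quad, Fin.sum_univ_three, PiLp.add_apply, PiLp.smul_apply, smul_eq_mul]
  ring

theorem exists_quad_ne_zero {A : Matrix (Fin 3) (Fin 3) ℝ} (hA : A.IsSymm) (h0 : A ≠ 0) :
    ∃ v, quad A v ≠ 0 := by
  by_contra! h
  apply h0
  have hd : ∀ i, A i i = 0 := fun i => by
    have := h (EuclideanSpace.single i 1)
    simpa [quad, PiLp.single_apply] using this
  ext i j
  have := h (EuclideanSpace.single i 1 + (1 : ℝ) • EuclideanSpace.single j 1)
  rw [quad_add_smul, h, h] at this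
  simp [mul_add, Finset.sum_add_distrib] at this
  have hs : A j i = A i j := by rw [← hA.apply i j]
  simp
  linarith

/-- A nonzero quadratic form vanishes only on a null set of the sphere: along almost every line
in a direction where the form does not vanish, it restricts to a quadratic polynomial. -/
theorem sigma_quad_eq_zero {A : Matrix (Fin 3) (Fin 3) ℝ} (hA : A.IsSymm) (h0 : A ≠ 0) :
    sigma {p : S2 | quad A p = 0} = 0 := by
  obtain ⟨v, hv⟩ := exists_quad_ne_zero hA h0
  have hcone : volume {x : E3 | quad A x = 0} = 0 := by
    have hm : MeasurableSet {x : E3 | quad A x ≠ 0} :=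
      (isOpen_ne_fun (continuous_quad A) continuous_const).measurableSet
    have := ae_mem_of_ae_add_linearMap_mem (LinearMap.toSpanSingleton ℝ E3 v) volume volume hm
      (fun x => by
        rw [ae_iff]
        obtain ⟨b, hb⟩ : ∃ b, b = ∑ i, ∑ j, A i j * (x i * v j + v i * x j) := ⟨_, rfl⟩
        let P : Polynomial ℝ := Polynomial.C (quad A x) + Polynomial.C b * Polynomial.X
          + Polynomial.C (quad A v) * Polynomial.X ^ 2
        have hP : P ≠ 0 := fun h => hv (by
          have := congrArg (fun P => Polynomial.coeff P 2) h
          simpa [P, Polynomial.coeff_X, Polynomial.coeff_C] using this)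
        refine measure_mono_null (fun t ht => ?_) ((P.roots.toFinset.finite_toSet).measure_zero _)
        simp only [Set.mem_ofPred_eq, not_not, LinearMap.toSpanSingleton_apply,
          quad_add_smul, ← hb, ne_eq] at ht
        simp only [Finset.mem_coe, Multiset.mem_toFinset, Polynomial.mem_roots hP,
          Polynomial.IsRoot.def]
        simp [P]
        linarith)
    rw [ae_iff] at this
    simpa using this
  unfold sigma
  rw [Measure.toSphere_apply']
  · rw [measure_mono_null _ hcone, mul_zero]
    rintro _ ⟨r, hr, _, ⟨p, hp, rfl⟩, rfl⟩
    have : quad A (r • (p : E3)) = r ^ 2 * quad A p := by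
      simp only [quad, Fin.sum_univ_three, PiLp.smul_apply, smul_eq_mul]
      ring
    simp only [Set.mem_ofPred_eq] at hp ⊢
    simp [this, hp]
  · exact (isClosed_eq (continuous_quad_coe A) continuous_const).measurableSet

/-- On the sphere `c` is the quadratic form of `c • 1`. -/
theorem sigma_quad_eq {A : Matrix (Fin 3) (Fin 3) ℝ} (hA : A.IsSymm) {c : ℝ} (h0 : A ≠ c • 1) :
    sigma {p : S2 | quad A p = c} = 0 := by
  have h1 : (A - c • (1 : Matrix (Fin 3) (Fin 3) ℝ)).IsSymm :=
    hA.sub (Matrix.isSymm_one.smul c)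
  have := sigma_quad_eq_zero h1 (sub_ne_zero.2 h0)
  simpa [quad_sub, quad_smul, quad_one_coe, sub_eq_zero] using this

theorem integral_quad_mul {f : S2 → ℝ} (hf : Integrable f sigma) (A : Matrix (Fin 3) (Fin 3) ℝ) :
    ∫ p : S2, quad A p * f p ∂sigma
      = ∑ i, ∑ j, A i j * ∫ p : S2, ((p : E3) i * (p : E3) j) * f p ∂sigma := by
  have hint : ∀ i j, Integrable (fun p : S2 => A i j * (((p : E3) i * (p : E3) j) * f p)) sigma :=
    fun i j => (integrable_mul_of_continuous hf (by fun_prop)).const_mul _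
  have e : ∀ p : S2, quad A p * f p
      = ∑ i, ∑ j, A i j * (((p : E3) i * (p : E3) j) * f p) := fun p => by
    simp only [quad, Finset.sum_mul, mul_assoc]
  simp_rw [e]
  rw [integral_finsetSum _ fun i _ => integrable_finsetSum _ fun j _ => hint i j]
  refine Finset.sum_congr rfl fun i _ => ?_
  rw [integral_finsetSum _ fun j _ => hint i j]
  exact Finset.sum_congr rfl fun j _ => integral_const_mul _ _

/-! ### Second moments of axisymmetric functions -/

/-- Second moments of an axisymmetric function along one direction. The reflection in the plane
orthogonal to `y` kills the mixed moments, and one exchanging `y` with `n × y` makes the two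
transversal moments equal. -/
theorem integral_inner_sq_axisymmetric (n : S2) (h : ℝ → ℝ)
    (hi : Integrable (fun p : S2 => h (inner ℝ (n : E3) (p : E3))) sigma) (x : E3) :
    ∫ p : S2, (inner ℝ x (p : E3)) ^ 2 * h (inner ℝ (n : E3) (p : E3)) ∂sigma
      = (1 / 2 * ∫ p : S2, (1 - (inner ℝ (n : E3) (p : E3)) ^ 2) *
          h (inner ℝ (n : E3) (p : E3)) ∂sigma) * ‖x‖ ^ 2
        + (1 / 2 * ∫ p : S2, (3 * (inner ℝ (n : E3) (p : E3)) ^ 2 - 1) *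
          h (inner ℝ (n : E3) (p : E3)) ∂sigma) * (inner ℝ (n : E3) x) ^ 2 := by
  set N : E3 := (n : E3) with hN
  have hNN : inner ℝ N N = (1 : ℝ) := by rw [real_inner_self_eq_norm_sq]; simp [N]
  -- change of variables by an isometry fixing the axis
  have key : ∀ (L : E3 ≃ₗᵢ[ℝ] E3), L N = N → ∀ a b : E3,
      ∫ p : S2, inner ℝ (L a) (p : E3) * inner ℝ (L b) (p : E3) * h (inner ℝ N (p : E3)) ∂sigma
      = ∫ p : S2, inner ℝ a (p : E3) * inner ℝ b (p : E3) * h (inner ℝ N (p : E3)) ∂sigma := by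
    intro L hL a b
    rw [← integral_comp_sphereHomeo L]
    refine integral_congr_ae (ae_of_all _ fun p => ?_)
    have : inner ℝ N (L p) = inner ℝ N (p : E3) := by
      conv_lhs => rw [← hL]
      simp
    simp [this]
  have hint : ∀ g : S2 → ℝ, Continuous g →
      Integrable (fun p => g p * h (inner ℝ N (p : E3))) sigma :=
    fun g hg => integrable_mul_of_continuous hi hg
  set c : ℝ := inner ℝ N x
  set y : E3 := x - c • N with hy
  have hNy : inner ℝ N y = (0 : ℝ) := by
    simp only [y, inner_sub_right, inner_smul_right, hNN, c]; ring
  have hxy : x = c • N + y := by simp [y]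
  have hnx : ‖x‖ ^ 2 = c ^ 2 + ‖y‖ ^ 2 := by
    rw [hxy, ← real_inner_self_eq_norm_sq, ← real_inner_self_eq_norm_sq]
    simp only [inner_add_left, inner_add_right, inner_smul_left, inner_smul_right, hNN, hNy,
      real_inner_comm N y]
    simp
    ring
  have hcross : ∫ p : S2, inner ℝ N (p : E3) * inner ℝ y (p : E3) * h (inner ℝ N (p : E3)) ∂sigma
      = 0 := by
    have h1 := key (Submodule.reflection (ℝ ∙ y)ᗮ) (Submodule.reflection_mem_subspace_eq_self (by
      rw [Submodule.mem_orthogonal_singleton_iff_inner_left]; exact hNy)) N y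
    rw [Submodule.reflection_orthogonalComplement_singleton_eq_neg,
      Submodule.reflection_mem_subspace_eq_self (by
        rw [Submodule.mem_orthogonal_singleton_iff_inner_left]; exact hNy)] at h1
    simp only [inner_neg_left, mul_neg, neg_mul, integral_neg] at h1
    linarith
  -- the vector product of the axis with `y`, of the same length as `y` and orthogonal to both
  let z : E3 := !₂[N 1 * y 2 - N 2 * y 1, N 2 * y 0 - N 0 * y 2, N 0 * y 1 - N 1 * y 0]
  have hn1 := sum_sq_coe n
  rw [← hN] at hn1
  rw [inner_eq] at hNy
  have hNz : inner ℝ N z = (0 : ℝ) := by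
    rw [inner_eq]; simp [z]; ring
  have hyz : ‖y‖ = ‖z‖ := by
    have : ‖y‖ ^ 2 = ‖z‖ ^ 2 := by
      rw [EuclideanSpace.real_norm_sq_eq, EuclideanSpace.real_norm_sq_eq]
      simp only [Fin.sum_univ_three]
      simp [z]
      linear_combination (-(y 0 ^ 2 + y 1 ^ 2 + y 2 ^ 2)) * hn1 +
        (N 0 * y 0 + N 1 * y 1 + N 2 * y 2) * hNy
    exact (sq_eq_sq₀ (norm_nonneg _) (norm_nonneg _)).1 this
  have hyy : ∫ p : S2, inner ℝ y (p : E3) * inner ℝ y (p : E3) * h (inner ℝ N (p : E3)) ∂sigma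
      = ∫ p : S2, inner ℝ z (p : E3) * inner ℝ z (p : E3) * h (inner ℝ N (p : E3)) ∂sigma := by
    have h1 := key (Submodule.reflection (ℝ ∙ (y - z))ᗮ)
      (Submodule.reflection_mem_subspace_eq_self (by
      rw [Submodule.mem_orthogonal_singleton_iff_inner_left, inner_sub_right, hNz, inner_eq, hNy,
        sub_zero])) y y
    rw [Submodule.reflection_sub hyz] at h1
    exact h1.symm
  -- Parseval's identity for the unit vector `p` in the orthogonal frame `N`, `y`, `z`
  have hlag : ∀ p : S2, inner ℝ z (p : E3) * inner ℝ z (p : E3)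
      = ‖y‖ ^ 2 * (1 - inner ℝ N (p : E3) ^ 2) - inner ℝ y (p : E3) * inner ℝ y (p : E3) := by
    intro p
    have hp := sum_sq_coe p
    rw [EuclideanSpace.real_norm_sq_eq]
    simp only [inner_eq, Fin.sum_univ_three]
    simp only [z, Matrix.cons_val]
    generalize (p : E3) 0 = p0 at *
    generalize (p : E3) 1 = p1 at *
    generalize (p : E3) 2 = p2 at *
    generalize N 0 = n0 at *
    generalize N 1 = n1 at *
    generalize N 2 = n2 at *
    generalize y 0 = y0 at *
    generalize y 1 = y1 at *
    generalize y 2 = y2 at *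
    linear_combination ((y0 ^ 2 + y1 ^ 2 + y2 ^ 2) * (p0 ^ 2 + p1 ^ 2 + p2 ^ 2)
        - (y0 * p0 + y1 * p1 + y2 * p2) ^ 2) * hn1
      + (y0 ^ 2 + y1 ^ 2 + y2 ^ 2) * hp
      - ((p0 ^ 2 + p1 ^ 2 + p2 ^ 2) * (n0 * y0 + n1 * y1 + n2 * y2)
        - 2 * (n0 * p0 + n1 * p1 + n2 * p2) * (y0 * p0 + y1 * p1 + y2 * p2)) * hNy
  have hy2 : ∫ p : S2, inner ℝ y (p : E3) * inner ℝ y (p : E3) * h (inner ℝ N (p : E3)) ∂sigma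
      = (1 / 2 * ∫ p : S2, (1 - (inner ℝ N (p : E3)) ^ 2) * h (inner ℝ N (p : E3)) ∂sigma)
        * ‖y‖ ^ 2 := by
    simp only [hlag, sub_mul _ (inner ℝ y _ * inner ℝ y _), mul_assoc (‖y‖ ^ 2)] at hyy
    rw [integral_sub ((hint _ (by fun_prop)).const_mul _) (hint _ (by fun_prop)),
      integral_const_mul] at hyy
    linarith
  have hsplit : ∀ p : S2, (inner ℝ x (p : E3)) ^ 2 * h (inner ℝ N (p : E3))
      = c ^ 2 * ((inner ℝ N (p : E3)) ^ 2 * h (inner ℝ N (p : E3)))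
        + (2 * c) * (inner ℝ N (p : E3) * inner ℝ y (p : E3) * h (inner ℝ N (p : E3)))
        + inner ℝ y (p : E3) * inner ℝ y (p : E3) * h (inner ℝ N (p : E3)) := by
    intro p
    conv_lhs => rw [hxy]
    rw [inner_add_left, inner_smul_left]
    simp
    ring
  simp only [hsplit]
  rw [integral_add, integral_add, integral_const_mul, integral_const_mul, hcross, hy2, hnx]
  rotate_left
  · exact (hint _ (by fun_prop)).const_mul _
  · exact (hint _ (by fun_prop)).const_mul _
  · exact ((hint _ (by fun_prop)).const_mul _).add ((hint _ (by fun_prop)).const_mul _)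
  · exact hint _ (by fun_prop)
  have e1 : ∫ p : S2, (3 * (inner ℝ N (p : E3)) ^ 2 - 1) * h (inner ℝ N (p : E3)) ∂sigma
      = 2 * (∫ p : S2, (inner ℝ N (p : E3)) ^ 2 * h (inner ℝ N (p : E3)) ∂sigma)
        - ∫ p : S2, (1 - (inner ℝ N (p : E3)) ^ 2) * h (inner ℝ N (p : E3)) ∂sigma := by
    rw [← integral_const_mul, ← integral_sub ((hint _ (by fun_prop)).const_mul _)
      (hint _ (by fun_prop))]
    congr 1; ext p; ring
  rw [e1]
  ring

/-- The tensor of second moments of an axisymmetric function is `α I + β n ⊗ n`. -/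
theorem integral_coord_mul_axisymmetric (n : S2) (h : ℝ → ℝ)
    (hi : Integrable (fun p : S2 => h (inner ℝ (n : E3) (p : E3))) sigma) (i j : Fin 3) :
    ∫ p : S2, ((p : E3) i * (p : E3) j) * h (inner ℝ (n : E3) (p : E3)) ∂sigma
      = (1 / 2 * ∫ p : S2, (1 - (inner ℝ (n : E3) (p : E3)) ^ 2) *
          h (inner ℝ (n : E3) (p : E3)) ∂sigma) * (1 : Matrix (Fin 3) (Fin 3) ℝ) i j
        + (1 / 2 * ∫ p : S2, (3 * (inner ℝ (n : E3) (p : E3)) ^ 2 - 1) *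
          h (inner ℝ (n : E3) (p : E3)) ∂sigma) * ((n : E3) i * (n : E3) j) := by
  have H := integral_inner_sq_axisymmetric n h hi
  have h1 := H (EuclideanSpace.single i 1 + EuclideanSpace.single j 1)
  have h2 := H (EuclideanSpace.single i 1)
  have h3 := H (EuclideanSpace.single j 1)
  have hint : ∀ g : S2 → ℝ, Continuous g →
      Integrable (fun p => g p * h (inner ℝ (n : E3) (p : E3))) sigma :=
    fun g hg => integrable_mul_of_continuous hi hg
  have e : ∀ p : S2, ((p : E3) i * (p : E3) j) * h (inner ℝ (n : E3) (p : E3))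
      = 1 / 2 * ((inner ℝ (EuclideanSpace.single i 1 + EuclideanSpace.single j 1 : E3) (p : E3)) ^ 2
          * h (inner ℝ (n : E3) (p : E3))
        - (inner ℝ (EuclideanSpace.single i 1 : E3) (p : E3)) ^ 2 * h (inner ℝ (n : E3) (p : E3))
        - (inner ℝ (EuclideanSpace.single j 1 : E3) (p : E3)) ^ 2
          * h (inner ℝ (n : E3) (p : E3))) := by
    intro p
    simp only [inner_add_left, EuclideanSpace.inner_single_left]
    simp
    ring
  simp only [e]
  rw [integral_const_mul, integral_sub, integral_sub, h1, h2, h3, norm_add_sq_real]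
  · generalize (∫ p : S2, (1 - (inner ℝ (n : E3) (p : E3)) ^ 2) *
      h (inner ℝ (n : E3) (p : E3)) ∂sigma) = a
    generalize (∫ p : S2, (3 * (inner ℝ (n : E3) (p : E3)) ^ 2 - 1) *
      h (inner ℝ (n : E3) (p : E3)) ∂sigma) = b
    have e1 : inner ℝ (EuclideanSpace.single i 1 : E3) (EuclideanSpace.single j 1)
        = (1 : Matrix (Fin 3) (Fin 3) ℝ) i j := by
      simp [EuclideanSpace.inner_single_left, Matrix.one_apply, PiLp.single_apply]
    rw [e1]
    simp only [inner_add_right, EuclideanSpace.inner_single_right, PiLp.norm_single, norm_one,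
      conj_trivial]
    ring
  · exact hint _ (by fun_prop)
  · exact hint _ (by fun_prop)
  · exact (hint _ (by fun_prop)).sub (hint _ (by fun_prop))
  · exact hint _ (by fun_prop)

/-- Pairing of a quadratic form with an axisymmetric function. -/
theorem integral_quad_axisymmetric (n : S2) (h : ℝ → ℝ)
    (hi : Integrable (fun p : S2 => h (inner ℝ (n : E3) (p : E3))) sigma)
    (A : Matrix (Fin 3) (Fin 3) ℝ) :
    ∫ p : S2, quad A p * h (inner ℝ (n : E3) (p : E3)) ∂sigma
      = (1 / 2 * ∫ p : S2, (1 - (inner ℝ (n : E3) (p : E3)) ^ 2) *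
          h (inner ℝ (n : E3) (p : E3)) ∂sigma) * A.trace
        + (1 / 2 * ∫ p : S2, (3 * (inner ℝ (n : E3) (p : E3)) ^ 2 - 1) *
          h (inner ℝ (n : E3) (p : E3)) ∂sigma) * quad A n := by
  rw [integral_quad_mul hi]
  have key : ∀ a b : ℝ, (∀ i j, ∫ p : S2, ((p : E3) i * (p : E3) j) *
      h (inner ℝ (n : E3) (p : E3)) ∂sigma
      = 1 / 2 * a * (1 : Matrix (Fin 3) (Fin 3) ℝ) i j + 1 / 2 * b * ((n : E3) i * (n : E3) j)) →
      ∑ i, ∑ j, A i j * ∫ p : S2, ((p : E3) i * (p : E3) j) *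
        h (inner ℝ (n : E3) (p : E3)) ∂sigma
      = 1 / 2 * a * A.trace + 1 / 2 * b * quad A n := fun a b hc => by
    simp only [hc]
    simp [quad, Matrix.trace, Fin.sum_univ_three, Matrix.one_apply]
    ring
  exact key _ _ (integral_coord_mul_axisymmetric n h hi)

/-! ### The free energy as a Bochner integral -/

/-- The full contraction `A : B` of two matrices. -/
def contract (A B : Matrix (Fin 3) (Fin 3) ℝ) : ℝ := ∑ i, ∑ j, A i j * B i j

theorem integrable_coord_mul {f : S2 → ℝ} (hf : Integrable f sigma) (i j : Fin 3) :
    Integrable (fun p : S2 => ((p : E3) i * (p : E3) j) * f p) sigma :=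
  integrable_mul_of_continuous hf (by fun_prop)

theorem qTensor_apply {f : S2 → ℝ} (hf : Integrable f sigma) (i j : Fin 3) :
    qTensor f i j = ∫ p : S2, ((p : E3) i * (p : E3) j) * f p ∂sigma
      - 1 / 3 * (1 : Matrix (Fin 3) (Fin 3) ℝ) i j * ∫ p, f p ∂sigma := by
  simp only [qTensor, Matrix.of_apply, sub_mul]
  rw [integral_sub (integrable_coord_mul hf i j) (hf.const_mul _), integral_const_mul]

theorem integral_quad_mul_eq {f : S2 → ℝ} (hf : Integrable f sigma)
    (A : Matrix (Fin 3) (Fin 3) ℝ) :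
    ∫ p : S2, quad A p * f p ∂sigma
      = contract A (qTensor f) + A.trace / 3 * ∫ p, f p ∂sigma := by
  rw [integral_quad_mul hf]
  simp only [contract, qTensor_apply hf, Fin.sum_univ_three, Matrix.trace, Matrix.one_apply]
  simp
  ring

theorem integral_quad_mul_of_admissible {Q : Sym0} {f : S2 → ℝ} (hf : f ∈ admissible Q)
    (A : Matrix (Fin 3) (Fin 3) ℝ) :
    ∫ p : S2, quad A p * f p ∂sigma = contract A Q + A.trace / 3 := by
  rw [integral_quad_mul_eq hf.1.1, hf.2, hf.1.2.2, mul_one]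

/-- The argument `Q p · p - η` of the logarithm in the free energy. -/
def weight (η : ℝ) (Q : Sym0) (p : S2) : ℝ := quad (Q : Matrix (Fin 3) (Fin 3) ℝ) p - η

theorem continuous_weight (η : ℝ) (Q : Sym0) : Continuous (weight η Q) :=
  (continuous_quad_coe _).sub continuous_const

/-- The argument of the logarithm in the free energy depends on `f` only through its Q-tensor.
The trace term of the pairing vanishes as `Q` is traceless. -/
theorem integral_inner_sq_sub_mul {Q : Sym0} {f : S2 → ℝ} (hf : f ∈ admissible Q) (p : S2) :
    ∫ q : S2, ((inner ℝ (p : E3) (q : E3)) ^ 2 - 1 / 3) * f q ∂sigma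
      = quad (Q : Matrix (Fin 3) (Fin 3) ℝ) p := by
  have e : ∀ q : S2, (inner ℝ (p : E3) (q : E3)) ^ 2 - 1 / 3
      = quad (uniaxialQ 1 p : Matrix (Fin 3) (Fin 3) ℝ) q := fun q => by
    rw [quad_uniaxialQ, one_mul]
  simp only [e]
  rw [integral_quad_mul_of_admissible hf, (uniaxialQ 1 p).2.2]
  have ht := Q.2.2
  simp only [contract, uniaxialQ, quad, Matrix.trace, Fin.sum_univ_three] at ht ⊢
  simp at ht ⊢
  linear_combination (-1 / 3) * ht

/-- The real integrand `f ln f - f ln (Q p · p - η)` of the free energy; it has the intended value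
wherever `f` vanishes or the argument of the second logarithm is positive. -/
noncomputable def energyDensity (η : ℝ) (Q : Sym0) (f : S2 → ℝ) (p : S2) : ℝ :=
  f p * Real.log (f p) - f p * Real.log (weight η Q p)

theorem freeEnergy_eq_extIntegral (η : ℝ) {Q : Sym0} {f : S2 → ℝ} (hf : f ∈ admissible Q) :
    freeEnergy η f = extIntegral fun p =>
      ((f p * Real.log (f p) : ℝ) : EReal) + (f p : EReal) * negLog (weight η Q p) := by
  simp only [freeEnergy, integral_inner_sq_sub_mul hf, weight]

theorem integrand_eq_coe_energyDensity {η : ℝ} {Q : Sym0} {f : S2 → ℝ} {p : S2}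
    (h : weight η Q p ≤ 0 → f p = 0) :
    ((f p * Real.log (f p) : ℝ) : EReal) + (f p : EReal) * negLog (weight η Q p)
      = (energyDensity η Q f p : EReal) := by
  unfold energyDensity negLog
  split_ifs with hw
  · rw [← EReal.coe_mul, ← EReal.coe_add]
    congr 1
    ring
  · simp [h (not_lt.1 hw)]

theorem extIntegral_eq_of_ae_eq {g : S2 → EReal} {φ : S2 → ℝ}
    (h : ∀ᵐ p ∂sigma, g p = (φ p : EReal)) :
    extIntegral g = ((∫⁻ p, ENNReal.ofReal (φ p) ∂sigma : ENNReal) : EReal)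
      - ((∫⁻ p, ENNReal.ofReal (-φ p) ∂sigma : ENNReal) : EReal) := by
  unfold extIntegral
  have h1 : ∫⁻ p, (g p).toENNReal ∂sigma = ∫⁻ p, ENNReal.ofReal (φ p) ∂sigma :=
    lintegral_congr_ae (h.mono fun p hp => by simp [hp])
  have h2 : ∫⁻ p, (-g p).toENNReal ∂sigma = ∫⁻ p, ENNReal.ofReal (-φ p) ∂sigma := by
    refine lintegral_congr_ae (h.mono fun p hp => ?_)
    simp only [hp]
    rw [← EReal.coe_neg, EReal.toENNReal_of_ne_top (EReal.coe_ne_top _), EReal.toReal_coe]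
  rw [h1, h2]

theorem coe_ennreal_eq_coe_toReal {x : ENNReal} (hx : x ≠ ⊤) :
    (x : EReal) = ((x.toReal : ℝ) : EReal) := by
  lift x to NNReal using hx
  rfl

theorem extIntegral_eq_integral {g : S2 → EReal} {φ : S2 → ℝ}
    (h : ∀ᵐ p ∂sigma, g p = (φ p : EReal)) (hφ : Integrable φ sigma) :
    extIntegral g = ((∫ p, φ p ∂sigma : ℝ) : EReal) := by
  have h1 : ∫⁻ p, ENNReal.ofReal (φ p) ∂sigma ≠ ⊤ := hφ.lintegral_lt_top.ne
  have h2 : ∫⁻ p, ENNReal.ofReal (-φ p) ∂sigma ≠ ⊤ := hφ.neg.lintegral_lt_top.ne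
  rw [extIntegral_eq_of_ae_eq h, integral_eq_lintegral_pos_part_sub_lintegral_neg_part hφ,
    EReal.coe_sub, coe_ennreal_eq_coe_toReal h1, coe_ennreal_eq_coe_toReal h2]

theorem freeEnergy_eq_integral {η : ℝ} {Q : Sym0} {f : S2 → ℝ} (hf : f ∈ admissible Q)
    (hv : ∀ᵐ p ∂sigma, weight η Q p ≤ 0 → f p = 0)
    (hi : Integrable (energyDensity η Q f) sigma) :
    freeEnergy η f = ((∫ p, energyDensity η Q f p ∂sigma : ℝ) : EReal) := by
  rw [freeEnergy_eq_extIntegral η hf]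
  exact extIntegral_eq_integral (hv.mono fun p hp => integrand_eq_coe_energyDensity hp) hi

theorem sub_one_le_mul_log {x : ℝ} (hx : 0 ≤ x) : x - 1 ≤ x * Real.log x := by
  have := InformationTheory.klFun_nonneg hx
  rw [InformationTheory.klFun_apply] at this
  linarith

/-- A density of finite energy vanishes where the argument of the logarithm is not positive. The
negative part of the integrand is bounded by the integrable function `1 + C f`, so that only the
positive part could diverge. -/
theorem integrable_of_freeEnergy_lt_top {η : ℝ} {Q : Sym0} {f : S2 → ℝ} (hf : f ∈ admissible Q)
    (hF : freeEnergy η f < ⊤) :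
    (∀ᵐ p ∂sigma, weight η Q p ≤ 0 → f p = 0) ∧ Integrable (energyDensity η Q f) sigma := by
  rw [freeEnergy_eq_extIntegral η hf] at hF
  set g : S2 → EReal := fun p =>
    ((f p * Real.log (f p) : ℝ) : EReal) + (f p : EReal) * negLog (weight η Q p) with hg
  obtain ⟨C, hC0, hC⟩ := exists_abs_le_of_continuous (continuous_weight η Q)
  have hfm : AEMeasurable f sigma := hf.1.1.aestronglyMeasurable.aemeasurable
  -- the negative part has a finite integral
  have hneg : ∫⁻ p, (-g p).toENNReal ∂sigma ≠ ⊤ := by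
    have hb : ∀ᵐ p ∂sigma, (-g p).toENNReal ≤ ENNReal.ofReal (1 + C * f p) := by
      filter_upwards [hf.1.2.1] with p hp
      by_cases hw : weight η Q p ≤ 0 → f p = 0
      · simp only [hg]
        rw [integrand_eq_coe_energyDensity hw, ← EReal.coe_neg,
          EReal.toENNReal_of_ne_top (EReal.coe_ne_top _), EReal.toReal_coe]
        refine ENNReal.ofReal_le_ofReal ?_
        unfold energyDensity
        have h1 := sub_one_le_mul_log hp
        rcases le_or_gt (weight η Q p) 0 with h0 | h0
        · simp [hw h0]
        · have h2 : f p * Real.log (weight η Q p) ≤ f p * C := by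
            refine mul_le_mul_of_nonneg_left ?_ hp
            have := Real.log_le_sub_one_of_pos h0
            have := (le_abs_self _).trans (hC p)
            linarith
          nlinarith
      · push Not at hw
        have hpos : 0 < f p := lt_of_le_of_ne hp hw.2.symm
        have : g p = ⊤ := by
          simp only [hg, negLog, not_lt.2 hw.1, if_false]
          rw [EReal.coe_mul_top_of_pos hpos, EReal.coe_add_top]
        simp [this]
    refine ne_top_of_le_ne_top ?_ (lintegral_mono_ae hb)
    exact ((integrable_const _).add (hf.1.1.const_mul C)).lintegral_lt_top.ne
  have hpos : ∫⁻ p, (g p).toENNReal ∂sigma ≠ ⊤ := by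
    intro h
    rw [extIntegral, h, coe_ennreal_eq_coe_toReal hneg, EReal.coe_ennreal_top,
      EReal.top_sub_coe] at hF
    exact lt_irrefl _ hF
  have hv : ∀ᵐ p ∂sigma, weight η Q p ≤ 0 → f p = 0 := by
    have hB : NullMeasurableSet ({p | weight η Q p ≤ 0} ∩ {p | 0 < f p}) sigma :=
      ((isClosed_le (continuous_weight η Q) continuous_const).measurableSet.nullMeasurableSet).inter
        (nullMeasurableSet_lt aemeasurable_const hfm)
    -- the integrand is `⊤` where `f` is positive and the weight is not
    have h0 : sigma ({p | weight η Q p ≤ 0} ∩ {p | 0 < f p}) = 0 := by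
      by_contra hne
      apply hpos
      have h1 : ∫⁻ p, ({p | weight η Q p ≤ 0} ∩ {p | 0 < f p}).indicator (fun _ => ⊤) p ∂sigma
          ≤ ∫⁻ p, (g p).toENNReal ∂sigma := by
        refine lintegral_mono fun p => ?_
        by_cases hp : p ∈ {p | weight η Q p ≤ 0} ∩ {p | 0 < f p}
        · have : g p = ⊤ := by
            simp only [hg, negLog, not_lt.2 (show weight η Q p ≤ 0 from hp.1), if_false]
            rw [EReal.coe_mul_top_of_pos hp.2, EReal.coe_add_top]
          simp [this]
        · simp [hp]
      rw [lintegral_indicator_const₀ hB, ENNReal.top_mul hne] at h1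
      exact top_le_iff.1 h1
    filter_upwards [hf.1.2.1, measure_eq_zero_iff_ae_notMem.1 h0] with p hp hp' hw
    by_contra hne
    exact hp' ⟨hw, lt_of_le_of_ne hp (Ne.symm hne)⟩
  refine ⟨hv, ?_⟩
  have hm : AEStronglyMeasurable (energyDensity η Q f) sigma := by
    refine AEMeasurable.aestronglyMeasurable ?_
    exact (hfm.mul (Real.measurable_log.comp_aemeasurable hfm)).sub
      (hfm.mul (Real.measurable_log.comp_aemeasurable (continuous_weight η Q).measurable.aemeasurable))
  refine ⟨hm, ?_⟩
  rw [hasFiniteIntegral_iff_norm]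
  have hle : ∀ᵐ p ∂sigma, ENNReal.ofReal ‖energyDensity η Q f p‖
      ≤ ENNReal.ofReal (energyDensity η Q f p) + (-g p).toENNReal := by
    filter_upwards [hv] with p hp
    simp only [hg]
    rw [integrand_eq_coe_energyDensity hp, ← EReal.coe_neg,
      EReal.toENNReal_of_ne_top (EReal.coe_ne_top _), EReal.toReal_coe, Real.norm_eq_abs]
    rcases le_total 0 (energyDensity η Q f p) with h | h
    · rw [abs_of_nonneg h]; exact le_self_add
    · rw [abs_of_nonpos h]; exact le_add_self
  refine (lintegral_mono_ae hle).trans_lt ?_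
  rw [lintegral_add_left' hm.aemeasurable.ennreal_ofReal]
  refine ENNReal.add_lt_top.2 ⟨?_, hneg.lt_top⟩
  refine lt_of_le_of_lt (le_of_eq ?_) hpos.lt_top
  refine lintegral_congr_ae (hv.mono fun p hp => ?_)
  simp only [hg]
  rw [integrand_eq_coe_energyDensity hp]
  simp

/-! ### Gibbs' variational principle -/

/-- The unnormalised density `(Q p · p - η)₊ exp ℓ(p)`. -/
noncomputable def tilted (η : ℝ) (Q : Sym0) (ℓ : S2 → ℝ) (p : S2) : ℝ :=
  max (weight η Q p) 0 * Real.exp (ℓ p)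

theorem continuous_tilted (η : ℝ) (Q : Sym0) {ℓ : S2 → ℝ} (hℓ : Continuous ℓ) :
    Continuous (tilted η Q ℓ) :=
  ((continuous_weight η Q).max continuous_const).mul (Real.continuous_exp.comp hℓ)

theorem tilted_nonneg (η : ℝ) (Q : Sym0) (ℓ : S2 → ℝ) (p : S2) : 0 ≤ tilted η Q ℓ p :=
  mul_nonneg (le_max_right _ _) (Real.exp_pos _).le

/-- The normalising constant of `tilted`. -/
noncomputable def partition (η : ℝ) (Q : Sym0) (ℓ : S2 → ℝ) : ℝ :=
  ∫ p, tilted η Q ℓ p ∂sigma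

/-- Nonnegativity of `y φ(x / y)` with `φ(t) = t ln t + 1 - t`. -/
theorem relative_entropy_nonneg {x y : ℝ} (hx : 0 ≤ x) (hy : 0 < y) :
    0 ≤ x * Real.log x - x * Real.log y - x + y := by
  have h := InformationTheory.klFun_nonneg (div_nonneg hx hy.le)
  rw [InformationTheory.klFun_apply] at h
  rcases hx.eq_or_lt with rfl | hx'
  · simpa using hy.le
  rw [Real.log_div hx'.ne' hy.ne'] at h
  have h2 := mul_nonneg hy.le h
  have : y * (x / y * (Real.log x - Real.log y) + 1 - x / y)
      = x * Real.log x - x * Real.log y - x + y := by field_simp; ring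
  linarith

theorem eq_of_relative_entropy_eq_zero {x y : ℝ} (hx : 0 ≤ x) (hy : 0 < y)
    (h0 : x * Real.log x - x * Real.log y - x + y = 0) : x = y := by
  rcases hx.eq_or_lt with rfl | hx'
  · simp at h0; exact absurd h0 hy.ne'
  have h : InformationTheory.klFun (x / y) = 0 := by
    rw [InformationTheory.klFun_apply, Real.log_div hx'.ne' hy.ne']
    have : y * (x / y * (Real.log x - Real.log y) + 1 - x / y) = 0 := by
      rw [← h0]; field_simp; ring
    exact (mul_eq_zero.1 this).resolve_left hy.ne'
  rw [InformationTheory.klFun_eq_zero_iff (by positivity), div_eq_one_iff_eq hy.ne'] at h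
  exact h

/-- The energy integrand minus its value predicted by Gibbs' principle is the relative entropy
integrand with respect to the tilted density. -/
theorem energyDensity_sub_eq {η : ℝ} {Q : Sym0} {f ℓ : S2 → ℝ} {p : S2} {Z : ℝ} (hZ : 0 < Z)
    (hw : 0 < weight η Q p) :
    energyDensity η Q f p - ℓ p * f p + Real.log Z * f p
      = f p * Real.log (f p) - f p * Real.log (tilted η Q ℓ p / Z) := by
  unfold energyDensity tilted
  rw [max_eq_left hw.le, Real.log_div (by positivity) hZ.ne',
    Real.log_mul hw.ne' (Real.exp_pos _).ne', Real.log_exp]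
  ring

/-- If the partition function vanished, the weight would be nonpositive almost everywhere, and a
density of finite energy would be zero. -/
theorem partition_pos_of_freeEnergy_lt_top {η : ℝ} {Q : Sym0} {f : S2 → ℝ}
    (hf : f ∈ admissible Q) (hF : freeEnergy η f < ⊤) {ℓ : S2 → ℝ} (hℓ : Continuous ℓ) :
    0 < partition η Q ℓ := by
  obtain ⟨hv, -⟩ := integrable_of_freeEnergy_lt_top hf hF
  refine lt_of_le_of_ne (integral_nonneg (tilted_nonneg η Q ℓ)) fun h => ?_
  have h0 := (integral_eq_zero_iff_of_nonneg (tilted_nonneg η Q ℓ)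
    (integrable_of_continuous (continuous_tilted η Q hℓ))).1 h.symm
  have : f =ᵐ[sigma] 0 := by
    filter_upwards [hv, h0] with p hp hp0
    refine hp ?_
    by_contra hw
    push Not at hw
    simp only [tilted, max_eq_left hw.le, Pi.zero_apply, mul_eq_zero, hw.ne',
      (Real.exp_pos _).ne', or_self] at hp0
  have h1 := hf.1.2.2
  rw [integral_congr_ae this] at h1
  simp at h1

/-- The pointwise inequality behind Gibbs' variational principle. -/
theorem gibbs_integrand_nonneg {η : ℝ} {Q : Sym0} {f ℓ : S2 → ℝ} {p : S2} {Z : ℝ} (hZ : 0 < Z)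
    (hp : 0 ≤ f p) (hv : weight η Q p ≤ 0 → f p = 0) :
    0 ≤ energyDensity η Q f p - ℓ p * f p + Real.log Z * f p - f p + tilted η Q ℓ p / Z := by
  rcases le_or_gt (weight η Q p) 0 with hw | hw
  · simp [energyDensity, tilted, hv hw, max_eq_right hw]
  · rw [energyDensity_sub_eq hZ hw]
    refine relative_entropy_nonneg hp (div_pos ?_ hZ)
    rw [tilted, max_eq_left hw.le]
    positivity

theorem eq_of_gibbs_integrand_eq_zero {η : ℝ} {Q : Sym0} {f ℓ : S2 → ℝ} {p : S2} {Z : ℝ}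
    (hZ : 0 < Z) (hp : 0 ≤ f p) (hv : weight η Q p ≤ 0 → f p = 0)
    (h0 : energyDensity η Q f p - ℓ p * f p + Real.log Z * f p - f p + tilted η Q ℓ p / Z = 0) :
    f p = tilted η Q ℓ p / Z := by
  rcases le_or_gt (weight η Q p) 0 with hw | hw
  · simp [tilted, hv hw, max_eq_right hw]
  · rw [energyDensity_sub_eq hZ hw] at h0
    refine eq_of_relative_entropy_eq_zero hp (div_pos ?_ hZ) h0
    rw [tilted, max_eq_left hw.le]
    positivity

/-- The integral of the nonnegative integrand is the gap in Gibbs' principle. -/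
theorem integral_gibbs_integrand {η : ℝ} {Q : Sym0} {f : S2 → ℝ}
    (hf : f ∈ admissible Q) (hi : Integrable (energyDensity η Q f) sigma) {ℓ : S2 → ℝ}
    (hℓ : Continuous ℓ) (hZ : 0 < partition η Q ℓ) :
    Integrable (fun p => energyDensity η Q f p - ℓ p * f p + Real.log (partition η Q ℓ) * f p
      - f p + tilted η Q ℓ p / partition η Q ℓ) sigma ∧
    ∫ p, (energyDensity η Q f p - ℓ p * f p + Real.log (partition η Q ℓ) * f p
      - f p + tilted η Q ℓ p / partition η Q ℓ) ∂sigma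
      = ∫ p, energyDensity η Q f p ∂sigma
        - (∫ p, ℓ p * f p ∂sigma - Real.log (partition η Q ℓ)) := by
  have i1 := integrable_mul_of_continuous hf.1.1 hℓ
  have i2 := hf.1.1.const_mul (Real.log (partition η Q ℓ))
  have i3 := (integrable_of_continuous (continuous_tilted η Q hℓ)).div_const (partition η Q ℓ)
  have j1 : Integrable (fun p => energyDensity η Q f p - ℓ p * f p) sigma := hi.sub i1
  have j2 : Integrable (fun p => energyDensity η Q f p - ℓ p * f p
    + Real.log (partition η Q ℓ) * f p) sigma := j1.add i2
  have j3 : Integrable (fun p => energyDensity η Q f p - ℓ p * f p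
    + Real.log (partition η Q ℓ) * f p - f p) sigma := j2.sub hf.1.1
  refine ⟨j3.add i3, ?_⟩
  rw [integral_add j3 i3, integral_sub j2 hf.1.1, integral_add j1 i2, integral_sub hi i1,
    integral_const_mul, integral_div, hf.1.2.2]
  change _ + partition η Q ℓ / partition η Q ℓ = _
  rw [div_self hZ.ne']
  ring

/-- Gibbs' variational principle, lower bound. -/
theorem gibbs_le_freeEnergy (η : ℝ) {Q : Sym0} {f : S2 → ℝ}
    (hf : f ∈ admissible Q) {ℓ : S2 → ℝ} (hℓ : Continuous ℓ) :
    ((∫ p, ℓ p * f p ∂sigma - Real.log (partition η Q ℓ) : ℝ) : EReal) ≤ freeEnergy η f := by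
  rcases eq_top_or_lt_top (freeEnergy η f) with hF | hF
  · simp [hF]
  obtain ⟨hv, hi⟩ := integrable_of_freeEnergy_lt_top hf hF
  have hZ := partition_pos_of_freeEnergy_lt_top hf hF hℓ
  rw [freeEnergy_eq_integral hf hv hi, EReal.coe_le_coe_iff]
  have h := (integral_gibbs_integrand hf hi hℓ hZ).2
  have h0 : 0 ≤ ∫ p, (energyDensity η Q f p - ℓ p * f p + Real.log (partition η Q ℓ) * f p
      - f p + tilted η Q ℓ p / partition η Q ℓ) ∂sigma := by
    refine integral_nonneg_of_ae ?_
    filter_upwards [hf.1.2.1, hv] with p hp hp'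
    exact gibbs_integrand_nonneg hZ hp hp'
  linarith

/-- Gibbs' variational principle, the case of equality. -/
theorem ae_eq_of_freeEnergy_eq_gibbs {η : ℝ} {Q : Sym0} {f : S2 → ℝ}
    (hf : f ∈ admissible Q) {ℓ : S2 → ℝ} (hℓ : Continuous ℓ)
    (hF : freeEnergy η f
      = ((∫ p, ℓ p * f p ∂sigma - Real.log (partition η Q ℓ) : ℝ) : EReal)) :
    ∀ᵐ p ∂sigma, f p = tilted η Q ℓ p / partition η Q ℓ := by
  have hF' : freeEnergy η f < ⊤ := hF ▸ EReal.coe_lt_top _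
  obtain ⟨hv, hi⟩ := integrable_of_freeEnergy_lt_top hf hF'
  have hZ := partition_pos_of_freeEnergy_lt_top hf hF' hℓ
  rw [freeEnergy_eq_integral hf hv hi, EReal.coe_eq_coe_iff] at hF
  obtain ⟨h1, h2⟩ := integral_gibbs_integrand hf hi hℓ hZ
  rw [hF, sub_self] at h2
  have h0 := (integral_eq_zero_iff_of_nonneg_ae (by
    filter_upwards [hf.1.2.1, hv] with p hp hp'
    exact gibbs_integrand_nonneg hZ hp hp') h1).1 h2
  filter_upwards [hf.1.2.1, hv, h0] with p hp hp' hp0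
  exact eq_of_gibbs_integrand_eq_zero hZ hp hp' hp0

/-- The energy of a perturbation `f` of the normalised tilted density `g` exceeds the Gibbs bound
by at most a constant times `sup (f - g)² / g`. -/
theorem freeEnergy_le_gibbs_add {η : ℝ} {Q : Sym0} {f : S2 → ℝ} (hf : f ∈ admissible Q)
    {ℓ : S2 → ℝ} (hℓ : Continuous ℓ) (hZ : 0 < partition η Q ℓ) {δ : ℝ}
    (h : ∀ p, (f p - tilted η Q ℓ p / partition η Q ℓ) ^ 2
      ≤ δ * (tilted η Q ℓ p / partition η Q ℓ)) :
    freeEnergy η f ≤ ((∫ p, ℓ p * f p ∂sigma - Real.log (partition η Q ℓ)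
      + δ * sigma.real univ : ℝ) : EReal) := by
  set Z := partition η Q ℓ with hZdef
  have hv : ∀ p, weight η Q p ≤ 0 → f p = 0 := fun p hp => by
    have := h p
    simp only [tilted, max_eq_right hp, zero_mul, zero_div, mul_zero, sub_zero] at this
    exact pow_eq_zero_iff two_ne_zero |>.1 (le_antisymm this (sq_nonneg _))
  have hup : ∀ p, 0 ≤ f p →
      energyDensity η Q f p - ℓ p * f p + Real.log Z * f p - f p + tilted η Q ℓ p / Z ≤ δ := by
    intro p hp
    rcases le_or_gt (weight η Q p) 0 with hw | hw
    -- the left side is zero there, and `δ` is nonnegative because `Z ≠ 0`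
    · have hδ : 0 ≤ δ := by
        by_contra hneg
        push Not at hneg
        have hall : ∀ q, tilted η Q ℓ q = 0 := fun q => by
          have h1 := (sq_nonneg _).trans (h q)
          have h2 := div_nonneg (tilted_nonneg η Q ℓ q) hZ.le
          have h3 : tilted η Q ℓ q / Z = 0 := by nlinarith
          simpa [hZ.ne'] using h3
        have : Z = 0 := by rw [hZdef, partition]; simp [hall]
        exact hZ.ne' this
      simpa [energyDensity, tilted, hv p hw, max_eq_right hw] using hδ
    · rw [energyDensity_sub_eq hZ hw]
      have hp2 := h p
      have hg : 0 < tilted η Q ℓ p / Z := by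
        rw [tilted, max_eq_left hw.le]; positivity
      set g := tilted η Q ℓ p / Z
      rcases hp.eq_or_lt with h0 | hpos
      · rw [← h0] at hp2 ⊢
        simp only [zero_mul, sub_zero, zero_add] at hp2 ⊢
        nlinarith
      -- `x ln (x / g) - x + g ≤ (x - g)² / g`, from `ln t ≤ t - 1`
      · have h1 : Real.log (f p) - Real.log g ≤ f p / g - 1 := by
          rw [← Real.log_div hpos.ne' hg.ne']
          exact Real.log_le_sub_one_of_pos (div_pos hpos hg)
        have h2 := mul_le_mul_of_nonneg_left h1 hp
        have h3 : f p * (f p / g - 1) - f p + g = (f p - g) ^ 2 / g := by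
          field_simp; ring
        have h4 : (f p - g) ^ 2 / g ≤ δ := by rwa [div_le_iff₀ hg]
        nlinarith
  have i1 := integrable_mul_of_continuous hf.1.1 hℓ
  have i2 := hf.1.1.const_mul (Real.log Z)
  have i3 := (integrable_of_continuous (continuous_tilted η Q hℓ)).div_const Z
  have hfm : AEMeasurable f sigma := hf.1.1.aestronglyMeasurable.aemeasurable
  have hm : AEStronglyMeasurable (energyDensity η Q f) sigma := by
    refine AEMeasurable.aestronglyMeasurable ?_
    exact (hfm.mul (Real.measurable_log.comp_aemeasurable hfm)).sub
      (hfm.mul (Real.measurable_log.comp_aemeasurable (continuous_weight η Q).measurable.aemeasurable))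
  have hR : Integrable (fun p => energyDensity η Q f p - ℓ p * f p + Real.log Z * f p
      - f p + tilted η Q ℓ p / Z) sigma := by
    refine Integrable.of_bound (C := δ) ((((hm.sub i1.1).add i2.1).sub hf.1.1.1).add i3.1) ?_
    filter_upwards [hf.1.2.1] with p hp
    rw [Real.norm_eq_abs, abs_of_nonneg (gibbs_integrand_nonneg hZ hp (hv p))]
    exact hup p hp
  have hi : Integrable (energyDensity η Q f) sigma := by
    have := (((hR.sub i3).add hf.1.1).sub i2).add i1
    refine this.congr (ae_of_all _ fun p => ?_)
    simp only [Pi.add_apply, Pi.sub_apply]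
    ring
  rw [freeEnergy_eq_integral hf (ae_of_all _ hv) hi, EReal.coe_le_coe_iff]
  have h2 := (integral_gibbs_integrand hf hi hℓ hZ).2
  have h3 : ∫ p, (energyDensity η Q f p - ℓ p * f p + Real.log Z * f p
      - f p + tilted η Q ℓ p / Z) ∂sigma ≤ ∫ _, δ ∂sigma := by
    refine integral_mono_ae hR (integrable_const _) ?_
    filter_upwards [hf.1.2.1] with p hp using hup p hp
  rw [integral_const, smul_eq_mul] at h3
  rw [← hZdef] at h2
  linarith

/-- The lower bound for `J` obtained from the tilt `exp (Λ p · p)`. -/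
noncomputable def gibbsBound (η : ℝ) (Λ : Matrix (Fin 3) (Fin 3) ℝ) (Q : Sym0) : ℝ :=
  contract Λ Q + Λ.trace / 3 - Real.log (partition η Q fun p => quad Λ p)

theorem gibbsBound_le_freeEnergy (η : ℝ) (Λ : Matrix (Fin 3) (Fin 3) ℝ) {Q : Sym0} {f : S2 → ℝ}
    (hf : f ∈ admissible Q) : (gibbsBound η Λ Q : EReal) ≤ freeEnergy η f := by
  have := gibbs_le_freeEnergy η hf (continuous_quad_coe Λ)
  rwa [integral_quad_mul_of_admissible hf] at this

theorem gibbsBound_le_J (η : ℝ) (Λ : Matrix (Fin 3) (Fin 3) ℝ) (Q : Sym0) :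
    (gibbsBound η Λ Q : EReal) ≤ J η Q :=
  le_iInf₂ fun _ hf => gibbsBound_le_freeEnergy η Λ hf

theorem J_le_gibbsBound_add {η : ℝ} {Λ : Matrix (Fin 3) (Fin 3) ℝ} {Q : Sym0} {f : S2 → ℝ}
    (hf : f ∈ admissible Q) (hZ : 0 < partition η Q fun p => quad Λ p) {δ : ℝ}
    (h : ∀ p, (f p - tilted η Q (fun p => quad Λ p) p / partition η Q fun p => quad Λ p) ^ 2
      ≤ δ * (tilted η Q (fun p => quad Λ p) p / partition η Q fun p => quad Λ p)) :
    J η Q ≤ ((gibbsBound η Λ Q + δ * sigma.real univ : ℝ) : EReal) := by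
  have h1 := freeEnergy_le_gibbs_add hf (continuous_quad_coe Λ) hZ h
  rw [integral_quad_mul_of_admissible hf] at h1
  exact (iInf₂_le f hf).trans h1

/-- If the normalised tilted density has the right Q-tensor, then it is optimal, and it is the
only optimal density up to null sets. -/
theorem isOptimal_tilted {η : ℝ} {Λ : Matrix (Fin 3) (Fin 3) ℝ} {Q : Sym0}
    (hZ : 0 < partition η Q fun p => quad Λ p)
    (hf : (fun p => tilted η Q (fun p => quad Λ p) p / partition η Q fun p => quad Λ p)
      ∈ admissible Q) :
    J η Q = (gibbsBound η Λ Q : EReal) ∧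
    IsOptimal η Q (fun p => tilted η Q (fun p => quad Λ p) p / partition η Q fun p => quad Λ p) ∧
    ∀ f, IsOptimal η Q f →
      ∀ᵐ p ∂sigma, f p = tilted η Q (fun p => quad Λ p) p / partition η Q fun p => quad Λ p := by
  have h1 := freeEnergy_le_gibbs_add hf (continuous_quad_coe Λ) hZ (δ := 0) (fun p => by simp)
  rw [integral_quad_mul_of_admissible hf, zero_mul, add_zero] at h1
  have hJ : J η Q = (gibbsBound η Λ Q : EReal) :=
    le_antisymm ((iInf₂_le _ hf).trans h1) (gibbsBound_le_J η Λ Q)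
  refine ⟨hJ, ⟨hf, ?_⟩, fun f hfo => ?_⟩
  · exact le_antisymm (h1.trans_eq hJ.symm) (iInf₂_le _ hf)
  · refine ae_eq_of_freeEnergy_eq_gibbs hfo.1 (continuous_quad_coe Λ) ?_
    rw [hfo.2, hJ, integral_quad_mul_of_admissible hfo.1]
    rfl

/-! ### Differentiability of `J` -/

section Differentiability

attribute [local instance] Matrix.normedAddCommGroup Matrix.normedSpace

/-- The topology of the norm on `Sym0`. It is the subspace topology, but expressed in the way in
which the theory of normed spaces expects it. -/
@[reducible] noncomputable def normTopology : TopologicalSpace Sym0 :=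
  PseudoMetricSpace.toUniformSpace.toTopologicalSpace

attribute [local instance] normTopology

theorem abs_coord_le (p : S2) (i : Fin 3) : |(p : E3) i| ≤ 1 := by
  have h := PiLp.norm_apply_le (p : E3) i
  simpa using h

theorem abs_quad_le (A : Matrix (Fin 3) (Fin 3) ℝ) (p : S2) : |quad A p| ≤ 9 * ‖A‖ := by
  have h : ∀ i j, |A i j * ((p : E3) i * (p : E3) j)| ≤ ‖A‖ := fun i j => by
    rw [abs_mul, abs_mul]
    have h1 : |A i j| ≤ ‖A‖ := Matrix.norm_entry_le_entrywise_sup_norm A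
    have h2 := mul_le_one₀ (abs_coord_le p i) (abs_nonneg _) (abs_coord_le p j)
    calc _ ≤ ‖A‖ * 1 := mul_le_mul h1 h2 (by positivity) (norm_nonneg _)
      _ = ‖A‖ := mul_one _
  unfold quad
  refine (Finset.abs_sum_le_sum_abs _ _).trans ?_
  refine (Finset.sum_le_sum fun i _ => (Finset.abs_sum_le_sum_abs _ _).trans
    (Finset.sum_le_sum fun j _ => h i j)).trans ?_
  simp
  linarith

/-- The functional `H ↦ H p · p` on traceless symmetric matrices. -/
noncomputable def quadCLM (p : S2) : Sym0 →L[ℝ] ℝ :=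
  LinearMap.toContinuousLinearMap
    { toFun := fun H => quad (H : Matrix (Fin 3) (Fin 3) ℝ) p
      map_add' := fun A B => by simp [quad_add]
      map_smul' := fun c A => by simp [quad_smul] }

@[simp] theorem quadCLM_apply (p : S2) (H : Sym0) :
    quadCLM p H = quad (H : Matrix (Fin 3) (Fin 3) ℝ) p := rfl

theorem continuous_quadCLM : Continuous quadCLM := by
  rw [continuous_clm_apply]
  exact fun H => continuous_quad_coe _

theorem abs_weight_sub_le (η : ℝ) (Q Q' : Sym0) (p : S2) :
    |weight η Q p - weight η Q' p| ≤ 9 * ‖Q - Q'‖ := by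
  have : weight η Q p - weight η Q' p = quad ((Q - Q' : Sym0) : Matrix (Fin 3) (Fin 3) ℝ) p := by
    simp [weight, quad_sub]
  rw [this]
  exact abs_quad_le _ p

/-- Integrals of the truncated weight `(Q p · p - η)₊` are differentiable in `Q` as soon as the
level set `Q p · p = η`, where the truncation has a kink, is a null set. -/
theorem hasFDerivAt_integral_weight {η : ℝ} {Q₀ : Sym0} (h0 : sigma {p | weight η Q₀ p = 0} = 0)
    {ψ : S2 → ℝ} (hψ : Continuous ψ) :
    ∃ D : Sym0 →L[ℝ] ℝ,
      (∀ H : Sym0, D H = ∫ p, quad (H : Matrix (Fin 3) (Fin 3) ℝ) p *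
        (if 0 < weight η Q₀ p then ψ p else 0) ∂sigma) ∧
      HasFDerivAt (fun Q : Sym0 => ∫ p, max (weight η Q p) 0 * ψ p ∂sigma) D Q₀ := by
  obtain ⟨C, hC0, hC⟩ := exists_abs_le_of_continuous hψ
  let F' : S2 → Sym0 →L[ℝ] ℝ := fun p => (if 0 < weight η Q₀ p then ψ p else 0) • quadCLM p
  have hm : AEStronglyMeasurable F' sigma := by
    refine AEStronglyMeasurable.smul (f := fun p => if 0 < weight η Q₀ p then ψ p else 0)
      (g := quadCLM) ?_ continuous_quadCLM.aestronglyMeasurable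
    exact (Measurable.ite (isOpen_lt continuous_const (continuous_weight η Q₀)).measurableSet
      hψ.measurable measurable_const).aestronglyMeasurable
  have hcont : ∀ Q : Sym0, Continuous fun p => max (weight η Q p) 0 * ψ p := fun Q =>
    ((continuous_weight η Q).max continuous_const).mul hψ
  have key := hasFDerivAt_integral_of_dominated_loc_of_lip (μ := sigma) (𝕜 := ℝ)
    (F := fun (Q : Sym0) p => max (weight η Q p) 0 * ψ p) (F' := F') (x₀ := Q₀)
    (bound := fun _ => 9 * C) (s := univ) univ_mem
    (Eventually.of_forall fun Q => (hcont Q).aestronglyMeasurable)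
    (integrable_of_continuous (hcont Q₀)) hm
    (ae_of_all _ fun p => by
      rw [lipschitzOnWith_iff_norm_sub_le]
      intro Q _ Q' _
      rw [← sub_mul, Real.norm_eq_abs, abs_mul, Real.coe_nnabs,
        abs_of_nonneg (show 0 ≤ 9 * C by positivity)]
      have h1 := (abs_max_sub_max_le_abs (weight η Q p) (weight η Q' p) 0).trans
        (abs_weight_sub_le η Q Q' p)
      calc |max (weight η Q p) 0 - max (weight η Q' p) 0| * |ψ p|
          ≤ (9 * ‖Q - Q'‖) * C := mul_le_mul h1 (hC p) (abs_nonneg _) (by positivity)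
        _ = 9 * C * ‖Q - Q'‖ := by ring)
    (integrable_const _)
    (by
      filter_upwards [measure_eq_zero_iff_ae_notMem.1 h0] with p hp
      have hw : HasFDerivAt (fun Q : Sym0 => weight η Q p) (quadCLM p) Q₀ :=
        ((quadCLM p).hasFDerivAt (x := Q₀)).sub_const η
      rcases lt_or_gt_of_ne (show weight η Q₀ p ≠ 0 from hp) with hlt | hgt
      · have : F' p = 0 := by simp [F', not_lt.2 hlt.le]
        rw [this]
        refine (hasFDerivAt_const (0 : ℝ) Q₀).congr_of_eventuallyEq ?_
        filter_upwards [hw.continuousAt.eventually_lt continuousAt_const hlt] with Q hQ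
        simp [max_eq_right hQ.le]
      · have : F' p = ψ p • quadCLM p := by simp [F', hgt]
        rw [this]
        refine (hw.mul_const (ψ p)).congr_of_eventuallyEq ?_
        filter_upwards [continuousAt_const.eventually_lt hw.continuousAt hgt] with Q hQ
        simp [max_eq_left hQ.le])
  refine ⟨_, fun H => ?_, key.2⟩
  rw [ContinuousLinearMap.integral_apply key.1]
  refine integral_congr_ae (ae_of_all _ fun p => ?_)
  simp only [F', smul_apply, smul_eq_mul, quadCLM_apply, mul_comm]

theorem hasFDerivAt_partition {η : ℝ} {Q₀ : Sym0} (h0 : sigma {p | weight η Q₀ p = 0} = 0)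
    {ℓ : S2 → ℝ} (hℓ : Continuous ℓ) :
    ∃ D : Sym0 →L[ℝ] ℝ,
      (∀ H : Sym0, D H = ∫ p, quad (H : Matrix (Fin 3) (Fin 3) ℝ) p *
        (if 0 < weight η Q₀ p then Real.exp (ℓ p) else 0) ∂sigma) ∧
      HasFDerivAt (fun Q : Sym0 => partition η Q ℓ) D Q₀ :=
  hasFDerivAt_integral_weight h0 (Real.continuous_exp.comp hℓ)

/-- The functional `H ↦ Λ : H`. -/
noncomputable def contractCLM (Λ : Matrix (Fin 3) (Fin 3) ℝ) : Sym0 →L[ℝ] ℝ :=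
  LinearMap.toContinuousLinearMap
    { toFun := fun H => contract Λ H
      map_add' := fun A B => by simp [contract, mul_add, Finset.sum_add_distrib]
      map_smul' := fun c A => by simp [contract, Finset.mul_sum, mul_left_comm] }

theorem hasFDerivAt_gibbsBound {η : ℝ} {Q₀ : Sym0} (h0 : sigma {p | weight η Q₀ p = 0} = 0)
    {Λ : Matrix (Fin 3) (Fin 3) ℝ} (hZ : 0 < partition η Q₀ fun p => quad Λ p) :
    ∃ D : Sym0 →L[ℝ] ℝ,
      (∀ H : Sym0, D H = contract Λ H - (partition η Q₀ fun p => quad Λ p)⁻¹ *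
        ∫ p, quad (H : Matrix (Fin 3) (Fin 3) ℝ) p *
          (if 0 < weight η Q₀ p then Real.exp (quad Λ p) else 0) ∂sigma) ∧
      HasFDerivAt (gibbsBound η Λ) D Q₀ := by
  obtain ⟨D, hD, hD'⟩ := hasFDerivAt_partition h0 (continuous_quad_coe Λ)
  refine ⟨contractCLM Λ - (partition η Q₀ fun p => quad Λ p)⁻¹ • D, fun H => ?_, ?_⟩
  · simp only [sub_apply, smul_apply, hD, smul_eq_mul]
    rfl
  · exact (((contractCLM Λ).hasFDerivAt (x := Q₀)).add_const _).sub (hD'.log hZ.ne')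

theorem qTensor_mem {f : S2 → ℝ} (hf : Integrable f sigma) : qTensor f ∈ Sym0 := by
  constructor
  · ext i j
    simp only [Matrix.transpose_apply, qTensor_apply hf]
    simp only [Matrix.one_apply, eq_comm, mul_comm]
  · have h := integral_quad_mul_eq hf 1
    have ht : contract 1 (qTensor f) = (qTensor f).trace := by
      simp [contract, Matrix.trace, Matrix.one_apply]
    simp only [quad_one_coe, one_mul, ht, Matrix.trace_one, Fintype.card_fin] at h
    norm_num at h
    linarith

/-- The defect between `Q` and the Q-tensor of the normalised tilted density is `O(Q - Q₀)`. -/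
theorem isBigO_sub_qTensor_tilted {η : ℝ} {Q₀ : Sym0}
    (h0 : sigma {p | weight η Q₀ p = 0} = 0) {ℓ : S2 → ℝ} (hℓ : Continuous ℓ)
    (hZ : 0 < partition η Q₀ ℓ)
    (hQ : qTensor (fun p => tilted η Q₀ ℓ p / partition η Q₀ ℓ) = Q₀) :
    (fun Q : Sym0 => (Q : Matrix (Fin 3) (Fin 3) ℝ)
      - qTensor (fun p => tilted η Q ℓ p / partition η Q ℓ)) =O[𝓝 Q₀] fun Q => Q - Q₀ := by
  obtain ⟨D, -, hD⟩ := hasFDerivAt_partition h0 hℓ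
  have hentry : ∀ i j, (fun Q : Sym0 => ((Q : Matrix (Fin 3) (Fin 3) ℝ)
      - qTensor (fun p => tilted η Q ℓ p / partition η Q ℓ)) i j) =O[𝓝 Q₀] fun Q => Q - Q₀ := by
    intro i j
    obtain ⟨D', -, hD'⟩ := hasFDerivAt_integral_weight h0
      (ψ := fun p => Real.exp (ℓ p) * ((p : E3) i * (p : E3) j
        - (1 / 3) * (1 : Matrix (Fin 3) (Fin 3) ℝ) i j)) (by fun_prop)
    have e : ∀ Q : Sym0, qTensor (fun p => tilted η Q ℓ p / partition η Q ℓ) i j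
        = (∫ p, max (weight η Q p) 0 * (Real.exp (ℓ p) * ((p : E3) i * (p : E3) j
        - (1 / 3) * (1 : Matrix (Fin 3) (Fin 3) ℝ) i j)) ∂sigma) * (partition η Q ℓ)⁻¹ := by
      intro Q
      rw [← integral_mul_const]
      simp only [qTensor, Matrix.of_apply, tilted]
      refine integral_congr_ae (ae_of_all _ fun p => ?_)
      simp only
      ring
    let E : Sym0 →L[ℝ] ℝ := LinearMap.toContinuousLinearMap
      { toFun := fun H => (H : Matrix (Fin 3) (Fin 3) ℝ) i j
        map_add' := fun A B => rfl
        map_smul' := fun c A => rfl }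
    have hd := ((E.hasFDerivAt (x := Q₀)).sub
      (hD'.mul ((hasDerivAt_inv hZ.ne').comp_hasFDerivAt Q₀ hD))).isBigO_sub
    refine hd.congr_left fun Q => ?_
    have hQ0 := congrArg (fun A => A i j) hQ
    simp only [e] at hQ0
    simp only [Matrix.sub_apply, e]
    simp only [Function.comp_def, Pi.sub_apply, Pi.mul_apply]
    rw [hQ0]
    change (Q : Matrix (Fin 3) (Fin 3) ℝ) i j - _ - ((Q₀ : Matrix (Fin 3) (Fin 3) ℝ) i j - _) = _
    ring
  exact Asymptotics.isBigO_pi.2 fun i => Asymptotics.isBigO_pi.2 fun j => hentry i j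

theorem qTensor_add {f g : S2 → ℝ} (hf : Integrable f sigma) (hg : Integrable g sigma) :
    qTensor (fun p => f p + g p) = qTensor f + qTensor g := by
  ext i j
  have hfg : Integrable (fun p => f p + g p) sigma := hf.add hg
  rw [Matrix.add_apply, qTensor_apply hf, qTensor_apply hg, qTensor_apply hfg,
    integral_add hf hg]
  simp only [mul_add]
  rw [integral_add (integrable_coord_mul hf i j) (integrable_coord_mul hg i j)]
  ring

theorem qTensor_const_mul (c : ℝ) (f : S2 → ℝ) :
    qTensor (fun p => c * f p) = c • qTensor f := by
  ext i j
  simp only [qTensor, Matrix.of_apply, Matrix.smul_apply, smul_eq_mul]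
  rw [← integral_const_mul]
  congr 1
  ext p
  ring

/-- The function equal to `C p · p` minus its mean on the set `O`, and to `0` off `O`. -/
noncomputable def centeredQuad (O : Set S2) (C : Matrix (Fin 3) (Fin 3) ℝ) : S2 → ℝ :=
  O.indicator fun p => quad C p - (∫ q in O, quad C q ∂sigma) / sigma.real O

theorem integrable_quad (C : Matrix (Fin 3) (Fin 3) ℝ) :
    Integrable (fun p : S2 => quad C p) sigma :=
  integrable_of_continuous (continuous_quad_coe C)

theorem integrable_centeredQuad {O : Set S2} (hO : MeasurableSet O)
    (C : Matrix (Fin 3) (Fin 3) ℝ) : Integrable (centeredQuad O C) sigma :=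
  ((integrable_quad C).sub (integrable_const _)).indicator hO

theorem centeredQuad_add (O : Set S2) (A B : Matrix (Fin 3) (Fin 3) ℝ) :
    centeredQuad O (A + B) = fun p => centeredQuad O A p + centeredQuad O B p := by
  ext p
  have h : ∫ q in O, quad (A + B) q ∂sigma
      = ∫ q in O, quad A q ∂sigma + ∫ q in O, quad B q ∂sigma := by
    simp only [quad_add]
    exact integral_add (integrable_quad A).integrableOn (integrable_quad B).integrableOn
  by_cases hp : p ∈ O
  · simp only [centeredQuad, Set.indicator_of_mem hp, h]
    rw [quad_add]
    ring
  · simp [centeredQuad, Set.indicator_of_notMem hp]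

theorem centeredQuad_smul (O : Set S2) (c : ℝ) (A : Matrix (Fin 3) (Fin 3) ℝ) :
    centeredQuad O (c • A) = fun p => c * centeredQuad O A p := by
  ext p
  have h : ∫ q in O, quad (c • A) q ∂sigma = c * ∫ q in O, quad A q ∂sigma := by
    simp only [quad_smul]
    exact integral_const_mul _ _
  by_cases hp : p ∈ O
  · simp only [centeredQuad, Set.indicator_of_mem hp, h]
    rw [quad_smul]
    ring
  · simp [centeredQuad, Set.indicator_of_notMem hp]

theorem integral_centeredQuad {O : Set S2} (hO : IsOpen O) (hne : O.Nonempty)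
    (C : Matrix (Fin 3) (Fin 3) ℝ) : ∫ p, centeredQuad O C p ∂sigma = 0 := by
  have hpos : sigma.real O ≠ 0 := by
    rw [measureReal_ne_zero_iff]
    exact (hO.measure_pos sigma hne).ne'
  unfold centeredQuad
  rw [integral_indicator hO.measurableSet,
    integral_sub (integrable_quad C).integrableOn (integrable_const _), integral_const]
  simp only [measureReal_restrict_apply_univ, smul_eq_mul]
  rw [mul_div_cancel₀ _ hpos, sub_self]

theorem abs_centeredQuad_le {O : Set S2} (hO : IsOpen O) (hne : O.Nonempty)
    (C : Matrix (Fin 3) (Fin 3) ℝ) (p : S2) : |centeredQuad O C p| ≤ 18 * ‖C‖ := by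
  have hpos : 0 < sigma.real O := by
    exact ENNReal.toReal_pos (hO.measure_pos sigma hne).ne' (measure_ne_top _ _)
  by_cases hp : p ∈ O
  · rw [centeredQuad, Set.indicator_of_mem hp]
    have h1 := abs_quad_le C p
    have h2 : |(∫ q in O, quad C q ∂sigma) / sigma.real O| ≤ 9 * ‖C‖ := by
      rw [abs_div, abs_of_pos hpos, div_le_iff₀ hpos]
      exact norm_setIntegral_le_of_norm_le_const (f := fun q : S2 => quad C q)
        (measure_lt_top _ _) fun q _ => abs_quad_le C q
    have := abs_sub (quad C p) ((∫ q in O, quad C q ∂sigma) / sigma.real O)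
    linarith
  · rw [centeredQuad, Set.indicator_of_notMem hp, abs_zero]
    positivity

/-- The map `C ↦ qTensor (centeredQuad O C)` is injective: its quadratic form is the variance of
`C p · p` on `O`, and a traceless form is constant on no set of positive measure. -/
theorem eq_zero_of_qTensor_centeredQuad_eq_zero {O : Set S2} (hO : IsOpen O) (hne : O.Nonempty)
    (C : Sym0) (h : qTensor (centeredQuad O C) = 0) : C = 0 := by
  set a := (∫ q in O, quad (C : Matrix (Fin 3) (Fin 3) ℝ) q ∂sigma) / sigma.real O with ha
  have hint := integrable_centeredQuad hO.measurableSet (C : Matrix (Fin 3) (Fin 3) ℝ)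
  have h1 := integral_quad_mul_eq hint C
  rw [h, C.2.2] at h1
  have h2 : ∫ p, (centeredQuad O C p) ^ 2 ∂sigma = 0 := by
    have e : ∀ p, (centeredQuad O C p) ^ 2
        = quad (C : Matrix (Fin 3) (Fin 3) ℝ) p * centeredQuad O C p - a * centeredQuad O C p := by
      intro p
      by_cases hp : p ∈ O
      · simp only [centeredQuad, Set.indicator_of_mem hp, ← ha]; ring
      · simp [centeredQuad, Set.indicator_of_notMem hp]
    simp only [e]
    rw [integral_sub (integrable_mul_of_continuous hint (continuous_quad_coe _))
      (hint.const_mul _), integral_const_mul, integral_centeredQuad hO hne, h1]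
    simp [contract]
  have hint2 : Integrable (fun p => (centeredQuad O C p) ^ 2) sigma := by
    refine Integrable.of_bound (hint.1.pow 2) ((18 * ‖(C : Matrix (Fin 3) (Fin 3) ℝ)‖) ^ 2)
      (ae_of_all _ fun p => ?_)
    rw [norm_pow, Real.norm_eq_abs]
    exact pow_le_pow_left₀ (abs_nonneg _) (abs_centeredQuad_le hO hne _ p) 2
  have h3 := (integral_eq_zero_iff_of_nonneg (fun p => sq_nonneg _) hint2).1 h2
  have hC : (C : Matrix (Fin 3) (Fin 3) ℝ) = a • 1 := by
    by_contra hCne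
    have hnull := sigma_quad_eq C.2.1 hCne
    refine (hO.measure_pos sigma hne).ne' ?_
    have hsub : ∀ᵐ p ∂sigma, p ∉ O := by
      filter_upwards [h3, measure_eq_zero_iff_ae_notMem.1 hnull] with p hp hp' hpO
      simp only [centeredQuad, Set.indicator_of_mem hpO, ← ha, Pi.zero_apply] at hp
      exact hp' (by
        have := pow_eq_zero_iff two_ne_zero |>.1 hp
        simpa [sub_eq_zero] using this)
    exact measure_eq_zero_iff_ae_notMem.2 hsub
  have htr := C.2.2
  rw [hC, Matrix.trace_smul, Matrix.trace_one] at htr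
  simp at htr
  ext1
  rw [hC, htr]
  simp

/-- Bounded functions supported in a given open set, of integral zero, realise every traceless
symmetric matrix as Q-tensor, with linear bounds. -/
theorem exists_perturbation {O : Set S2} (hO : IsOpen O) (hne : O.Nonempty) :
    ∃ (Φ : Sym0 → S2 → ℝ) (K : ℝ), 0 ≤ K ∧ ∀ H : Sym0, Integrable (Φ H) sigma ∧
      (∀ p, |Φ H p| ≤ K * ‖H‖) ∧ (∀ p, p ∉ O → Φ H p = 0) ∧ ∫ p, Φ H p ∂sigma = 0 ∧
      qTensor (Φ H) = H := by
  have hint := fun C : Sym0 =>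
    integrable_centeredQuad hO.measurableSet (C : Matrix (Fin 3) (Fin 3) ℝ)
  let T : Sym0 →ₗ[ℝ] Sym0 :=
    { toFun := fun C => ⟨qTensor (centeredQuad O C), qTensor_mem (hint C)⟩
      map_add' := fun A B => by
        ext1
        simp only [Submodule.coe_add, centeredQuad_add]
        exact qTensor_add (hint A) (hint B)
      map_smul' := fun c A => by
        ext1
        simp only [Submodule.coe_smul, centeredQuad_smul]
        exact qTensor_const_mul c _ }
  have hinj : Function.Injective T := by
    rw [← LinearMap.ker_eq_bot, LinearMap.ker_eq_bot']
    intro C hC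
    exact eq_zero_of_qTensor_centeredQuad_eq_zero hO hne C (congrArg Subtype.val hC)
  let e := (LinearEquiv.ofInjectiveEndo T hinj)
  let S : Sym0 →L[ℝ] Sym0 := LinearMap.toContinuousLinearMap (e.symm : Sym0 →ₗ[ℝ] Sym0)
  refine ⟨fun H => centeredQuad O (S H), 18 * ‖S‖, by positivity, fun H =>
    ⟨hint _, fun p => ?_, fun p hp => Set.indicator_of_notMem hp _,
      integral_centeredQuad hO hne _, ?_⟩⟩
  · refine (abs_centeredQuad_le hO hne _ p).trans ?_
    rw [mul_assoc]
    exact mul_le_mul_of_nonneg_left (S.le_opNorm H) (by norm_num)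
  · have : T (S H) = H := e.apply_symm_apply H
    exact congrArg Subtype.val this

/-- Near `Q₀` the function `J` lies between the Gibbs bound and the Gibbs bound plus a quadratic
error, if the tilted density realises `Q₀`. Hence `J` inherits the derivative of the Gibbs bound. -/
theorem hasFDerivAt_J {η : ℝ} {Q₀ : Sym0} (h0 : sigma {p | weight η Q₀ p = 0} = 0)
    {Λ : Matrix (Fin 3) (Fin 3) ℝ} (hZ : 0 < partition η Q₀ fun p => quad Λ p)
    (hf : (fun p => tilted η Q₀ (fun p => quad Λ p) p / partition η Q₀ fun p => quad Λ p)
      ∈ admissible Q₀) :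
    Q₀ ∈ interior (domJ η) ∧ ∃ D : Sym0 →L[ℝ] ℝ,
      (∀ H : Sym0, D H = contract Λ H - (partition η Q₀ fun p => quad Λ p)⁻¹ *
        ∫ p, quad (H : Matrix (Fin 3) (Fin 3) ℝ) p *
          (if 0 < weight η Q₀ p then Real.exp (quad Λ p) else 0) ∂sigma) ∧
      HasFDerivAt (fun Q : Sym0 => (J η Q).toReal) D Q₀ := by
  set ℓ : S2 → ℝ := fun p => quad Λ p with hℓdef
  have hℓ : Continuous ℓ := continuous_quad_coe Λ
  have hint : ∀ Q, Integrable (fun p => tilted η Q ℓ p / partition η Q ℓ) sigma := fun Q =>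
    (integrable_of_continuous (continuous_tilted η Q hℓ)).div_const _
  -- an open set on which the weight is bounded below
  obtain ⟨p₀, hp₀⟩ : ∃ p, 0 < weight η Q₀ p := by
    by_contra! hall
    have : partition η Q₀ ℓ = 0 := by
      simp [partition, tilted, max_eq_right (hall _)]
    exact hZ.ne' this
  set κ := weight η Q₀ p₀ / 2 with hκ
  have hκ0 : 0 < κ := by positivity
  set O : Set S2 := {p | κ < weight η Q₀ p} with hOdef
  have hO : IsOpen O := isOpen_lt continuous_const (continuous_weight η Q₀)
  have hne : O.Nonempty := ⟨p₀, by change κ < _; linarith⟩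
  obtain ⟨Φ, K, hK, hΦ⟩ := exists_perturbation hO hne
  obtain ⟨M, hM0, hM⟩ := exists_abs_le_of_continuous hℓ
  set Z₀ := partition η Q₀ ℓ with hZ₀
  -- a lower bound on `O` for the normalised tilted densities with `Q` near `Q₀`, where the weight
  -- is at least `κ / 2` and the partition function at most `2 Z₀`
  set c := κ / 2 * Real.exp (-M) / (2 * Z₀) with hc
  have hc0 : 0 < c := by positivity
  -- the defect of the Q-tensor, to be corrected by the perturbation `Φ (r Q)`
  let r : Sym0 → Sym0 := fun Q =>
    ⟨Q - qTensor (fun p => tilted η Q ℓ p / partition η Q ℓ),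
      Sym0.sub_mem Q.2 (qTensor_mem (hint Q))⟩
  have hr : r =O[𝓝 Q₀] fun Q => Q - Q₀ :=
    Asymptotics.isBigO_norm_left.1 (isBigO_sub_qTensor_tilted h0 hℓ hZ hf.2).norm_left
  obtain ⟨D, hD, hD'⟩ := hasFDerivAt_gibbsBound h0 hZ
  obtain ⟨DZ, -, hDZ⟩ := hasFDerivAt_partition h0 hℓ
  have hrt : Tendsto (fun Q => K * ‖r Q‖) (𝓝 Q₀) (𝓝 0) := by
    have h1 : Tendsto (fun Q : Sym0 => Q - Q₀) (𝓝 Q₀) (𝓝 0) := by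
      have h2 : Continuous fun Q : Sym0 => Q - Q₀ := by fun_prop
      simpa using h2.tendsto Q₀
    have h2 := (hr.trans_tendsto h1).norm.const_mul K
    simpa using h2
  have hup : ∀ᶠ Q in 𝓝 Q₀,
      J η Q ≤ ((gibbsBound η Λ Q + K ^ 2 * ‖r Q‖ ^ 2 / c * sigma.real univ : ℝ) : EReal) := by
    filter_upwards [hrt.eventually_lt_const hc0,
      hDZ.continuousAt.eventually_lt continuousAt_const (show Z₀ < 2 * Z₀ by linarith),
      continuousAt_const.eventually_lt hDZ.continuousAt (show 0 < Z₀ from hZ),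
      Metric.ball_mem_nhds Q₀ (show 0 < κ / 18 by positivity)] with Q hrQ hZ2 hZ1 hball
    -- `g + Φ (r Q)` is admissible for `Q`, and `(Φ (r Q))² / g` is quadratic in `r Q`
    set g : S2 → ℝ := fun p => tilted η Q ℓ p / partition η Q ℓ with hg
    obtain ⟨hΦi, hΦb, hΦ0, hΦz, hΦq⟩ := hΦ (r Q)
    have hg0 : ∀ p, 0 ≤ g p := fun p => div_nonneg (tilted_nonneg _ _ _ _) hZ1.le
    have hgc : ∀ p ∈ O, c ≤ g p := by
      intro p hp
      have hw : κ / 2 ≤ weight η Q p := by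
        have h1 := abs_le.1 (abs_weight_sub_le η Q Q₀ p)
        have h2 : ‖Q - Q₀‖ < κ / 18 := by rwa [mem_ball_iff_norm] at hball
        have h3 : κ < weight η Q₀ p := hp
        linarith [h1.1]
      have he : Real.exp (-M) ≤ Real.exp (ℓ p) := Real.exp_le_exp.2 (abs_le.1 (hM p)).1
      rw [hc, hg]
      refine div_le_div₀ (tilted_nonneg _ _ _ _) ?_ hZ1 hZ2.le
      exact mul_le_mul (hw.trans (le_max_left _ _)) he (Real.exp_pos _).le
        (le_max_right _ _)
    have hφ : ∀ p, (Φ (r Q) p) ^ 2 ≤ K ^ 2 * ‖r Q‖ ^ 2 / c * g p := by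
      intro p
      by_cases hp : p ∈ O
      · have h1 : (Φ (r Q) p) ^ 2 ≤ (K * ‖r Q‖) ^ 2 := sq_le_sq' (abs_le.1 (hΦb p)).1
          (abs_le.1 (hΦb p)).2
        calc _ ≤ K ^ 2 * ‖r Q‖ ^ 2 / c * c := by
              rw [div_mul_cancel₀ _ hc0.ne', ← mul_pow]; exact h1
          _ ≤ _ := mul_le_mul_of_nonneg_left (hgc p hp) (by positivity)
      · rw [hΦ0 p hp, zero_pow two_ne_zero]
        exact mul_nonneg (by positivity) (hg0 p)
    refine J_le_gibbsBound_add (f := fun p => g p + Φ (r Q) p) ⟨⟨(hint Q).add hΦi,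
      ae_of_all _ fun p => ?_, ?_⟩, ?_⟩ hZ1 fun p => ?_
    · by_cases hp : p ∈ O
      · have := (abs_le.1 (hΦb p)).1
        have := hgc p hp
        change 0 ≤ g p + Φ (r Q) p
        linarith
      · change 0 ≤ g p + Φ (r Q) p
        rw [hΦ0 p hp, add_zero]
        exact hg0 p
    · rw [integral_add (hint Q) hΦi, hΦz, add_zero, integral_div]
      exact div_self hZ1.ne'
    · rw [qTensor_add (hint Q) hΦi, hΦq]
      exact add_sub_cancel _ _
    · change (g p + Φ (r Q) p - g p) ^ 2 ≤ _
      rw [add_sub_cancel_left]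
      exact hφ p
  have hdom : Q₀ ∈ interior (domJ η) := by
    rw [mem_interior_iff_mem_nhds]
    filter_upwards [hup] with Q hQ
    exact hQ.trans_lt (EReal.coe_lt_top _)
  refine ⟨hdom, D, hD, ?_⟩
  have hE : (fun Q : Sym0 => (J η Q).toReal - gibbsBound η Λ Q) =O[𝓝 Q₀]
      fun Q => ‖Q - Q₀‖ ^ 2 := by
    have h1 : (fun Q : Sym0 => (J η Q).toReal - gibbsBound η Λ Q) =O[𝓝 Q₀]
        fun Q => ‖r Q‖ ^ 2 := by
      refine Asymptotics.IsBigO.of_bound (K ^ 2 / c * sigma.real univ) ?_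
      filter_upwards [hup] with Q hQ
      have hlow := gibbsBound_le_J η Λ Q
      have hreal : J η Q = (((J η Q).toReal : ℝ) : EReal) :=
        (EReal.coe_toReal (hQ.trans_lt (EReal.coe_lt_top _)).ne
          ((EReal.bot_lt_coe _).trans_le hlow).ne').symm
      rw [hreal, EReal.coe_le_coe_iff] at hlow hQ
      rw [Real.norm_eq_abs, abs_of_nonneg (by linarith), norm_pow, norm_norm]
      calc _ ≤ K ^ 2 * ‖r Q‖ ^ 2 / c * sigma.real univ := by linarith
        _ = _ := by ring
    exact h1.trans (hr.norm_norm.pow 2)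
  have hE' := Asymptotics.IsBigO.hasFDerivAt (𝕜 := ℝ) hE one_lt_two
  have hsum := hE'.add hD'
  rw [zero_add] at hsum
  refine hsum.congr_of_eventuallyEq (Eventually.of_forall fun Q => ?_)
  simp

end Differentiability

/-! ### Uniaxial tensors and criticality -/

theorem uniaxialQ_eq_smul (S : ℝ) (n : S2) : uniaxialQ S n = S • uniaxialQ 1 n := by
  ext1
  simp [uniaxialQ]

theorem quad_uniaxialQ_self (S : ℝ) (n : S2) :
    quad (uniaxialQ S n : Matrix (Fin 3) (Fin 3) ℝ) n = S * (2 / 3) := by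
  rw [quad_uniaxialQ, real_inner_self_eq_norm_sq]
  norm_num

theorem contract_uniaxialQ (S : ℝ) (n : S2) (H : Sym0) :
    contract (uniaxialQ S n) H = S * quad (H : Matrix (Fin 3) (Fin 3) ℝ) n := by
  have ht := H.2.2
  simp only [Matrix.trace, Fin.sum_univ_three, Matrix.diag_apply] at ht
  simp [contract, uniaxialQ, quad, Fin.sum_univ_three, Matrix.one_apply]
  linear_combination (-S / 3) * ht

theorem weight_uniaxialQ (η S : ℝ) (n p : S2) :
    weight η (uniaxialQ S n) p = S * ((inner ℝ (n : E3) (p : E3)) ^ 2 - 1 / 3) - η := by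
  rw [weight, quad_uniaxialQ]

theorem uniaxialQ_ne_smul_one {S : ℝ} (hS : S ≠ 0) (n : S2) (c : ℝ) :
    (uniaxialQ S n : Matrix (Fin 3) (Fin 3) ℝ) ≠ c • 1 := by
  intro h
  have ht := (uniaxialQ S n).2.2
  rw [h, Matrix.trace_smul, Matrix.trace_one] at ht
  have hc : c = 0 := by simpa using ht
  have hq := quad_uniaxialQ_self S n
  rw [h, hc, quad_smul, zero_mul] at hq
  exact hS (by linarith)

theorem sigma_weight_uniaxialQ_eq_zero (η : ℝ) {S : ℝ} (hS : S ≠ 0) (n : S2) :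
    sigma {p | weight η (uniaxialQ S n) p = 0} = 0 := by
  have := sigma_quad_eq (uniaxialQ S n).2.1 (uniaxialQ_ne_smul_one hS n η)
  simpa [weight, sub_eq_zero] using this

section Differentiability

attribute [local instance] Matrix.normedAddCommGroup Matrix.normedSpace normTopology

/-- The derivative is an integral of `H p · p` against an axisymmetric function, hence a multiple
of `H n · n` because `H` is traceless. -/
theorem hasFDerivAt_J_uniaxialQ {η S lam : ℝ} (hS : S ≠ 0) (n : S2)
    (hZ : 0 < partition η (uniaxialQ S n) fun p => quad (uniaxialQ lam n) p)
    (hf : (fun p => tilted η (uniaxialQ S n) (fun p => quad (uniaxialQ lam n) p) p /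
      partition η (uniaxialQ S n) fun p => quad (uniaxialQ lam n) p) ∈ admissible (uniaxialQ S n)) :
    ∃ D : Sym0 →L[ℝ] ℝ, (∃ k : ℝ, ∀ H : Sym0, D H = k * quad (H : Matrix (Fin 3) (Fin 3) ℝ) n) ∧
      HasFDerivAt (fun Q : Sym0 => (J η Q).toReal) D (uniaxialQ S n) := by
  obtain ⟨-, D, hD, hD'⟩ := hasFDerivAt_J (sigma_weight_uniaxialQ_eq_zero η hS n) hZ hf
  refine ⟨D, ?_, hD'⟩
  let h : ℝ → ℝ := fun t =>
    if 0 < S * (t ^ 2 - 1 / 3) - η then Real.exp (lam * (t ^ 2 - 1 / 3)) else 0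
  have hi : Integrable (fun p : S2 => h (inner ℝ (n : E3) (p : E3))) sigma := by
    have hc : Continuous fun p : S2 => Real.exp (lam * ((inner ℝ (n : E3) (p : E3)) ^ 2 - 1 / 3)) := by
      fun_prop
    have hs : IsOpen {p : S2 | 0 < S * ((inner ℝ (n : E3) (p : E3)) ^ 2 - 1 / 3) - η} :=
      isOpen_lt continuous_const (by fun_prop)
    exact (integrable_of_continuous hc).indicator hs.measurableSet
  refine ⟨lam - (partition η (uniaxialQ S n) fun p => quad (uniaxialQ lam n) p)⁻¹ *
    (1 / 2 * ∫ p : S2, (3 * (inner ℝ (n : E3) (p : E3)) ^ 2 - 1) *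
          h (inner ℝ (n : E3) (p : E3)) ∂sigma), fun H => ?_⟩
  have e := integral_quad_axisymmetric n h hi H
  rw [H.2.2, mul_zero, zero_add] at e
  rw [hD, contract_uniaxialQ, sub_mul, mul_assoc, ← e]
  simp only [weight_uniaxialQ, quad_uniaxialQ, h]

theorem hasDerivAt_J_uniaxialQ {η S : ℝ} {n : S2} {D : Sym0 →L[ℝ] ℝ}
    (hD : HasFDerivAt (fun Q : Sym0 => (J η Q).toReal) D (uniaxialQ S n)) :
    HasDerivAt (fun s => (J η (uniaxialQ s n)).toReal) (D (uniaxialQ 1 n)) S := by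
  have h1 : HasDerivAt (fun s => uniaxialQ s n) (uniaxialQ 1 n) S := by
    have h2 := (hasDerivAt_id S).smul_const (uniaxialQ 1 n)
    rw [one_smul] at h2
    refine h2.congr_of_eventuallyEq (Eventually.of_forall fun s => ?_)
    exact uniaxialQ_eq_smul s n
  exact hD.comp_hasDerivAt S h1

theorem continuousAt_J_uniaxialQ {η S lam : ℝ} (hS : S ≠ 0) (n : S2)
    (hZ : 0 < partition η (uniaxialQ S n) fun p => quad (uniaxialQ lam n) p)
    (hf : (fun p => tilted η (uniaxialQ S n) (fun p => quad (uniaxialQ lam n) p) p /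
      partition η (uniaxialQ S n) fun p => quad (uniaxialQ lam n) p) ∈ admissible (uniaxialQ S n)) :
    ContinuousAt (fun s => (J η (uniaxialQ s n)).toReal) S := by
  obtain ⟨D, -, hD⟩ := hasFDerivAt_J_uniaxialQ hS n hZ hf
  exact (hasDerivAt_J_uniaxialQ hD).continuousAt

/-- By axial symmetry the derivative of `J` at a uniaxial tensor is a multiple of `H ↦ H n · n`,
so that it vanishes as soon as it vanishes along the uniaxial line. -/
theorem isCriticalPoint_of_isLocalMin {η S lam : ℝ} (hS : S ≠ 0) (n : S2)
    (hZ : 0 < partition η (uniaxialQ S n) fun p => quad (uniaxialQ lam n) p)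
    (hf : (fun p => tilted η (uniaxialQ S n) (fun p => quad (uniaxialQ lam n) p) p /
      partition η (uniaxialQ S n) fun p => quad (uniaxialQ lam n) p) ∈ admissible (uniaxialQ S n))
    (hmin : IsLocalMin (fun s => (J η (uniaxialQ s n)).toReal) S) :
    IsCriticalPoint η (uniaxialQ S n) := by
  obtain ⟨D, ⟨k, hk⟩, hD⟩ := hasFDerivAt_J_uniaxialQ hS n hZ hf
  have h0 := hmin.hasDerivAt_eq_zero (hasDerivAt_J_uniaxialQ hD)
  rw [hk, quad_uniaxialQ_self] at h0
  have hk0 : k = 0 := by linarith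
  have hD0 : D = 0 := by
    ext H
    rw [hk, hk0, zero_mul]
    rfl
  subst hD0
  exact ⟨(hasFDerivAt_J (sigma_weight_uniaxialQ_eq_zero η hS n) hZ hf).1, hD⟩

end Differentiability

/-! ### Feasible uniaxial tensors -/

/-- The point `√τ n + √(1 - τ) u`, with `u` a unit vector orthogonal to `n`. -/
theorem exists_inner_sq_eq (n : S2) {τ : ℝ} (h0 : 0 ≤ τ) (h1 : τ ≤ 1) :
    ∃ p : S2, (inner ℝ (n : E3) (p : E3)) ^ 2 = τ := by
  obtain ⟨u, hu, hnu⟩ : ∃ u : E3, ‖u‖ = 1 ∧ inner ℝ (n : E3) u = (0 : ℝ) := by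
    have hrank : Module.finrank ℝ (ℝ ∙ (n : E3))ᗮ = 2 := by
      have : Fact (Module.finrank ℝ E3 = 2 + 1) := ⟨by simp⟩
      exact Submodule.finrank_orthogonal_span_singleton (by
        intro h
        have := norm_eq_of_mem_sphere n
        rw [h, norm_zero] at this
        exact zero_ne_one this)
    have : Nontrivial (ℝ ∙ (n : E3))ᗮ := Module.nontrivial_of_finrank_pos (R := ℝ) (by omega)
    obtain ⟨u, hu⟩ := exists_norm_eq (E := (ℝ ∙ (n : E3))ᗮ) zero_le_one
    exact ⟨u, hu, Submodule.mem_orthogonal_singleton_iff_inner_right.1 u.2⟩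
  have hnn : inner ℝ (n : E3) (n : E3) = (1 : ℝ) := by rw [real_inner_self_eq_norm_sq]; simp
  have huu : inner ℝ u u = (1 : ℝ) := by rw [real_inner_self_eq_norm_sq, hu, one_pow]
  have hmem : √τ • (n : E3) + √(1 - τ) • u ∈ Metric.sphere (0 : E3) 1 := by
    rw [mem_sphere_zero_iff_norm]
    have : ‖√τ • (n : E3) + √(1 - τ) • u‖ ^ 2 = 1 := by
      rw [← real_inner_self_eq_norm_sq]
      simp only [inner_add_left, inner_add_right, real_inner_smul_left, real_inner_smul_right,
        hnn, huu, hnu, real_inner_comm (n : E3) u]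
      have h2 := Real.mul_self_sqrt h0
      have h3 := Real.mul_self_sqrt (sub_nonneg.2 h1)
      linarith
    exact (pow_eq_one_iff_of_nonneg (norm_nonneg _) two_ne_zero).1 this
  refine ⟨⟨_, hmem⟩, ?_⟩
  simp only [inner_add_right, real_inner_smul_right, hnn, hnu, mul_one, mul_zero, add_zero]
  exact Real.sq_sqrt h0

theorem integral_pos_of_continuous {g : S2 → ℝ} (hg : Continuous g) (h0 : ∀ p, 0 ≤ g p) {p₀ : S2}
    (hp : 0 < g p₀) : 0 < ∫ p, g p ∂sigma := by
  rw [integral_pos_iff_support_of_nonneg h0 (integrable_of_continuous hg)]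
  exact hg.isOpen_support.measure_pos sigma ⟨p₀, hp.ne'⟩

/-- A large tilt favours positive values of `X`. With `A = ∫ v X₊²` and `B = ∫ v |X|` the
inequality `X exp (lam X) ≥ lam X₊² - |X|` shows that `lam = B / A` suffices. -/
theorem exists_tilt_integral_nonneg {v X : S2 → ℝ} (hv : Continuous v) (hX : Continuous X)
    (hv0 : ∀ p, 0 ≤ v p) {p₁ : S2} (h1 : 0 < v p₁) (h1' : 0 < X p₁) :
    ∃ lam : ℝ, 0 ≤ ∫ p, v p * (X p * Real.exp (lam * X p)) ∂sigma := by
  have hA : 0 < ∫ p, v p * (max (X p) 0) ^ 2 ∂sigma :=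
    integral_pos_of_continuous (p₀ := p₁) (hv.mul ((hX.max continuous_const).pow 2))
      (fun p => mul_nonneg (hv0 p) (sq_nonneg _)) (by
        rw [max_eq_left h1'.le]; positivity)
  set A := ∫ p, v p * (max (X p) 0) ^ 2 ∂sigma with hAdef
  set B := ∫ p, v p * |X p| ∂sigma with hBdef
  have hB : 0 ≤ B := integral_nonneg fun p => mul_nonneg (hv0 p) (abs_nonneg _)
  refine ⟨B / A, ?_⟩
  have hlam : 0 ≤ B / A := by positivity
  have i1 : Integrable (fun p => v p * (max (X p) 0) ^ 2) sigma :=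
    integrable_of_continuous (hv.mul ((hX.max continuous_const).pow 2))
  have i2 : Integrable (fun p => v p * |X p|) sigma := integrable_of_continuous (hv.mul hX.abs)
  have hle : ∫ p, (B / A * (v p * (max (X p) 0) ^ 2) - v p * |X p|) ∂sigma
      ≤ ∫ p, v p * (X p * Real.exp (B / A * X p)) ∂sigma := by
    refine integral_mono ((i1.const_mul _).sub i2)
      (integrable_of_continuous (hv.mul (hX.mul (by fun_prop)))) fun p => ?_
    have hx : B / A * (max (X p) 0) ^ 2 - |X p| ≤ X p * Real.exp (B / A * X p) := by
      rcases le_total 0 (X p) with h | h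
      · rw [max_eq_left h, abs_of_nonneg h]
        have := mul_le_mul_of_nonneg_left (Real.add_one_le_exp (B / A * X p)) h
        nlinarith
      · rw [max_eq_right h, abs_of_nonpos h]
        have : Real.exp (B / A * X p) ≤ 1 := Real.exp_le_one_iff.2 (by nlinarith)
        nlinarith
    have := mul_le_mul_of_nonneg_left hx (hv0 p)
    simp only
    linarith
  rw [integral_sub (i1.const_mul _) i2, integral_const_mul] at hle
  have hz : B / A * A - B = 0 := by field_simp; ring
  have : B / A * A - B ≤ ∫ p, v p * (X p * Real.exp (B / A * X p)) ∂sigma := hle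
  linarith

/-- An exponential tilt can shift the mean of `X` to zero if `X` takes both signs on the support
of the weight. -/
theorem exists_tilt_integral_eq_zero {v X : S2 → ℝ} (hv : Continuous v) (hX : Continuous X)
    (hv0 : ∀ p, 0 ≤ v p) {p₁ p₂ : S2} (h1 : 0 < v p₁) (h1' : 0 < X p₁) (h2 : 0 < v p₂)
    (h2' : X p₂ < 0) :
    ∃ lam : ℝ, ∫ p, v p * (X p * Real.exp (lam * X p)) ∂sigma = 0 := by
  have hcont : Continuous fun lam : ℝ => ∫ p, v p * (X p * Real.exp (lam * X p)) ∂sigma := by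
    have := continuous_parametric_integral_of_continuous (μ := sigma)
      (f := fun (lam : ℝ) p => v p * (X p * Real.exp (lam * X p)))
      (by simp only [Function.uncurry_def]; fun_prop) isCompact_univ
    simpa using this
  obtain ⟨a, ha⟩ := exists_tilt_integral_nonneg hv hX hv0 h1 h1'
  obtain ⟨b, hb⟩ := exists_tilt_integral_nonneg hv hX.neg hv0 h2 (by simpa using h2')
  have hb' : ∫ p, v p * (X p * Real.exp (-b * X p)) ∂sigma ≤ 0 := by
    have e : ∀ p, v p * (-X p * Real.exp (b * -X p)) = -(v p * (X p * Real.exp (-b * X p))) :=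
      fun p => by rw [mul_neg, ← neg_mul b]; ring
    simp only [Pi.neg_apply, e, integral_neg] at hb
    linarith
  exact mem_range_of_exists_le_of_exists_ge hcont ⟨_, hb'⟩ ⟨_, ha⟩

/-- An axisymmetric density has a uniaxial Q-tensor, whose parameter can be read off from the
second moment along the axis. -/
theorem qTensor_axisymmetric {f : S2 → ℝ} {h : ℝ → ℝ} {n : S2}
    (hfh : ∀ p : S2, f p = h (inner ℝ (n : E3) (p : E3))) (hi : Integrable f sigma)
    (h1 : ∫ p, f p ∂sigma = 1) {S : ℝ}
    (hm : ∫ p : S2, ((inner ℝ (n : E3) (p : E3)) ^ 2 - (1 / 3 + 2 * S / 3)) * f p ∂sigma = 0) :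
    qTensor f = uniaxialQ S n := by
  obtain rfl : f = fun p : S2 => h (inner ℝ (n : E3) (p : E3)) := funext hfh
  have hint : ∀ g : S2 → ℝ, Continuous g →
      Integrable (fun p => g p * h (inner ℝ (n : E3) (p : E3))) sigma :=
    fun g hg => integrable_mul_of_continuous hi hg
  have hm2 : ∫ p : S2, (inner ℝ (n : E3) (p : E3)) ^ 2 * h (inner ℝ (n : E3) (p : E3)) ∂sigma
      = 1 / 3 + 2 * S / 3 := by
    simp only [sub_mul] at hm
    rw [integral_sub (hint _ (by fun_prop)) (hi.const_mul _), integral_const_mul, h1] at hm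
    linarith
  have ha : ∫ p : S2, (1 - (inner ℝ (n : E3) (p : E3)) ^ 2) * h (inner ℝ (n : E3) (p : E3)) ∂sigma
      = 2 / 3 - 2 * S / 3 := by
    simp only [sub_mul, one_mul]
    rw [integral_sub hi (hint _ (by fun_prop)), h1, hm2]
    ring
  have hb : ∫ p : S2, (3 * (inner ℝ (n : E3) (p : E3)) ^ 2 - 1) *
      h (inner ℝ (n : E3) (p : E3)) ∂sigma = 2 * S := by
    simp only [sub_mul, one_mul, mul_assoc (3 : ℝ)]
    rw [integral_sub ((hint _ (by fun_prop)).const_mul _) hi, integral_const_mul, h1, hm2]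
    ring
  ext i j
  rw [qTensor_apply hi, integral_coord_mul_axisymmetric n h hi, ha, hb, h1]
  simp only [uniaxialQ, Matrix.smul_apply, Matrix.sub_apply, Matrix.of_apply, smul_eq_mul]
  ring

/-- If `2 S² / 3 > η` then a tilted density realises the uniaxial tensor of parameter `S`. -/
theorem exists_tilted_mem_admissible {η S : ℝ} (n : S2) (hS1 : -1 / 2 < S) (hS2 : S < 1)
    (hη : η < 2 * S ^ 2 / 3) :
    ∃ lam : ℝ, 0 < (partition η (uniaxialQ S n) fun p => quad (uniaxialQ lam n) p) ∧
      (fun p => tilted η (uniaxialQ S n) (fun p => quad (uniaxialQ lam n) p) p /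
      partition η (uniaxialQ S n) fun p => quad (uniaxialQ lam n) p)
        ∈ admissible (uniaxialQ S n) := by
  -- at height `t² = m` the weight is positive, hence also for `t²` slightly above or below `m`
  set m := 1 / 3 + 2 * S / 3 with hm
  obtain ⟨ε, hε, hε1, hε2, hε3⟩ : ∃ ε > 0, ε ≤ m ∧ ε ≤ 1 - m ∧ ε < 2 * S ^ 2 / 3 - η := by
    refine ⟨min (min m (1 - m)) ((2 * S ^ 2 / 3 - η) / 2), ?_, ?_, ?_, ?_⟩
    · exact lt_min (lt_min (by linarith) (by linarith)) (by linarith)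
    · exact (min_le_left _ _).trans (min_le_left _ _)
    · exact (min_le_left _ _).trans (min_le_right _ _)
    · exact (min_le_right _ _).trans_lt (by linarith)
  obtain ⟨p₁, hp₁⟩ := exists_inner_sq_eq n (τ := m + ε) (by linarith) (by linarith)
  obtain ⟨p₂, hp₂⟩ := exists_inner_sq_eq n (τ := m - ε) (by linarith) (by linarith)
  have hv := (continuous_weight η (uniaxialQ S n)).max (continuous_const (y := (0 : ℝ)))
  have hX : Continuous fun p : S2 => (inner ℝ (n : E3) (p : E3)) ^ 2 - m := by fun_prop
  have hw1 : 0 < max (weight η (uniaxialQ S n) p₁) 0 := by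
    refine lt_max_of_lt_left ?_
    rw [weight_uniaxialQ, hp₁, hm]
    nlinarith
  have hw2 : 0 < max (weight η (uniaxialQ S n) p₂) 0 := by
    refine lt_max_of_lt_left ?_
    rw [weight_uniaxialQ, hp₂, hm]
    nlinarith
  obtain ⟨lam, hlam⟩ := exists_tilt_integral_eq_zero hv hX (fun _ => le_max_right _ _)
    hw1 (by rw [hp₁]; linarith) hw2 (by rw [hp₂]; linarith)
  have hZ : 0 < partition η (uniaxialQ S n) fun p => quad (uniaxialQ lam n) p :=
    integral_pos_of_continuous (p₀ := p₁) (continuous_tilted _ _ (continuous_quad_coe _))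
      (tilted_nonneg _ _ _) (mul_pos hw1 (Real.exp_pos _))
  set Z := partition η (uniaxialQ S n) fun p => quad (uniaxialQ lam n) p with hZdef
  have hi := (integrable_of_continuous (continuous_tilted η (uniaxialQ S n)
    (continuous_quad_coe (uniaxialQ lam n : Matrix (Fin 3) (Fin 3) ℝ)))).div_const Z
  have hone : ∫ p, tilted η (uniaxialQ S n) (fun p => quad (uniaxialQ lam n) p) p / Z ∂sigma
      = 1 := by
    rw [integral_div]
    exact div_self hZ.ne'
  refine ⟨lam, hZ, ⟨hi, ae_of_all _ fun p => div_nonneg (tilted_nonneg _ _ _ _) hZ.le, hone⟩, ?_⟩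
  refine qTensor_axisymmetric (h := fun t => max (S * (t ^ 2 - 1 / 3) - η) 0 *
    Real.exp (lam * (t ^ 2 - 1 / 3)) / Z) (fun p => ?_) hi hone ?_
  · simp only [tilted, weight_uniaxialQ, quad_uniaxialQ]
  · have e : ∀ p : S2, ((inner ℝ (n : E3) (p : E3)) ^ 2 - (1 / 3 + 2 * S / 3)) *
        (tilted η (uniaxialQ S n) (fun p => quad (uniaxialQ lam n) p) p / Z)
        = Real.exp (lam * (m - 1 / 3)) / Z * (max (weight η (uniaxialQ S n) p) 0 *
          (((inner ℝ (n : E3) (p : E3)) ^ 2 - m) *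
            Real.exp (lam * ((inner ℝ (n : E3) (p : E3)) ^ 2 - m)))) := by
      intro p
      have : Real.exp (lam * ((inner ℝ (n : E3) (p : E3)) ^ 2 - 1 / 3))
          = Real.exp (lam * (m - 1 / 3)) * Real.exp (lam * ((inner ℝ (n : E3) (p : E3)) ^ 2 - m)) := by
        rw [← Real.exp_add]; congr 1; ring
      simp only [tilted, quad_uniaxialQ, this, ← hm]
      ring
    simp only [e]
    rw [integral_const_mul, hlam, mul_zero]

/-! ### Blow-up of `J` and existence of minimisers -/

/-- A bound which forces `J` to be infinite where `2 S² / 3 ≤ η`, and to blow up where the two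
sides become equal. -/
theorem linear_bound_le_J {η S k : ℝ} (n : S2) (hk : 0 < k) :
    ((-k * (2 * S ^ 2 / 3 - η) - Real.log (k⁻¹ * sigma.real univ) : ℝ) : EReal)
      ≤ J η (uniaxialQ S n) := by
  refine le_iInf₂ fun f hf => ?_
  rcases eq_top_or_lt_top (freeEnergy η f) with hF | hF
  · simp [hF]
  have hℓ : Continuous fun p => -k * weight η (uniaxialQ S n) p :=
    continuous_const.mul (continuous_weight _ _)
  refine le_trans ?_ (gibbs_le_freeEnergy η hf hℓ)
  have hZ := partition_pos_of_freeEnergy_lt_top hf hF hℓ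
  rw [EReal.coe_le_coe_iff]
  -- the test tilt is `exp (-k w)`; the mean of `w` is `2 S² / 3 - η`, and `w exp (-k w) ≤ 1 / k`
  have h1 : ∫ p, -k * weight η (uniaxialQ S n) p * f p ∂sigma = -k * (2 * S ^ 2 / 3 - η) := by
    have h2 := integral_quad_mul_of_admissible hf (uniaxialQ S n)
    rw [contract_uniaxialQ, quad_uniaxialQ_self, (uniaxialQ S n).2.2] at h2
    simp only [weight, mul_assoc, sub_mul]
    rw [integral_const_mul, integral_sub (integrable_mul_of_continuous hf.1.1
      (continuous_quad_coe _)) (hf.1.1.const_mul _), integral_const_mul, hf.1.2.2, h2]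
    ring
  rw [h1]
  refine sub_le_sub_left (Real.log_le_log hZ ?_) _
  have h3 : partition η (uniaxialQ S n) (fun p => -k * weight η (uniaxialQ S n) p)
      ≤ ∫ _, k⁻¹ ∂sigma := by
    refine integral_mono (integrable_of_continuous (continuous_tilted _ _ hℓ))
      (integrable_const _) fun p => ?_
    simp only [tilted]
    rcases le_total (weight η (uniaxialQ S n) p) 0 with h | h
    · rw [max_eq_right h, zero_mul]; positivity
    · rw [max_eq_left h, neg_mul, Real.exp_neg, ← div_eq_mul_inv, div_le_iff₀ (Real.exp_pos _)]
      have h4 := Real.add_one_le_exp (k * weight η (uniaxialQ S n) p)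
      have h5 : weight η (uniaxialQ S n) p = k⁻¹ * (k * weight η (uniaxialQ S n) p) := by
        field_simp
      calc _ = k⁻¹ * (k * weight η (uniaxialQ S n) p) := h5
        _ ≤ _ := mul_le_mul_of_nonneg_left (by linarith) (by positivity)
  simpa [mul_comm] using h3

/-- Where `2 S² / 3 ≤ η` the linear bound is at least `ln k` up to a constant, for every `k`. -/
theorem J_uniaxialQ_eq_top {η S : ℝ} (n : S2) (h : 2 * S ^ 2 / 3 ≤ η) :
    J η (uniaxialQ S n) = ⊤ := by
  rw [EReal.eq_top_iff_forall_lt]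
  intro M
  have hσ := sigma_univ_pos
  -- with this `k` the logarithm in the linear bound is `-(M + 1)`
  have hk : 0 < Real.exp (M + 1) * sigma.real univ := by positivity
  refine lt_of_lt_of_le ?_ (linear_bound_le_J (η := η) (S := S) n hk)
  rw [EReal.coe_lt_coe_iff, mul_inv, mul_assoc, inv_mul_cancel₀ hσ.ne', mul_one, ← Real.exp_neg,
    Real.log_exp]
  nlinarith

/-- Concentration of a function `X` near its zero set costs an unbounded amount of entropy. -/
theorem exists_le_freeEnergy_of_concentration {X : S2 → ℝ} (hX : Continuous X)
    (hX0 : ∀ᵐ p ∂sigma, 0 < X p) (M : ℝ) :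
    ∃ δ > 0, ∀ (η : ℝ) (Q : Sym0) (f : S2 → ℝ), f ∈ admissible Q → (∀ p, weight η Q p ≤ 1) →
      ∫ p, X p * f p ∂sigma ≤ δ → (M : EReal) ≤ freeEnergy η f := by
  -- the test tilt is `exp (-k X)` with `k` large and `δ = 1 / k`
  have hlim : Tendsto (fun k : ℕ => ∫ p, Real.exp (-(k : ℝ) * X p) ∂sigma) atTop (𝓝 0) := by
    have h0 : ∫ _, (0 : ℝ) ∂sigma = 0 := by simp
    rw [← h0]
    refine tendsto_integral_of_dominated_convergence (fun _ => 1)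
      (fun k => (by fun_prop : Continuous _).aestronglyMeasurable) (integrable_const _)
      (fun k => ?_) ?_
    · filter_upwards [hX0] with p hp
      rw [Real.norm_eq_abs, Real.abs_exp, Real.exp_le_one_iff]
      have : 0 ≤ (k : ℝ) * X p := by positivity
      linarith
    · filter_upwards [hX0] with p hp
      refine Real.tendsto_exp_atBot.comp ?_
      simp only [neg_mul]
      exact tendsto_neg_atTop_atBot.comp (tendsto_natCast_atTop_atTop.atTop_mul_const hp)
  obtain ⟨k, hk, hk1⟩ := ((hlim.eventually_lt_const (Real.exp_pos (-(M + 1)))).and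
    (eventually_ge_atTop 1)).exists
  have hkpos : (0 : ℝ) < k := by exact_mod_cast hk1
  refine ⟨1 / k, by positivity, fun η Q f hf hw hXf => ?_⟩
  rcases eq_top_or_lt_top (freeEnergy η f) with hF | hF
  · simp [hF]
  have hℓ : Continuous fun p => -(k : ℝ) * X p := by fun_prop
  refine le_trans ?_ (gibbs_le_freeEnergy η hf hℓ)
  have hZ := partition_pos_of_freeEnergy_lt_top hf hF hℓ
  rw [EReal.coe_le_coe_iff]
  have h1 : -1 ≤ ∫ p, -(k : ℝ) * X p * f p ∂sigma := by
    simp only [mul_assoc]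
    rw [integral_const_mul]
    rw [le_div_iff₀ hkpos] at hXf
    linarith
  have h2 : partition η Q (fun p => -(k : ℝ) * X p) ≤ ∫ p, Real.exp (-(k : ℝ) * X p) ∂sigma := by
    refine integral_mono (integrable_of_continuous (continuous_tilted _ _ hℓ))
      (integrable_of_continuous (by fun_prop)) fun p => ?_
    simp only [tilted]
    have := mul_le_mul_of_nonneg_right (max_le (hw p) zero_le_one)
      (Real.exp_pos (-(k : ℝ) * X p)).le
    linarith
  have h3 := Real.log_le_log hZ (h2.trans hk.le)
  rw [Real.log_exp] at h3
  linarith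

/-- A continuous function on an open interval which is large near both ends attains its minimum. -/
theorem exists_isMinOn_Ioo {g : ℝ → ℝ} {a b : ℝ} (hab : a < b) (hg : ContinuousOn g (Ioo a b))
    (hblow : ∀ M, ∃ δ > 0, ∀ s ∈ Ioo a b, s < a + δ ∨ b - δ < s → M ≤ g s) :
    ∃ S ∈ Ioo a b, ∀ s ∈ Ioo a b, g S ≤ g s := by
  set c := (a + b) / 2 with hc
  obtain ⟨δ, hδ, hδM⟩ := hblow (g c)
  set ε := min δ ((b - a) / 2) with hε
  have hε0 : 0 < ε := lt_min hδ (by linarith)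
  have hε1 : ε ≤ (b - a) / 2 := min_le_right _ _
  have hsub : Icc (a + ε) (b - ε) ⊆ Ioo a b := fun s hs => ⟨by linarith [hs.1], by linarith [hs.2]⟩
  have hcmem : c ∈ Icc (a + ε) (b - ε) := ⟨by linarith, by linarith⟩
  obtain ⟨S, hS, hSmin⟩ := isCompact_Icc.exists_isMinOn ⟨c, hcmem⟩ (hg.mono hsub)
  refine ⟨S, hsub hS, fun s hs => ?_⟩
  by_cases hsI : s ∈ Icc (a + ε) (b - ε)
  · exact hSmin hsI
  · refine (hSmin hcmem).trans (hδM s hs ?_)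
    have : ε ≤ δ := min_le_left _ _
    by_contra! h
    exact hsI ⟨by linarith [h.1], by linarith [h.2]⟩

theorem J_eq_coe_toReal {η S : ℝ} (n : S2) (hS1 : -1 / 2 < S) (hS2 : S < 1)
    (hη : η < 2 * S ^ 2 / 3) :
    J η (uniaxialQ S n) = (((J η (uniaxialQ S n)).toReal : ℝ) : EReal) := by
  obtain ⟨lam, hZ, hf⟩ := exists_tilted_mem_admissible n hS1 hS2 hη
  rw [(isOptimal_tilted hZ hf).1, EReal.toReal_coe]

/-- If `J` blows up at both ends of an interval of parameters on which the uniaxial tensors are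
feasible, then it has a minimum there, and the minimiser is a critical point. -/
theorem exists_isCriticalPoint {η a b : ℝ} (n : S2) (hab : a < b)
    (hfin : ∀ s ∈ Ioo a b, -1 / 2 < s ∧ s < 1 ∧ s ≠ 0 ∧ η < 2 * s ^ 2 / 3)
    (hblow : ∀ M : ℝ, ∃ δ > 0, ∀ s ∈ Ioo a b, s < a + δ ∨ b - δ < s →
      (M : EReal) ≤ J η (uniaxialQ s n)) :
    ∃ S ∈ Ioo a b, (∀ s ∈ Ioo a b, J η (uniaxialQ S n) ≤ J η (uniaxialQ s n)) ∧
      IsCriticalPoint η (uniaxialQ S n) ∧ ∃ f, IsOptimal η (uniaxialQ S n) f := by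
  have hreal : ∀ s ∈ Ioo a b,
      J η (uniaxialQ s n) = (((J η (uniaxialQ s n)).toReal : ℝ) : EReal) := fun s hs =>
    have ⟨h1, h2, _, h4⟩ := hfin s hs
    J_eq_coe_toReal n h1 h2 h4
  obtain ⟨S, hS, hmin⟩ := exists_isMinOn_Ioo (g := fun s => (J η (uniaxialQ s n)).toReal) hab
    (fun s hs => by
      obtain ⟨h1, h2, h3, h4⟩ := hfin s hs
      obtain ⟨lam, hZ, hf⟩ := exists_tilted_mem_admissible n h1 h2 h4
      exact (continuousAt_J_uniaxialQ h3 n hZ hf).continuousWithinAt)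
    (fun M => by
      obtain ⟨δ, hδ, h⟩ := hblow M
      refine ⟨δ, hδ, fun s hs hs' => ?_⟩
      have := h s hs hs'
      rwa [hreal s hs, EReal.coe_le_coe_iff] at this)
  obtain ⟨h1, h2, h3, h4⟩ := hfin S hS
  obtain ⟨lam, hZ, hf⟩ := exists_tilted_mem_admissible n h1 h2 h4
  refine ⟨S, hS, fun s hs => ?_, isCriticalPoint_of_isLocalMin h3 n hZ hf ?_,
    _, (isOptimal_tilted hZ hf).2.1⟩
  · rw [hreal s hs, hreal S hS, EReal.coe_le_coe_iff]
    exact hmin s hs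
  · filter_upwards [Ioo_mem_nhds hS.1 hS.2] with s hs using hmin s hs

/-- `J` blows up at the parameters `c` where feasibility degenerates. -/
theorem exists_le_J_near_degenerate {η c : ℝ} (n : S2) (hc : 2 * c ^ 2 / 3 = η) (M : ℝ) :
    ∃ δ > 0, ∀ s : ℝ, |s - c| < δ → (M : EReal) ≤ J η (uniaxialQ s n) := by
  have hσ := sigma_univ_pos
  -- with this `k` the linear bound is `M + 1 - k (2 s² / 3 - η)`
  set k := Real.exp (M + 1) * sigma.real univ with hkdef
  have hk : 0 < k := by positivity
  have hcont : Continuous fun s : ℝ => k * (2 * s ^ 2 / 3 - η) := by fun_prop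
  have h0 : k * (2 * c ^ 2 / 3 - η) < 1 := by rw [hc]; simp
  obtain ⟨δ, hδ, h⟩ := Metric.eventually_nhds_iff.1
    (hcont.continuousAt.eventually_lt continuousAt_const h0)
  refine ⟨δ, hδ, fun s hs => le_trans ?_ (linear_bound_le_J (η := η) (S := s) n hk)⟩
  have h1 := h (y := s) (by rwa [Real.dist_eq])
  rw [EReal.coe_le_coe_iff, hkdef, mul_inv, mul_assoc, inv_mul_cancel₀ hσ.ne', mul_one,
    ← Real.exp_neg, Real.log_exp, ← hkdef]
  linarith

theorem sigma_inner_sq_eq (n : S2) (c : ℝ) :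
    sigma {p : S2 | (inner ℝ (n : E3) (p : E3)) ^ 2 = c} = 0 := by
  have := sigma_quad_eq (uniaxialQ 1 n).2.1 (uniaxialQ_ne_smul_one one_ne_zero n (c - 1 / 3))
  simpa [quad_uniaxialQ] using this

theorem inner_sq_le_one (n p : S2) : (inner ℝ (n : E3) (p : E3)) ^ 2 ≤ 1 := by
  have h := abs_real_inner_le_norm (n : E3) (p : E3)
  rw [norm_eq_of_mem_sphere, norm_eq_of_mem_sphere, mul_one] at h
  exact (sq_le_one_iff_abs_le_one _).2 h

theorem integral_inner_sq_mul {S : ℝ} {n : S2} {f : S2 → ℝ}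
    (hf : f ∈ admissible (uniaxialQ S n)) :
    ∫ p : S2, (inner ℝ (n : E3) (p : E3)) ^ 2 * f p ∂sigma = 1 / 3 + 2 * S / 3 := by
  have h := integral_quad_mul_of_admissible hf (uniaxialQ 1 n)
  rw [contract_uniaxialQ, quad_uniaxialQ_self, (uniaxialQ 1 n).2.2] at h
  simp only [quad_uniaxialQ, one_mul, sub_mul] at h
  rw [integral_sub (integrable_mul_of_continuous hf.1.1 (by fun_prop)) (hf.1.1.const_mul _),
    integral_const_mul, hf.1.2.2] at h
  linarith

theorem integral_one_sub_inner_sq_mul {S : ℝ} {n : S2} {f : S2 → ℝ}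
    (hf : f ∈ admissible (uniaxialQ S n)) :
    ∫ p : S2, (1 - (inner ℝ (n : E3) (p : E3)) ^ 2) * f p ∂sigma = 2 / 3 * (1 - S) := by
  simp only [sub_mul, one_mul]
  rw [integral_sub hf.1.1 (integrable_mul_of_continuous hf.1.1 (by fun_prop)),
    integral_inner_sq_mul hf, hf.1.2.2]
  ring

theorem weight_uniaxialQ_le_one {η S : ℝ} (hη : 0 ≤ η) (hS1 : -1 / 2 < S) (hS2 : S < 1)
    (n p : S2) : weight η (uniaxialQ S n) p ≤ 1 := by
  rw [weight_uniaxialQ]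
  have h1 := inner_sq_le_one n p
  have h2 := sq_nonneg (inner ℝ (n : E3) (p : E3) : ℝ)
  nlinarith

/-- For `s ≤ √(3 η / 2)` the value of `J` is infinite, so it suffices to minimise beyond. -/
theorem exists_prolate_minimiser {η : ℝ} (hη : 0 ≤ η) (hη' : η < 2 / 3) (n : S2) :
    ∃ S ∈ Ioo (0 : ℝ) 1, IsMinOn (fun s : ℝ => J η (uniaxialQ s n)) (Ioo (0 : ℝ) 1) S ∧
      IsCriticalPoint η (uniaxialQ S n) ∧ ∃ f, IsOptimal η (uniaxialQ S n) f := by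
  have h32 : 0 ≤ 3 * η / 2 := by positivity
  set c := √(3 * η / 2) with hc
  have hc0 : 0 ≤ c := Real.sqrt_nonneg _
  have hcsq : c ^ 2 = 3 * η / 2 := Real.sq_sqrt h32
  have hc1 : c < 1 := by nlinarith
  have hfeas : ∀ s ∈ Ioo c 1, η < 2 * s ^ 2 / 3 := fun s hs => by nlinarith [hs.1]
  obtain ⟨S, hS, hmin, hcrit, hopt⟩ := exists_isCriticalPoint (η := η) n hc1
    (fun s hs => ⟨by linarith [hs.1], hs.2, by linarith [hs.1], hfeas s hs⟩)
    (fun M => by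
      obtain ⟨δ₁, hδ₁, h1⟩ := exists_le_J_near_degenerate (η := η) (c := c) n (by linarith) M
      obtain ⟨δ₂, hδ₂, h2⟩ := exists_le_freeEnergy_of_concentration
        (X := fun p : S2 => 1 - (inner ℝ (n : E3) (p : E3)) ^ 2) (by fun_prop) (by
          filter_upwards [measure_eq_zero_iff_ae_notMem.1 (sigma_inner_sq_eq n 1)] with p hp
          exact sub_pos.2 (lt_of_le_of_ne (inner_sq_le_one n p) hp)) M
      refine ⟨min δ₁ δ₂, lt_min hδ₁ hδ₂, fun s hs hs' => ?_⟩
      rcases hs' with h | h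
      · refine h1 s ?_
        rw [abs_of_pos (by linarith [hs.1])]
        linarith [min_le_left δ₁ δ₂]
      · refine le_iInf₂ fun f hf => h2 η _ f hf (weight_uniaxialQ_le_one hη
          (by linarith [hs.1]) hs.2 n) ?_
        rw [integral_one_sub_inner_sq_mul hf]
        linarith [min_le_right δ₁ δ₂, hs.2])
  refine ⟨S, ⟨hc0.trans_lt hS.1, hS.2⟩, fun s hs => ?_, hcrit, hopt⟩
  rcases lt_or_ge c s with h | h
  · exact hmin s ⟨h, hs.2⟩
  · simp only [Set.mem_ofPred_eq]
    rw [J_uniaxialQ_eq_top (S := s) n (by nlinarith [hs.1])]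
    exact le_top

/-- For `s ≥ -√(3 η / 2)` the value of `J` is infinite, so it suffices to minimise below. -/
theorem exists_oblate_minimiser {η : ℝ} (hη : 0 ≤ η) (hη' : η < 1 / 6) (n : S2) :
    ∃ S ∈ Ioo (-1 / 2 : ℝ) 0,
      IsMinOn (fun s : ℝ => J η (uniaxialQ s n)) (Ioo (-1 / 2 : ℝ) 0) S ∧
      IsCriticalPoint η (uniaxialQ S n) ∧ ∃ f, IsOptimal η (uniaxialQ S n) f := by
  have h32 : 0 ≤ 3 * η / 2 := by positivity
  set c := √(3 * η / 2) with hc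
  have hc0 : 0 ≤ c := Real.sqrt_nonneg _
  have hcsq : c ^ 2 = 3 * η / 2 := Real.sq_sqrt h32
  have hc1 : c < 1 / 2 := by nlinarith
  have hfeas : ∀ s ∈ Ioo (-1 / 2) (-c), η < 2 * s ^ 2 / 3 := fun s hs => by nlinarith [hs.2]
  obtain ⟨S, hS, hmin, hcrit, hopt⟩ := exists_isCriticalPoint (η := η) n
    (show -1 / 2 < -c by linarith)
    (fun s hs => ⟨hs.1, by linarith [hs.2], by linarith [hs.2], hfeas s hs⟩)
    (fun M => by
      obtain ⟨δ₁, hδ₁, h1⟩ := exists_le_J_near_degenerate (η := η) (c := -c) n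
        (by rw [neg_sq]; linarith) M
      obtain ⟨δ₂, hδ₂, h2⟩ := exists_le_freeEnergy_of_concentration
        (X := fun p : S2 => (inner ℝ (n : E3) (p : E3)) ^ 2) (by fun_prop) (by
          filter_upwards [measure_eq_zero_iff_ae_notMem.1 (sigma_inner_sq_eq n 0)] with p hp
          exact lt_of_le_of_ne (sq_nonneg _) (Ne.symm hp)) M
      refine ⟨min δ₁ δ₂, lt_min hδ₁ hδ₂, fun s hs hs' => ?_⟩
      rcases hs' with h | h
      · refine le_iInf₂ fun f hf => h2 η _ f hf (weight_uniaxialQ_le_one hη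
          hs.1 (by linarith [hs.2]) n) ?_
        rw [integral_inner_sq_mul hf]
        linarith [min_le_right δ₁ δ₂, hs.1]
      · refine h1 s ?_
        rw [abs_of_neg (by linarith [hs.2])]
        linarith [min_le_left δ₁ δ₂])
  refine ⟨S, ⟨hS.1, by linarith [hS.2]⟩, fun s hs => ?_, hcrit, hopt⟩
  rcases lt_or_ge s (-c) with h | h
  · exact hmin s ⟨hs.1, h⟩
  · simp only [Set.mem_ofPred_eq]
    rw [J_uniaxialQ_eq_top (S := s) n (by nlinarith [hs.2])]
    exact le_top

/-! ### Concentration of densities -/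

/-- By compactness `X` is bounded below off a neighbourhood of its zero set. -/
theorem exists_abs_sub_le_add_mul {X G : S2 → ℝ} (hX : Continuous X) (hX0 : ∀ p, 0 ≤ X p)
    (hG : Continuous G) {c : ℝ} (h : ∀ p, X p = 0 → G p = c) {ε : ℝ} (hε : 0 < ε) :
    ∃ C, 0 ≤ C ∧ ∀ p, |G p - c| ≤ ε + C * X p := by
  have hGc : Continuous fun p => |G p - c| := (hG.sub continuous_const).abs
  have hK : IsCompact {p | ε ≤ |G p - c|} := (isClosed_le continuous_const hGc).isCompact
  rcases Set.eq_empty_or_nonempty {p | ε ≤ |G p - c|} with he | hne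
  · refine ⟨0, le_rfl, fun p => ?_⟩
    have : p ∉ {p | ε ≤ |G p - c|} := by rw [he]; exact Set.notMem_empty p
    rw [zero_mul, add_zero]
    exact (not_le.1 this).le
  · obtain ⟨q, hq, hqmin⟩ := hK.exists_isMinOn hne hX.continuousOn
    obtain ⟨B, hB0, hB⟩ := exists_abs_le_of_continuous (hG.sub continuous_const (g := fun _ => c))
    have hXq : 0 < X q := by
      refine lt_of_le_of_ne (hX0 q) fun h0 => ?_
      have hq' : ε ≤ |G q - c| := hq
      rw [h q h0.symm, sub_self, abs_zero] at hq'
      linarith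
    refine ⟨B / X q, by positivity, fun p => ?_⟩
    by_cases hp : ε ≤ |G p - c|
    · have h1 : X q ≤ X p := hqmin hp
      have h2 : B ≤ B / X q * X p := by
        rw [div_mul_eq_mul_div, le_div_iff₀ hXq]
        exact mul_le_mul_of_nonneg_left h1 hB0
      have h3 : |G p - c| ≤ B := hB p
      linarith
    · have : 0 ≤ B / X q * X p := mul_nonneg (by positivity) (hX0 p)
      linarith

/-- Densities which concentrate on the zero set of `X` integrate a continuous function, constant
on that zero set, to that constant in the limit. -/
theorem tendsto_integral_of_concentration {F : ℕ → S2 → ℝ} (hF : ∀ j, IsDensity (F j))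
    {X G : S2 → ℝ} (hX : Continuous X) (hX0 : ∀ p, 0 ≤ X p) (hG : Continuous G) {c : ℝ}
    (h : ∀ p, X p = 0 → G p = c)
    (hlim : Tendsto (fun j => ∫ p, X p * F j p ∂sigma) atTop (𝓝 0)) :
    Tendsto (fun j => ∫ p, F j p * G p ∂sigma) atTop (𝓝 c) := by
  rw [Metric.tendsto_atTop]
  intro ε hε
  obtain ⟨C, hC, hb⟩ := exists_abs_sub_le_add_mul hX hX0 hG h (half_pos hε)
  have h2 : Tendsto (fun j => C * ∫ p, X p * F j p ∂sigma) atTop (𝓝 0) := by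
    simpa using hlim.const_mul C
  obtain ⟨N, hN⟩ := eventually_atTop.1 (h2.eventually_lt_const (half_pos hε))
  refine ⟨N, fun j hj => ?_⟩
  obtain ⟨hi, hnn, hone⟩ := hF j
  have i1 : Integrable (fun p => F j p * G p) sigma := by
    simpa only [mul_comm] using integrable_mul_of_continuous hi hG
  have e : ∫ p, F j p * G p ∂sigma - c = ∫ p, (G p - c) * F j p ∂sigma := by
    simp only [sub_mul]
    rw [integral_sub (integrable_mul_of_continuous hi hG) (hi.const_mul c), integral_const_mul,
      hone, mul_one]
    simp only [mul_comm]
  rw [Real.dist_eq, e]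
  have i2 := integrable_mul_of_continuous hi hX
  calc |∫ p, (G p - c) * F j p ∂sigma|
      ≤ ∫ p, (ε / 2 * F j p + C * (X p * F j p)) ∂sigma := by
        rw [← Real.norm_eq_abs]
        refine norm_integral_le_of_norm_le ((hi.const_mul _).add (i2.const_mul _)) ?_
        filter_upwards [hnn] with p hp
        rw [Real.norm_eq_abs, abs_mul, abs_of_nonneg hp]
        have := mul_le_mul_of_nonneg_right (hb p) hp
        linarith
    _ = ε / 2 + C * ∫ p, X p * F j p ∂sigma := by
        rw [integral_add (hi.const_mul _) (i2.const_mul _), integral_const_mul,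
          integral_const_mul, hone, mul_one]
    _ < ε := by linarith [hN j hj]

/-! ### Rotation of optimal densities -/

/-- Finiteness of `J` at a uniaxial tensor forces `2 S² / 3 > η`, and optimal densities are then
axisymmetric, being equal to the tilted density. -/
theorem optimal_axisymmetric {η S : ℝ} {n : S2} (hS1 : -1 / 2 < S) (hS2 : S < 1)
    (hcrit : IsCriticalPoint η (uniaxialQ S n)) {f : S2 → ℝ}
    (hf : IsOptimal η (uniaxialQ S n) f) :
    η < 2 * S ^ 2 / 3 ∧ ∃ h : ℝ → ℝ,
      (∀ᵐ p : S2 ∂sigma, f p = h (inner ℝ (n : E3) (p : E3))) ∧ ∀ t, h (-t) = h t := by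
  have hη : η < 2 * S ^ 2 / 3 := by
    by_contra! hle
    have h1 : J η (uniaxialQ S n) < ⊤ := by
      have h2 : uniaxialQ S n ∈ domJ η := interior_subset hcrit.1
      exact h2
    rw [J_uniaxialQ_eq_top n hle] at h1
    exact lt_irrefl _ h1
  refine ⟨hη, ?_⟩
  obtain ⟨lam, hZ, hadm⟩ := exists_tilted_mem_admissible n hS1 hS2 hη
  set Z := partition η (uniaxialQ S n) fun p => quad (uniaxialQ lam n) p
  refine ⟨fun t => max (S * (t ^ 2 - 1 / 3) - η) 0 * Real.exp (lam * (t ^ 2 - 1 / 3)) / Z, ?_,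
    fun t => by simp only [neg_sq]⟩
  filter_upwards [(isOptimal_tilted hZ hadm).2.2 f hf] with p hp
  rw [hp]
  simp only [tilted, weight_uniaxialQ, quad_uniaxialQ, Z]

theorem exists_unit_orthogonal (e : S2) : ∃ u : S2, inner ℝ (u : E3) (e : E3) = (0 : ℝ) := by
  obtain ⟨u, hu⟩ := exists_inner_sq_eq e le_rfl zero_le_one
  exact ⟨u, by rw [real_inner_comm]; exact pow_eq_zero_iff two_ne_zero |>.1 hu⟩

/-- The half-turn about `a` maps `e` to `n` if `a` is a suitable bisector. -/
theorem exists_half_turn_axis (e n : S2) :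
    ∃ a : S2, (2 * inner ℝ (a : E3) (e : E3)) • (a : E3) - e = n := by
  by_cases h : (e : E3) + n = 0
  · obtain ⟨a, ha⟩ := exists_unit_orthogonal e
    refine ⟨a, ?_⟩
    rw [ha, mul_zero, zero_smul, zero_sub]
    exact neg_eq_of_add_eq_zero_right h
  · have hpos : 0 < ‖(e : E3) + n‖ := norm_pos_iff.2 h
    have hmem : ‖(e : E3) + n‖⁻¹ • ((e : E3) + n) ∈ Metric.sphere (0 : E3) 1 := by
      rw [mem_sphere_zero_iff_norm, norm_smul, norm_inv, norm_norm, inv_mul_cancel₀ hpos.ne']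
    refine ⟨⟨_, hmem⟩, ?_⟩
    have hsq : ‖(e : E3) + n‖ ^ 2 = 2 * inner ℝ ((e : E3) + n) (e : E3) := by
      rw [norm_add_sq_real, norm_eq_of_mem_sphere, norm_eq_of_mem_sphere, inner_add_left,
        real_inner_self_eq_norm_sq, norm_eq_of_mem_sphere, real_inner_comm (e : E3) n]
      ring
    simp only [real_inner_smul_left, smul_smul]
    have : 2 * (‖(e : E3) + n‖⁻¹ * inner ℝ ((e : E3) + n) (e : E3)) * ‖(e : E3) + n‖⁻¹ = 1 := by
      field_simp
      linarith
    rw [this, one_smul, add_sub_cancel_left]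

/-- The rotation is a half-turn, given by the matrix `2 a ⊗ a - I`. -/
theorem exists_rotation (e n : S2) : ∃ (R : SO3) (L : E3 ≃ₗᵢ[ℝ] E3),
    (∀ p, rotate R p = sphereHomeo L p) ∧ L e = n := by
  obtain ⟨a, ha⟩ := exists_half_turn_axis e n
  have hsum := sum_sq_coe a
  have hR : (Matrix.of fun i j => 2 * ((a : E3) i * (a : E3) j)
      - (1 : Matrix (Fin 3) (Fin 3) ℝ) i j) ∈ Matrix.specialOrthogonalGroup (Fin 3) ℝ := by
    rw [Matrix.mem_specialOrthogonalGroup_iff, Matrix.mem_orthogonalGroup_iff]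
    constructor
    · clear ha
      ext i j
      simp only [Matrix.mul_apply, Fin.sum_univ_three, Matrix.of_apply]
      generalize (a : E3) = x at hsum ⊢
      generalize h0 : x 0 = x0 at hsum ⊢
      generalize h1 : x 1 = x1 at hsum ⊢
      generalize h2 : x 2 = x2 at hsum ⊢
      clear e n
      fin_cases i <;> fin_cases j <;> simp [h0, h1, h2, Matrix.one_apply] <;>
        first
        | linear_combination (4 * x0 * x0) * hsum
        | linear_combination (4 * x0 * x1) * hsum
        | linear_combination (4 * x0 * x2) * hsum
        | linear_combination (4 * x1 * x1) * hsum
        | linear_combination (4 * x1 * x2) * hsum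
        | linear_combination (4 * x2 * x2) * hsum
    · rw [Matrix.det_fin_three]
      simp
      linear_combination 2 * hsum
  let L : E3 ≃ₗᵢ[ℝ] E3 := Submodule.reflection (ℝ ∙ (a : E3))
  have hL : ∀ x : E3, L x = (2 * inner ℝ (a : E3) x) • (a : E3) - x := by
    intro x
    have := Submodule.reflection_singleton_apply (𝕜 := ℝ) (a : E3) x
    simp only [L]
    rw [this, norm_eq_of_mem_sphere]
    simp [two_smul, two_mul, add_smul]
  refine ⟨⟨_, hR⟩, L, fun p => ?_, by rw [hL, ha]⟩
  ext i
  simp only [rotate, coe_sphereHomeo, hL, inner_eq, Matrix.mulVec, dotProduct, Fin.sum_univ_three,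
    Matrix.of_apply, PiLp.sub_apply, PiLp.smul_apply, smul_eq_mul]
  fin_cases i <;> simp [Matrix.one_apply] <;> ring

/-- An optimal density for a uniaxial tensor can be rotated so that its axis is `e`. -/
theorem exists_rotateFun_axisymmetric {S : ℝ} {n : S2} {f : S2 → ℝ}
    (hf : f ∈ admissible (uniaxialQ S n)) {h : ℝ → ℝ}
    (hh : ∀ᵐ p : S2 ∂sigma, f p = h (inner ℝ (n : E3) (p : E3))) (e : S2) :
    ∃ R : SO3, IsDensity (rotateFun R f) ∧
      (∀ᵐ p : S2 ∂sigma, rotateFun R f p = h (inner ℝ (e : E3) (p : E3))) ∧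
      ∫ p : S2, (inner ℝ (e : E3) (p : E3)) ^ 2 * rotateFun R f p ∂sigma = 1 / 3 + 2 * S / 3 := by
  obtain ⟨R, L, hRL, hLe⟩ := exists_rotation e n
  have hfun : ∀ p, rotateFun R f p = f (sphereHomeo L p) := fun p => by rw [rotateFun, hRL]
  have hmp := measurePreserving_sphereHomeo L
  have hin : ∀ p : S2, inner ℝ (n : E3) (sphereHomeo L p : E3) = inner ℝ (e : E3) (p : E3) := by
    intro p
    rw [coe_sphereHomeo, ← hLe, LinearIsometryEquiv.inner_map_map]
  refine ⟨R, ⟨?_, ?_, ?_⟩, ?_, ?_⟩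
  · have : rotateFun R f = f ∘ (sphereHomeo L).toMeasurableEquiv := funext hfun
    rw [this]
    exact (hmp.integrable_comp_emb (MeasurableEquiv.measurableEmbedding _)).2 hf.1.1
  · filter_upwards [hmp.quasiMeasurePreserving.ae hf.1.2.1] with p hp
    rw [hfun]; exact hp
  · simp only [hfun]
    rw [integral_comp_sphereHomeo L f, hf.1.2.2]
  · filter_upwards [hmp.quasiMeasurePreserving.ae hh] with p hp
    rw [hfun, ← hin]; exact hp
  · simp only [hfun, ← hin]
    rw [integral_comp_sphereHomeo L fun p => (inner ℝ (n : E3) (p : E3)) ^ 2 * f p,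
      integral_inner_sq_mul hf]

/-- An axisymmetric density does not distinguish test functions which differ by a symmetry of it. -/
theorem integral_comp_of_axisymmetric {F : S2 → ℝ} {h : ℝ → ℝ} {e : S2}
    (hF : ∀ᵐ p : S2 ∂sigma, F p = h (inner ℝ (e : E3) (p : E3))) (L : E3 ≃ₗᵢ[ℝ] E3)
    (hL : ∀ p : S2, h (inner ℝ (e : E3) (L p)) = h (inner ℝ (e : E3) (p : E3))) (g : S2 → ℝ) :
    ∫ p, F p * g (sphereHomeo L p) ∂sigma = ∫ p, F p * g p ∂sigma := by
  have h1 : ∫ p, F p * g p ∂sigma = ∫ p : S2, h (inner ℝ (e : E3) (p : E3)) * g p ∂sigma :=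
    integral_congr_ae (hF.mono fun p hp => by simp only [hp])
  rw [h1, ← integral_comp_sphereHomeo L fun p : S2 => h (inner ℝ (e : E3) (p : E3)) * g p]
  refine integral_congr_ae (hF.mono fun p hp => ?_)
  simp only [hp, coe_sphereHomeo, hL]

/-! ### The limit of prolate critical points -/

/-- Evenness distributes the mass equally between the two poles. -/
theorem weakStarTendsto_antipodalDirac {F : ℕ → S2 → ℝ} (hF : ∀ j, IsDensity (F j)) {e : S2}
    {h : ℕ → ℝ → ℝ} (hh : ∀ j, ∀ᵐ p : S2 ∂sigma, F j p = h j (inner ℝ (e : E3) (p : E3)))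
    (heven : ∀ j t, h j (-t) = h j t)
    (hlim : Tendsto (fun j => ∫ p : S2, (1 - (inner ℝ (e : E3) (p : E3)) ^ 2) * F j p ∂sigma)
      atTop (𝓝 0)) :
    WeakStarTendsto F (antipodalDirac e) := by
  intro g
  let N : E3 ≃ₗᵢ[ℝ] E3 := LinearIsometryEquiv.neg ℝ
  have hN : ∀ p, sphereHomeo N p = -p := fun p => by ext1; simp [N]
  have hG : Continuous fun p : S2 => 2⁻¹ * (g p + g (-p)) := by fun_prop
  have hc : ∫ p, g p ∂(antipodalDirac e) = 2⁻¹ * (g e + g (-e)) := by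
    unfold antipodalDirac
    rw [integral_smul_measure, integral_add_measure (integrable_dirac (by simp))
      (integrable_dirac (by simp)), integral_dirac, integral_dirac]
    simp
  rw [hc]
  have key := tendsto_integral_of_concentration hF
    (X := fun p : S2 => 1 - (inner ℝ (e : E3) (p : E3)) ^ 2) (by fun_prop)
    (fun p => sub_nonneg.2 (inner_sq_le_one e p)) hG (c := 2⁻¹ * (g e + g (-e)))
    (fun p hp => by
      have h1 : (inner ℝ (e : E3) (p : E3) - 1) * (inner ℝ (e : E3) (p : E3) + 1) = (0 : ℝ) := by
        linear_combination -hp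
      rcases mul_eq_zero.1 h1 with h2 | h2
      · have : (e : E3) = p := (inner_eq_one_iff_of_norm_eq_one (norm_eq_of_mem_sphere e)
          (norm_eq_of_mem_sphere p)).1 (sub_eq_zero.1 h2)
        rw [← Subtype.ext this]
      · have h3 : inner ℝ (e : E3) (p : E3) = (-1 : ℝ) := by linarith
        have : (e : E3) = -p := (inner_eq_neg_one_iff_of_norm_eq_one (norm_eq_of_mem_sphere e)
          (norm_eq_of_mem_sphere p)).1 h3
        have h4 : e = -p := Subtype.ext this
        rw [h4, neg_neg, add_comm]) hlim
  refine key.congr fun j => ?_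
  have h1 := integral_comp_of_axisymmetric (hh j) N (fun p => by simp [N, heven]) g
  simp only [hN] at h1
  have i1 : Integrable (fun p => F j p * g p) sigma := by
    simpa only [mul_comm] using integrable_mul_of_continuous (hF j).1 g.continuous
  have i2 : Integrable (fun p => F j p * g (-p)) sigma := by
    simpa only [mul_comm] using integrable_mul_of_continuous (hF j).1
      (show Continuous fun p => g (-p) by fun_prop)
  have e1 : ∀ p, F j p * (2⁻¹ * (g p + g (-p))) = 2⁻¹ * (F j p * g p + F j p * g (-p)) :=
    fun p => by ring
  simp only [e1]
  rw [integral_const_mul, integral_add i1 i2, h1]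
  ring

/-- Feasibility forces the order parameter to tend to `1`. -/
theorem prolate_saturation (η : ℕ → ℝ) (hη : Tendsto η atTop (𝓝 (2 / 3)))
    (Q : ℕ → Sym0) (hQ : ∀ j, IsProlate (Q j)) (hcrit : ∀ j, IsCriticalPoint (η j) (Q j))
    (f : ℕ → S2 → ℝ) (hf : ∀ j, IsOptimal (η j) (Q j) (f j)) (e : S2) :
    ∃ R : ℕ → SO3, WeakStarTendsto (fun j => rotateFun (R j) (f j)) (antipodalDirac e) := by
  choose n S hS hQS using hQ
  obtain rfl : Q = fun j => uniaxialQ (S j) (n j) := funext hQS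
  have hopt := fun j => optimal_axisymmetric (by linarith [(hS j).1]) (hS j).2 (hcrit j) (hf j)
  choose hfeas h hh heven using hopt
  choose R hden hax hmom using fun j => exists_rotateFun_axisymmetric (hf j).1 (hh j) e
  refine ⟨R, weakStarTendsto_antipodalDirac hden hax heven ?_⟩
  have hval : ∀ j, ∫ p : S2, (1 - (inner ℝ (e : E3) (p : E3)) ^ 2) * rotateFun (R j) (f j) p ∂sigma
      = 2 / 3 * (1 - S j) := by
    intro j
    simp only [sub_mul, one_mul]
    rw [integral_sub (hden j).1 (integrable_mul_of_continuous (hden j).1 (by fun_prop)),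
      hmom, (hden j).2.2]
    ring
  simp only [hval]
  -- feasibility gives `3 η / 2 < S ^ 2 < S < 1`
  have hlow : Tendsto (fun j => 3 / 2 * η j) atTop (𝓝 1) := by
    have := hη.const_mul (3 / 2 : ℝ)
    norm_num at this
    exact this
  have hS1 : Tendsto S atTop (𝓝 1) :=
    tendsto_of_tendsto_of_tendsto_of_le_of_le hlow tendsto_const_nhds
      (fun j => by
        have h1 := hfeas j
        have h2 := hS j
        change 3 / 2 * η j ≤ S j
        nlinarith [h2.1, h2.2])
      fun j => (hS j).2.le
  have := (hS1.const_sub 1).const_mul (2 / 3 : ℝ)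
  simpa using this

/-! ### The uniform measure on a great circle -/

/-- The unit-speed parametrisation `θ ↦ cos θ b₁ + sin θ b₂` of the great circle orthogonal to the
first vector of an orthonormal basis. -/
noncomputable def circleParam (b : OrthonormalBasis (Fin 3) ℝ E3) (θ : ℝ) : S2 :=
  ⟨Real.cos θ • b 1 + Real.sin θ • b 2, by
    rw [mem_sphere_zero_iff_norm]
    have h : ‖Real.cos θ • b 1 + Real.sin θ • b 2‖ ^ 2 = 1 := by
      rw [← real_inner_self_eq_norm_sq]
      simp only [inner_add_left, inner_add_right, real_inner_smul_left, real_inner_smul_right,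
        b.inner_eq_ite]
      simp
      nlinarith [Real.sin_sq_add_cos_sq θ]
    exact (pow_eq_one_iff_of_nonneg (norm_nonneg _) two_ne_zero).1 h⟩

theorem coe_circleParam (b : OrthonormalBasis (Fin 3) ℝ E3) (θ : ℝ) :
    (circleParam b θ : E3) = Real.cos θ • b 1 + Real.sin θ • b 2 := rfl

theorem continuous_circleParam (b : OrthonormalBasis (Fin 3) ℝ E3) :
    Continuous (circleParam b) := by
  refine Continuous.subtype_mk ?_ _
  exact (Real.continuous_cos.smul continuous_const).add (Real.continuous_sin.smul continuous_const)

theorem inner_circleParam (b : OrthonormalBasis (Fin 3) ℝ E3) (θ φ : ℝ) :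
    inner ℝ (circleParam b θ : E3) (circleParam b φ : E3) = Real.cos (θ - φ) := by
  simp only [coe_circleParam, inner_add_left, inner_add_right, real_inner_smul_left,
    real_inner_smul_right, b.inner_eq_ite, Real.cos_sub]
  simp
  ring

theorem lipschitzWith_circleParam (b : OrthonormalBasis (Fin 3) ℝ E3) :
    LipschitzWith 1 (circleParam b) := by
  refine LipschitzWith.of_dist_le_mul fun θ φ => ?_
  rw [NNReal.coe_one, one_mul, Subtype.dist_eq, dist_eq_norm, Real.dist_eq]
  refine abs_le_of_sq_le_sq' ?_ (abs_nonneg _) |>.2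
  rw [norm_sub_sq_real, inner_circleParam, norm_eq_of_mem_sphere, norm_eq_of_mem_sphere, sq_abs]
  have := Real.one_sub_sq_div_two_le_cos (x := θ - φ)
  linarith

theorem injOn_circleParam (b : OrthonormalBasis (Fin 3) ℝ E3) :
    InjOn (circleParam b) (Ioc (-Real.pi) Real.pi) := by
  intro θ hθ φ hφ h
  have hc := congrArg (fun p : S2 => inner ℝ (b 1) (p : E3)) h
  have hs := congrArg (fun p : S2 => inner ℝ (b 2) (p : E3)) h
  simp only [coe_circleParam, inner_add_right, real_inner_smul_right, b.inner_eq_ite] at hc hs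
  simp at hc hs
  -- the angle is the argument of a complex number determined by the point
  rw [← Complex.arg_cos_add_sin_mul_I hθ, ← Complex.arg_cos_add_sin_mul_I hφ]
  simp only [← Complex.ofReal_cos, ← Complex.ofReal_sin, hc, hs]

theorem image_circleParam (b : OrthonormalBasis (Fin 3) ℝ E3) :
    circleParam b '' Ioc (-Real.pi) Real.pi = {p : S2 | inner ℝ (b 0) (p : E3) = (0 : ℝ)} := by
  ext p
  constructor
  · rintro ⟨θ, -, rfl⟩
    change inner ℝ (b 0) (circleParam b θ : E3) = (0 : ℝ)
    simp [coe_circleParam, inner_add_right, real_inner_smul_right, b.inner_eq_ite]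
  · intro hp
    have hp0 : inner ℝ (b 0) (p : E3) = (0 : ℝ) := hp
    have hsum := b.sum_sq_norm_inner_right (p : E3)
    rw [norm_eq_of_mem_sphere, Fin.sum_univ_three, hp0] at hsum
    simp only [Real.norm_eq_abs, sq_abs] at hsum
    set x : ℝ := inner ℝ (b 1) (p : E3) with hx
    set y : ℝ := inner ℝ (b 2) (p : E3) with hy
    have hz : ‖(⟨x, y⟩ : ℂ)‖ = 1 := by
      rw [Complex.norm_def, Complex.normSq_mk, Real.sqrt_eq_one]
      nlinarith
    refine ⟨Complex.arg ⟨x, y⟩, Complex.arg_mem_Ioc _, ?_⟩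
    ext1
    have hne : (⟨x, y⟩ : ℂ) ≠ 0 := by rw [← norm_ne_zero_iff, hz]; exact one_ne_zero
    rw [coe_circleParam, Complex.cos_arg hne, Complex.sin_arg, hz, div_one, div_one]
    conv_rhs => rw [← b.sum_repr' (p : E3), Fin.sum_univ_three, hp0, zero_smul, zero_add]

/-- An arc has one-dimensional Hausdorff measure at least the length of its chord, by projection
onto the chord. -/
theorem chord_le_hausdorffMeasure (b : OrthonormalBasis (Fin 3) ℝ E3) (m : ℝ) {r : ℝ}
    (hr : 0 < r) :
    ENNReal.ofReal (2 * Real.sin r)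
      ≤ Measure.hausdorffMeasure 1 (circleParam b '' Ioc (m - r) (m + r)) := by
  -- the coordinate in the direction of the tangent at the midpoint of the arc
  let π : S2 → ℝ := fun p => inner ℝ (circleParam b (m + Real.pi / 2) : E3) (p : E3)
  have hπ : LipschitzWith 1 π := by
    refine LipschitzWith.of_dist_le_mul fun p q => ?_
    rw [NNReal.coe_one, one_mul, Real.dist_eq, ← inner_sub_right, Subtype.dist_eq, dist_eq_norm]
    refine (abs_real_inner_le_norm _ _).trans ?_
    rw [norm_eq_of_mem_sphere, one_mul]
  have hval : ∀ x, π (circleParam b (m + x)) = Real.sin x := fun x => by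
    simp only [π]
    rw [inner_circleParam, add_sub_add_left_eq_sub, Real.cos_pi_div_two_sub]
  have hsub : Ioo (-Real.sin r) (Real.sin r) ⊆ π '' (circleParam b '' Ioc (m - r) (m + r)) := by
    intro y hy
    rw [← Real.sin_neg] at hy
    obtain ⟨x, hx, rfl⟩ := intermediate_value_Ioo (show -r ≤ r by linarith)
      Real.continuous_sin.continuousOn hy
    exact ⟨_, ⟨m + x, ⟨by linarith [hx.1], by linarith [hx.2]⟩, rfl⟩, hval x⟩
  calc ENNReal.ofReal (2 * Real.sin r) = volume (Ioo (-Real.sin r) (Real.sin r)) := by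
        rw [Real.volume_Ioo]; congr 1; ring
    _ ≤ volume (π '' (circleParam b '' Ioc (m - r) (m + r))) := measure_mono hsub
    _ = Measure.hausdorffMeasure 1 (π '' (circleParam b '' Ioc (m - r) (m + r))) := by
        rw [hausdorffMeasure_real]
    _ ≤ _ := by
        have := hπ.hausdorffMeasure_image_le (d := 1) zero_le_one
          (circleParam b '' Ioc (m - r) (m + r))
        simpa using this

theorem measurableSet_image_circleParam (b : OrthonormalBasis (Fin 3) ℝ E3) {B : Set ℝ}
    (hB : MeasurableSet B) (hsub : B ⊆ Ioc (-Real.pi) Real.pi) :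
    MeasurableSet (circleParam b '' B) :=
  hB.image_of_continuousOn_injOn (continuous_circleParam b).continuousOn
    ((injOn_circleParam b).mono hsub)

/-- The total length of the circle is at least that of the chords of `N + 1` equal arcs, for
every `N`. -/
theorem two_pi_le_hausdorffMeasure (b : OrthonormalBasis (Fin 3) ℝ E3) :
    ENNReal.ofReal (2 * Real.pi)
      ≤ Measure.hausdorffMeasure 1 (circleParam b '' Ioc (-Real.pi) Real.pi) := by
  have hstep : ∀ N : ℕ, ENNReal.ofReal (2 * Real.pi * Real.sinc (Real.pi / (N + 1)))
      ≤ Measure.hausdorffMeasure 1 (circleParam b '' Ioc (-Real.pi) Real.pi) := by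
    intro N
    have hN : (0 : ℝ) < N + 1 := by positivity
    set r := Real.pi / (N + 1) with hr
    have hr0 : 0 < r := by positivity
    have hrN : (N + 1) * r = Real.pi := by rw [hr]; field_simp
    -- midpoints of `N + 1` arcs of half-length `r`
    let m : ℕ → ℝ := fun k => -Real.pi + (2 * k + 1) * r
    have hsub : ∀ k ∈ Finset.range (N + 1),
        Ioc (m k - r) (m k + r) ⊆ Ioc (-Real.pi) Real.pi := by
      intro k hk x hx
      have hk' : (k : ℝ) + 1 ≤ N + 1 := by exact_mod_cast Finset.mem_range.1 hk
      have hk0 : (0 : ℝ) ≤ k := by positivity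
      constructor
      · have := hx.1
        simp only [m] at this
        nlinarith
      · have := hx.2
        simp only [m] at this
        nlinarith
    have hdisj : ∀ k l : ℕ, k < l →
        Disjoint (Ioc (m k - r) (m k + r)) (Ioc (m l - r) (m l + r)) := by
      intro k l hkl
      rw [Set.disjoint_left]
      intro x hx hx'
      have hkl' : (k : ℝ) + 1 ≤ l := by exact_mod_cast hkl
      have h1 := hx.2
      have h2 := hx'.1
      simp only [m] at h1 h2
      nlinarith
    have hpd : (Finset.range (N + 1) : Set ℕ).PairwiseDisjoint
        fun k => circleParam b '' Ioc (m k - r) (m k + r) := by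
      intro k hk l hl hkl
      refine Set.disjoint_left.2 ?_
      rintro _ ⟨x, hx, rfl⟩ ⟨y, hy, hxy⟩
      obtain rfl := injOn_circleParam b (hsub l hl hy) (hsub k hk hx) hxy
      rcases lt_or_gt_of_ne hkl with h | h
      · exact Set.disjoint_left.1 (hdisj k l h) hx hy
      · exact Set.disjoint_left.1 (hdisj l k h) hy hx
    have hunion := measure_biUnion_finset (μ := (Measure.hausdorffMeasure 1 : Measure S2)) hpd
      fun k hk => measurableSet_image_circleParam b measurableSet_Ioc (hsub k hk)
    calc ENNReal.ofReal (2 * Real.pi * Real.sinc r)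
        = ∑ k ∈ Finset.range (N + 1), ENNReal.ofReal (2 * Real.sin r) := by
          rw [Finset.sum_const, Finset.card_range, nsmul_eq_mul, ← ENNReal.ofReal_natCast,
            ← ENNReal.ofReal_mul (by positivity), Real.sinc_of_ne_zero hr0.ne']
          congr 1
          push_cast
          rw [← hrN]
          field_simp
      _ ≤ ∑ k ∈ Finset.range (N + 1),
          Measure.hausdorffMeasure 1 (circleParam b '' Ioc (m k - r) (m k + r)) :=
          Finset.sum_le_sum fun k _ => chord_le_hausdorffMeasure b (m k) hr0
      _ = Measure.hausdorffMeasure 1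
          (⋃ k ∈ Finset.range (N + 1), circleParam b '' Ioc (m k - r) (m k + r)) := hunion.symm
      _ ≤ _ := measure_mono (Set.iUnion₂_subset fun k hk => Set.image_mono (hsub k hk))
  have hlim : Tendsto (fun N : ℕ => ENNReal.ofReal (2 * Real.pi *
      Real.sinc (Real.pi / (N + 1)))) atTop (𝓝 (ENNReal.ofReal (2 * Real.pi))) := by
    refine ENNReal.tendsto_ofReal ?_
    have h0 : Tendsto (fun N : ℕ => Real.pi / ((N : ℝ) + 1)) atTop (𝓝 0) :=
      tendsto_const_nhds.div_atTop (tendsto_natCast_atTop_atTop.atTop_add tendsto_const_nhds)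
    have h1 := (Real.continuous_sinc.tendsto 0).comp h0
    rw [Real.sinc_zero] at h1
    simpa using h1.const_mul (2 * Real.pi)
  exact le_of_tendsto hlim (Eventually.of_forall hstep)

/-- On the great circle `H¹` is arc length. The upper bound holds since the parametrisation is
1-Lipschitz; the lower bound follows from the total length and the upper bound on the complement. -/
theorem hausdorffMeasure_image_circleParam (b : OrthonormalBasis (Fin 3) ℝ E3) {B : Set ℝ}
    (hB : MeasurableSet B) (hsub : B ⊆ Ioc (-Real.pi) Real.pi) :
    Measure.hausdorffMeasure 1 (circleParam b '' B) = volume B := by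
  have hle : ∀ A : Set ℝ, Measure.hausdorffMeasure 1 (circleParam b '' A) ≤ volume A := by
    intro A
    have := (lipschitzWith_circleParam b).hausdorffMeasure_image_le (d := 1) zero_le_one A
    simpa [hausdorffMeasure_real] using this
  refine le_antisymm (hle B) ?_
  -- the complementary arc also has at most its length, while the total length is at least `2π`
  set I := Ioc (-Real.pi) Real.pi with hI
  have hvolI : volume I = ENNReal.ofReal (2 * Real.pi) := by
    rw [hI, Real.volume_Ioc]; congr 1; ring
  have hfin : volume (I \ B) ≠ ⊤ :=
    ne_top_of_le_ne_top (by rw [hvolI]; exact ENNReal.ofReal_ne_top) (measure_mono sdiff_subset)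
  have h1 : volume B + volume (I \ B) ≤
      Measure.hausdorffMeasure 1 (circleParam b '' B) + volume (I \ B) := by
    rw [measure_add_sdiff hB.nullMeasurableSet, Set.union_eq_self_of_subset_left hsub, hvolI]
    refine (two_pi_le_hausdorffMeasure b).trans ?_
    have hI' : circleParam b '' I = circleParam b '' B ∪ circleParam b '' (I \ B) := by
      rw [← Set.image_union, Set.union_sdiff_cancel hsub]
    rw [hI']
    exact (measure_union_le _ _).trans (by gcongr; exact hle _)
  exact (ENNReal.add_le_add_iff_right hfin).1 h1

theorem greatCircle_eq_map (b : OrthonormalBasis (Fin 3) ℝ E3) :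
    (Measure.hausdorffMeasure 1 : Measure S2).restrict {p : S2 | inner ℝ (b 0) (p : E3) = (0 : ℝ)}
      = (volume.restrict (Ioc (-Real.pi) Real.pi)).map (circleParam b) := by
  ext A hA
  have hpre := (continuous_circleParam b).measurable hA
  rw [Measure.restrict_apply hA, Measure.map_apply (continuous_circleParam b).measurable hA,
    Measure.restrict_apply hpre, ← image_circleParam, ← Set.image_preimage_inter]
  exact hausdorffMeasure_image_circleParam b (hpre.inter measurableSet_Ioc) Set.inter_subset_right

theorem integral_greatCircleMeasure (b : OrthonormalBasis (Fin 3) ℝ E3) {e : S2} (he : b 0 = e)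
    (g : C(S2, ℝ)) :
    ∫ p, g p ∂(greatCircleMeasure e)
      = 1 / (2 * Real.pi) * ∫ θ in (-Real.pi)..Real.pi, g (circleParam b θ) := by
  unfold greatCircleMeasure
  rw [← he, integral_smul_measure, greatCircle_eq_map,
    integral_map (continuous_circleParam b).aemeasurable g.continuous.aestronglyMeasurable,
    intervalIntegral.integral_of_le (by linarith [Real.pi_pos]),
    ENNReal.toReal_ofReal (by positivity), smul_eq_mul]

/-! ### The limit of oblate critical points -/

/-- The reflection in the plane orthogonal to the vector of angle `θ / 2` on the great circle. It
fixes the axis, and acts on the great circle by `φ ↦ θ - φ + π`. -/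
noncomputable def axialReflection (b : OrthonormalBasis (Fin 3) ℝ E3) (θ : ℝ) : E3 ≃ₗᵢ[ℝ] E3 :=
  Submodule.reflection (ℝ ∙ (circleParam b (θ / 2) : E3))ᗮ

theorem axialReflection_apply (b : OrthonormalBasis (Fin 3) ℝ E3) (θ : ℝ) (x : E3) :
    axialReflection b θ x
      = x - (2 * inner ℝ (circleParam b (θ / 2) : E3) x) • (circleParam b (θ / 2) : E3) := by
  unfold axialReflection
  rw [Submodule.reflection_orthogonal_apply, Submodule.reflection_singleton_apply,
    norm_eq_of_mem_sphere]
  simp [two_smul, two_mul, add_smul]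

theorem inner_axialReflection (b : OrthonormalBasis (Fin 3) ℝ E3) (θ : ℝ) (x : E3) :
    inner ℝ (b 0) (axialReflection b θ x) = inner ℝ (b 0) x := by
  rw [axialReflection_apply, inner_sub_right, real_inner_smul_right]
  have : inner ℝ (b 0) (circleParam b (θ / 2) : E3) = (0 : ℝ) := by
    simp [coe_circleParam, inner_add_right, real_inner_smul_right, b.inner_eq_ite]
  rw [this, mul_zero, sub_zero]

theorem sphereHomeo_axialReflection_circleParam (b : OrthonormalBasis (Fin 3) ℝ E3) (θ φ : ℝ) :
    sphereHomeo (axialReflection b θ) (circleParam b φ) = circleParam b (θ + (Real.pi - φ)) := by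
  ext1
  obtain ⟨α, rfl⟩ : ∃ α, θ = 2 * α := ⟨θ / 2, by ring⟩
  have hα : 2 * α / 2 = α := by ring
  have e : 2 * α + (Real.pi - φ) = (2 * α - φ) + Real.pi := by ring
  rw [coe_sphereHomeo, axialReflection_apply, inner_circleParam, hα, e]
  simp only [coe_circleParam, Real.cos_add_pi, Real.sin_add_pi]
  have h1 : Real.cos φ - 2 * Real.cos (α - φ) * Real.cos α = -Real.cos (2 * α - φ) := by
    simp only [Real.cos_sub, Real.cos_two_mul, Real.sin_two_mul]
    ring
  have h2 : Real.sin φ - 2 * Real.cos (α - φ) * Real.sin α = -Real.sin (2 * α - φ) := by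
    simp only [Real.cos_sub, Real.sin_sub, Real.cos_two_mul, Real.sin_two_mul]
    linear_combination (-2 * Real.sin φ) * Real.sin_sq_add_cos_sq α
  rw [← h1, ← h2]
  module

theorem continuous_axialReflection (b : OrthonormalBasis (Fin 3) ℝ E3) :
    Continuous fun x : S2 × ℝ => sphereHomeo (axialReflection b x.2) x.1 := by
  have h := continuous_circleParam b
  refine Continuous.subtype_mk (f := fun x : S2 × ℝ => axialReflection b x.2 x.1) ?_ _
  simp only [axialReflection_apply]
  fun_prop

theorem periodic_circleParam (b : OrthonormalBasis (Fin 3) ℝ E3) :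
    Function.Periodic (circleParam b) (2 * Real.pi) := fun θ => by
  ext1
  simp only [coe_circleParam, Real.cos_add_two_pi, Real.sin_add_two_pi]

/-- The average of a continuous function over the axial reflections. -/
noncomputable def axialAverage (b : OrthonormalBasis (Fin 3) ℝ E3) (g : C(S2, ℝ)) (p : S2) : ℝ :=
  1 / (2 * Real.pi) * ∫ θ in (-Real.pi)..Real.pi, g (sphereHomeo (axialReflection b θ) p)

theorem continuous_axialAverage (b : OrthonormalBasis (Fin 3) ℝ E3) (g : C(S2, ℝ)) :
    Continuous (axialAverage b g) := by
  refine continuous_const.mul ?_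
  exact intervalIntegral.continuous_parametric_intervalIntegral_of_continuous'
    (f := fun p θ => g (sphereHomeo (axialReflection b θ) p))
    (g.continuous.comp (continuous_axialReflection b)) _ _

/-- On the great circle the axial reflections act transitively, and the average over them is the
mean over the circle. -/
theorem axialAverage_circleParam (b : OrthonormalBasis (Fin 3) ℝ E3) (g : C(S2, ℝ)) (φ : ℝ) :
    axialAverage b g (circleParam b φ)
      = 1 / (2 * Real.pi) * ∫ θ in (-Real.pi)..Real.pi, g (circleParam b θ) := by
  unfold axialAverage
  congr 1
  simp only [sphereHomeo_axialReflection_circleParam]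
  rw [intervalIntegral.integral_comp_add_right (fun θ => g (circleParam b θ))]
  have hper : Function.Periodic (fun θ => g (circleParam b θ)) (2 * Real.pi) := fun θ => by
    simp only [periodic_circleParam b θ]
  have h := hper.intervalIntegral_add_eq (-Real.pi + (Real.pi - φ)) (-Real.pi)
  have e1 : -Real.pi + (Real.pi - φ) + 2 * Real.pi = Real.pi + (Real.pi - φ) := by ring
  have e2 : -Real.pi + 2 * Real.pi = Real.pi := by ring
  rwa [e1, e2] at h

/-- An axisymmetric density integrates `g` and its axial average to the same value. -/
theorem integral_mul_axialAverage (b : OrthonormalBasis (Fin 3) ℝ E3) {e : S2} (he : b 0 = e)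
    {F : S2 → ℝ} (hi : Integrable F sigma) {h : ℝ → ℝ}
    (hF : ∀ᵐ p : S2 ∂sigma, F p = h (inner ℝ (e : E3) (p : E3))) (g : C(S2, ℝ)) :
    ∫ p, F p * axialAverage b g p ∂sigma = ∫ p, F p * g p ∂sigma := by
  obtain ⟨C, -, hC⟩ := exists_abs_le_of_continuous g.continuous
  have hpi : -Real.pi ≤ Real.pi := by linarith [Real.pi_pos]
  have hint : Integrable (Function.uncurry fun (p : S2) (θ : ℝ) =>
      F p * g (sphereHomeo (axialReflection b θ) p))
      (sigma.prod (volume.restrict (Ioc (-Real.pi) Real.pi))) := by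
    have h1 : Integrable (fun x : S2 × ℝ => F x.1)
        (sigma.prod (volume.restrict (Ioc (-Real.pi) Real.pi))) := hi.comp_fst _
    have h2 : Continuous fun x : S2 × ℝ => g (sphereHomeo (axialReflection b x.2) x.1) :=
      g.continuous.comp (continuous_axialReflection b)
    have h3 := h1.bdd_mul (c := C) h2.aestronglyMeasurable (ae_of_all _ fun x => hC _)
    simpa only [Function.uncurry_def, mul_comm] using h3
  have e1 : ∀ p, F p * axialAverage b g p = 1 / (2 * Real.pi) *
      ∫ θ in Ioc (-Real.pi) Real.pi, F p * g (sphereHomeo (axialReflection b θ) p) := fun p => by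
    rw [axialAverage, intervalIntegral.integral_of_le hpi, integral_const_mul]
    ring
  simp only [e1]
  rw [integral_const_mul, integral_integral_swap hint]
  have e2 : ∀ θ : ℝ, ∫ p, F p * g (sphereHomeo (axialReflection b θ) p) ∂sigma
      = ∫ p, F p * g p ∂sigma := fun θ =>
    integral_comp_of_axisymmetric hF (axialReflection b θ)
      (fun p => by rw [← he, inner_axialReflection]) g
  simp only [e2]
  rw [setIntegral_const, Measure.real, Real.volume_Ioc, ENNReal.toReal_ofReal (by linarith),
    smul_eq_mul]
  field_simp
  ring

theorem exists_orthonormalBasis_zero_eq (e : S2) :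
    ∃ b : OrthonormalBasis (Fin 3) ℝ E3, b 0 = e := by
  have hv : Orthonormal ℝ (({0} : Set (Fin 3)).domRestrict fun _ => (e : E3)) := by
    constructor
    · intro i
      exact norm_eq_of_mem_sphere e
    · intro i j hij
      exact absurd (Subsingleton.elim i j) hij
  obtain ⟨b, hb⟩ := hv.exists_orthonormalBasis_extension_of_card_eq (by simp)
  exact ⟨b, hb 0 rfl⟩

/-- Axial symmetry distributes the mass uniformly over the great circle. -/
theorem weakStarTendsto_greatCircleMeasure {F : ℕ → S2 → ℝ} (hF : ∀ j, IsDensity (F j)) {e : S2}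
    {h : ℕ → ℝ → ℝ} (hh : ∀ j, ∀ᵐ p : S2 ∂sigma, F j p = h j (inner ℝ (e : E3) (p : E3)))
    (hlim : Tendsto (fun j => ∫ p : S2, (inner ℝ (e : E3) (p : E3)) ^ 2 * F j p ∂sigma)
      atTop (𝓝 0)) :
    WeakStarTendsto F (greatCircleMeasure e) := by
  intro g
  obtain ⟨b, hb⟩ := exists_orthonormalBasis_zero_eq e
  rw [integral_greatCircleMeasure b hb]
  refine (tendsto_integral_of_concentration hF
    (X := fun p : S2 => (inner ℝ (e : E3) (p : E3)) ^ 2) (by fun_prop)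
    (fun p => sq_nonneg _) (continuous_axialAverage b g) (fun p hp => ?_) hlim).congr
    fun j => integral_mul_axialAverage b hb (hF j).1 (hh j) g
  have hp' : p ∈ {p : S2 | inner ℝ (b 0) (p : E3) = (0 : ℝ)} := by
    rw [hb]
    exact pow_eq_zero_iff two_ne_zero |>.1 hp
  rw [← image_circleParam] at hp'
  obtain ⟨φ, -, rfl⟩ := hp'
  exact axialAverage_circleParam b g φ

/-- Feasibility forces the order parameter to tend to `-1/2`. -/
theorem oblate_saturation (η : ℕ → ℝ) (hη : Tendsto η atTop (𝓝 (1 / 6)))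
    (Q : ℕ → Sym0) (hQ : ∀ j, IsOblate (Q j)) (hcrit : ∀ j, IsCriticalPoint (η j) (Q j))
    (f : ℕ → S2 → ℝ) (hf : ∀ j, IsOptimal (η j) (Q j) (f j)) (e : S2) :
    ∃ R : ℕ → SO3, WeakStarTendsto (fun j => rotateFun (R j) (f j)) (greatCircleMeasure e) := by
  choose n S hS hQS using hQ
  obtain rfl : Q = fun j => uniaxialQ (S j) (n j) := funext hQS
  have hopt := fun j => optimal_axisymmetric (hS j).1 (by linarith [(hS j).2]) (hcrit j) (hf j)
  choose hfeas h hh heven using hopt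
  choose R hden hax hmom using fun j => exists_rotateFun_axisymmetric (hf j).1 (hh j) e
  refine ⟨R, weakStarTendsto_greatCircleMeasure hden hax ?_⟩
  simp only [hmom]
  -- feasibility gives `6 η < (2 S) ^ 2 < -2 S < 1`
  have hup : Tendsto (fun j => -3 * η j) atTop (𝓝 (-1 / 2)) := by
    have := hη.const_mul (-3 : ℝ)
    norm_num at this ⊢
    exact this
  have hS1 : Tendsto S atTop (𝓝 (-1 / 2)) :=
    tendsto_of_tendsto_of_tendsto_of_le_of_le tendsto_const_nhds hup
      (fun j => (hS j).1.le)
      fun j => by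
        have h1 := hfeas j
        have h2 := hS j
        change S j ≤ -3 * η j
        nlinarith [h2.1, h2.2]
  have := ((hS1.const_mul 2).div_const 3).const_add (1 / 3 : ℝ)
  norm_num at this
  simpa using this

end Onsager

theorem mainTheorem10 :
    -- prolate critical points, obtained by minimising along a uniaxial line
    (∀ η : ℝ, 0 ≤ η → η < 2 / 3 → ∀ n : Onsager.S2, ∃ S ∈ Ioo (0 : ℝ) 1,
      IsMinOn (fun s : ℝ => Onsager.J η (Onsager.uniaxialQ s n)) (Ioo (0 : ℝ) 1) S ∧
      Onsager.IsCriticalPoint η (Onsager.uniaxialQ S n) ∧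
      ∃ f : Onsager.S2 → ℝ, Onsager.IsOptimal η (Onsager.uniaxialQ S n) f) ∧
    -- their limit at saturation
    (∀ η : ℕ → ℝ, (∀ j, η j < 2 / 3) → Tendsto η atTop (𝓝 (2 / 3)) →
      ∀ Q : ℕ → Onsager.Sym0, (∀ j, Onsager.IsProlate (Q j)) →
      (∀ j, Onsager.IsCriticalPoint (η j) (Q j)) →
      ∀ f : ℕ → Onsager.S2 → ℝ, (∀ j, Onsager.IsOptimal (η j) (Q j) (f j)) →
      ∀ e : Onsager.S2, ∃ R : ℕ → Onsager.SO3,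
        Onsager.WeakStarTendsto (fun j => Onsager.rotateFun (R j) (f j))
          (Onsager.antipodalDirac e)) ∧
    -- oblate critical points, obtained by minimising along a uniaxial line
    (∀ η : ℝ, 0 ≤ η → η < 1 / 6 → ∀ n : Onsager.S2, ∃ S ∈ Ioo (-1 / 2 : ℝ) 0,
      IsMinOn (fun s : ℝ => Onsager.J η (Onsager.uniaxialQ s n)) (Ioo (-1 / 2 : ℝ) 0) S ∧
      Onsager.IsCriticalPoint η (Onsager.uniaxialQ S n) ∧
      ∃ f : Onsager.S2 → ℝ, Onsager.IsOptimal η (Onsager.uniaxialQ S n) f) ∧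
    -- their limit at saturation
    (∀ η : ℕ → ℝ, (∀ j, η j < 1 / 6) → Tendsto η atTop (𝓝 (1 / 6)) →
      ∀ Q : ℕ → Onsager.Sym0, (∀ j, Onsager.IsOblate (Q j)) →
      (∀ j, Onsager.IsCriticalPoint (η j) (Q j)) →
      ∀ f : ℕ → Onsager.S2 → ℝ, (∀ j, Onsager.IsOptimal (η j) (Q j) (f j)) →
      ∀ e : Onsager.S2, ∃ R : ℕ → Onsager.SO3,
        Onsager.WeakStarTendsto (fun j => Onsager.rotateFun (R j) (f j))
          (Onsager.greatCircleMeasure e)) := by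
  exact ⟨fun _ h1 h2 n => Onsager.exists_prolate_minimiser h1 h2 n,
    fun η _ hη Q hQ hcrit f hf e => Onsager.prolate_saturation η hη Q hQ hcrit f hf e,
    fun _ h1 h2 n => Onsager.exists_oblate_minimiser h1 h2 n,
    fun η _ hη Q hQ hcrit f hf e => Onsager.oblate_saturation η hη Q hQ hcrit f hf e⟩
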